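/- **Setting.** Let $X_t=f_t+\varepsilon_t$, $t=1,\dots,T$, with $f$ deterministic. Its change-points are the times $2\le t\le T$ with $f_t\ne f_{t-1}$, denoted $\eta_1<\dots<\eta_N$; put $\eta_0=1$, $\eta_{N+1}=T+1$. For $s\le b<e$ and $n=e-s+1$ let $$\tilde X_{s,e}^b=\sqrt{\tfrac{e-b}{n(b-s+1)}}\sum_{t=s}^b X_t-\sqrt{\tfrac{b-s+1}{n(e-b)}}\sum_{t=b+1}^e X_t .$$ **WBS2 algorithm** with parameter $\tilde M\ge1$. On a sub-domain $[s,e]$ with $s<e$: if $\tilde M\ge\frac12(e-s+1)(e-s)$, take all intervals $[s_m,e_m]\subseteq[s,e]$ with $s_m<e_m$; otherwise draw $\tilde M$ such intervals independently, with replacement, uniformly over all pairs $s\le s_m<e_m\le e$, independently of everything else. Let $(m_0,b)$ maximise $|\tilde X_{s_m,e_m}^{b}|$ over $m$ and $s_m\le b<e_m$; record $(s_{m_0},e_{m_0},b,|\tilde X_{s_{m_0},e_{m_0}}^{b}|)$ and apply the routine to $[s,b]$ and to $[b+1,e]$. Nothing is done on a sub-domain of length 1. Start from $[1,T]$ and finally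 sort the recorded elements by decreasing absolute CUSUM, giving the solution path $(s_k,e_k,b_k,|\tilde X_{s_k,e_k}^{b_k}|)_{k\ge 1}$. Ties in the maximisation and in the sorting may be broken in any way. Scale 1 consists of the sub-domain $[1,T]$, and scale $j+1$ of the sub-domains into which those of scale $j$ are split. Let $\Gamma_j$ be the length of the longest sub-domain at scale $j$ and $J=\min\{j\ge1:\Gamma_j=1\}-1$. **Theorem.** (i) For every data sequence of length $T\ge 1$, the solution path has length exactly $T-1$. (ii) There is an absolute constant $K$ such that, for every $T\ge2$, every $\tilde M\ge1$, all data and all draws, the computation of the solution path, including the sorting, takes at most $K\tilde M J T$ elementary steps (reading a data point, an arithmetic operation including square roots, a comparison, drawing a random number, a list operation on one cell), i.e. $O(\tilde MJT)$. (iii) For all $\sigma,\delta,\Delta>0$ there are constants $C_1,C_2,c_0>0$, depending only on $\Delta$, $\sigma$ and $\delta$, such that for all $\bar f$, $C>0$ and $\kappa>-1/2$ there is $T_0$ with the following property. Let $T\ge T_0$, $\tilde M\ge1$, and suppose that $\varepsilon_1,\dots,\varepsilon_T$ are i.i.d. $N(0,\sigma^2)$; $\min_{1\le i\le N+1}(\eta_i-\eta_{i-1})\ge\delta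 T$; $|f_t|\le\bar f$ for all $t$; and $|f_{\eta_i}-f_{\eta_i-1}|\ge\underline f_T$ for $1\le i\le N$, where $\underline f_T\ge CT^\kappa$. Let $\tilde\eta_1\le\dots\le\tilde\eta_N$ be $b_1,\dots,b_N$ sorted increasingly. Then, with probability at least $$1-\alpha_T-\tfrac12N(N+1)\bigl(2C_1\underline f_T^{-2}\log T+1\bigr)^2(1-\delta^2/9)^{\tilde M},$$ the following three properties hold simultaneously: $\max_{1\le i\le N}|\eta_i-\tilde\eta_i|\le C_1\underline f_T^{-2}\log T$; $|\tilde X_{s_k,e_k}^{b_k}|\ge c_0\,\underline f_T\,T^{1/2}$ for $1\le k\le N$; and $|\tilde X_{s_k,e_k}^{b_k}|\le C_2\log^{1/2}T$ for $N<k\le T-1$. Here $$\alpha_T=1-P\Bigl(\forall\,1\le l\le m\le T:\ (m-l+1)^{-1/2}\Bigl|\sum_{i=l}^m\varepsilon_i\Bigr|\le\sigma\{2(1+\Delta)\log T\}^{1/2}\Bigr).$$ -/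

import Mathlib

open MeasureTheory ProbabilityTheory

namespace WBS2

noncomputable section

/-! ## Step counting

Programs are written in a monad that records, next to the value, the number of elementary steps of a
real-number random access machine: reading one data point, one arithmetic operation, one comparison,
one random number, one list cell. -/

/-- A value together with the number of elementary steps spent on computing it. -/
structure Timed (α : Type) where
  val : α
  steps : ℕ

instance : Monad Timed where
  pure a := ⟨a, 0⟩
  bind x g := ⟨(g x.val).val, x.steps + (g x.val).steps⟩

/-- A straight-line computation of `a` that takes `k` elementary steps. -/
def ops {α : Type} (k : ℕ) (a : α) : Timed α := ⟨a, k⟩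

/-- One elementary step with result `a`. -/
def op {α : Type} (a : α) : Timed α := ops 1 a

/-! ## CUSUM statistics -/

/-- The CUSUM statistic of the data portion `x s, …, x e` at `b`, where `s ≤ b < e`. -/
def cusum (x : ℕ → ℝ) (s e b : ℕ) : ℝ :=
  √(((e : ℝ) - b) / (((e : ℝ) - s + 1) * ((b : ℝ) - s + 1))) * ∑ t ∈ Finset.Icc s b, x t
    - √(((b : ℝ) - s + 1) / (((e : ℝ) - s + 1) * ((e : ℝ) - b))) * ∑ t ∈ Finset.Icc (b + 1) e, x t

/-- An element `(s, e, b, v)` of a solution path: the interval `[s, e]`, the candidate `b`, and the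
absolute CUSUM `v` of `[s, e]` at `b`. -/
structure Entry where
  s : ℕ
  e : ℕ
  b : ℕ
  v : ℝ

/-! ## The WBS2 program

`x` is the data, `M` the maximum number of intervals drawn on a sub-domain, and `draw s e m` the
`m`-th interval drawn on the sub-domain `[s, e]`. Each sub-domain is visited at most once, so that
the draws made on it are fresh. `tie` decides between two entries with equal absolute CUSUMs; it is
arbitrary, so that every way of breaking ties (also a random one) is covered. -/

/-- Whether the entry `p` is placed before `q`: its absolute CUSUM is larger, or there is a tie and
`tie` decides in favour of `p`. -/
def precedes (tie : Entry → Entry → Bool) (p q : Entry) : Bool :=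
  decide (q.v < p.v) || (decide (q.v = p.v) && tie p q)

/-- Keep the better one of the new entry and the best one so far (if any). -/
def keepBest (tie : Entry → Entry → Bool) (new : Entry) : Option Entry → Timed (Option Entry)
  | none => op (some new)
  | some old => ops 3 (if precedes tie new old then some new else some old)

/-- Adds `x t, x (t + 1), …` (`k` terms) to `acc`. -/
def addUp (x : ℕ → ℝ) : (k t : ℕ) → (acc : ℝ) → Timed ℝ
  | 0, _, acc => op acc
  | k + 1, t, acc => do
    let y ← op (x t)
    let acc' ← op (acc + y)
    let t' ← op (t + 1)
    addUp x k t' acc'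

/-- Runs through `k` successive values of `b` on the interval `[s, e]` with total `tot`; `left` is the
sum of the data from `s` to `b - 1`. The best entry so far is updated with the absolute CUSUMs met. -/
def scan (x : ℕ → ℝ) (tie : Entry → Entry → Bool) (s e : ℕ) (tot : ℝ) :
    (k b : ℕ) → (left : ℝ) → Option Entry → Timed (Option Entry)
  | 0, _, _, best => op best
  | k + 1, b, left, best => do
    let y ← op (x b)
    let left' ← op (left + y)
    let right ← op (tot - left')
    let p ← op ((e : ℝ) - b)
    let q ← ops 2 ((b : ℝ) - s + 1)
    let n ← ops 2 ((e : ℝ) - s + 1)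
    let v ← ops 10 |√(p / (n * q)) * left' - √(q / (n * p)) * right|
    let best' ← keepBest tie ⟨s, e, b, v⟩ best
    let b' ← op (b + 1)
    scan x tie s e tot k b' left' best'

/-- Maximises the absolute CUSUMs over all intervals `[s, e]` of a list and all `s ≤ b < e`. -/
def scanList (x : ℕ → ℝ) (tie : Entry → Entry → Bool) :
    List (ℕ × ℕ) → Option Entry → Timed (Option Entry)
  | [], best => op best
  | (s, e) :: l, best => do
    let len ← op (e - s)
    let tot ← addUp x (len + 1) s 0
    let best' ← scan x tie s e tot len s 0 best
    scanList x tie l best'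

/-- Puts the intervals `[i, i + 1], …, [i, i + k]` in front of a list. -/
def rowIntervals (i : ℕ) : (k : ℕ) → List (ℕ × ℕ) → Timed (List (ℕ × ℕ))
  | 0, acc => op acc
  | k + 1, acc => do
    let j ← ops 2 (i + k + 1)
    let acc' ← op ((i, j) :: acc)
    rowIntervals i k acc'

/-- Puts all intervals `[i, j]` with `e - k ≤ i < j ≤ e` in front of a list. -/
def allIntervals (e : ℕ) : (k : ℕ) → List (ℕ × ℕ) → Timed (List (ℕ × ℕ))
  | 0, acc => op acc
  | k + 1, acc => do
    let i ← ops 2 (e - (k + 1))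
    let acc' ← rowIntervals i (k + 1) acc
    allIntervals e k acc'

/-- Puts `m` intervals drawn on `[s, e]` in front of a list. -/
def drawIntervals (draw : ℕ → ℕ → ℕ → ℕ × ℕ) (s e : ℕ) :
    (m : ℕ) → List (ℕ × ℕ) → Timed (List (ℕ × ℕ))
  | 0, acc => op acc
  | m + 1, acc => do
    let p ← ops 2 (draw s e m)
    let acc' ← op (p :: acc)
    drawIntervals draw s e m acc'

/-- The search on one sub-domain `[s, e]`: all of its `n (n - 1) / 2` sub-intervals are examined if
there are at most `M` of them, and `M` drawn ones otherwise. -/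
def search (x : ℕ → ℝ) (M : ℕ) (draw : ℕ → ℕ → ℕ → ℕ × ℕ) (tie : Entry → Entry → Bool) (s e : ℕ) :
    Timed (Option Entry) := do
  let n ← ops 2 (e - s + 1)
  let all ← ops 4 (decide (n * (n - 1) / 2 ≤ M))
  let l ← if all then allIntervals e (e - s) [] else drawIntervals draw s e M []
  scanList x tie l none

/-- The recursive routine that produces the unsorted solution path on `[s, e]`. The test `hb` always
succeeds on intervals inside `[s, e]`; it makes termination evident. -/
def solPath (x : ℕ → ℝ) (M : ℕ) (draw : ℕ → ℕ → ℕ → ℕ × ℕ) (tie : Entry → Entry → Bool) (s e : ℕ) :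
    Timed (List Entry) := do
  let go ← ops 2 (decide (s < e))
  if go then do
    let best ← search x M draw tie s e
    match best with
    | none => op []
    | some p =>
      if _hb : s ≤ p.b ∧ p.b < e then do
        let l₁ ← solPath x M draw tie s p.b
        let l₂ ← solPath x M draw tie (p.b + 1) e
        ops (l₁.length + 4) (p :: (l₁ ++ l₂))
      else op []
  else op []
termination_by e - s
decreasing_by all_goals omega

/-- Merging of two lists of entries. -/
def merge (tie : Entry → Entry → Bool) : List Entry → List Entry → Timed (List Entry)
  | [], l₂ => op l₂
  | p :: l₁, [] => op (p :: l₁)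
  | p :: l₁, q :: l₂ => do
    let c ← ops 3 (precedes tie p q)
    if c then do
      let l ← merge tie l₁ (q :: l₂)
      op (p :: l)
    else do
      let l ← merge tie (p :: l₁) l₂
      op (q :: l)
termination_by l₁ l₂ => l₁.length + l₂.length

/-- Merge sort of a list of entries in the decreasing order of their absolute CUSUMs; cutting the
list into two halves takes a number of steps proportional to its length. -/
def sortPath (tie : Entry → Entry → Bool) (l : List Entry) : Timed (List Entry) :=
  if _h : l.length ≤ 1 then op l
  else do
    let _ ← ops (2 * l.length + 2) ()
    let l₁ ← sortPath tie (l.take (l.length / 2))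
    let l₂ ← sortPath tie (l.drop (l.length / 2))
    merge tie l₁ l₂
termination_by l.length
decreasing_by
  all_goals simp only [List.length_take, List.length_drop]
  all_goals omega

/-- The WBS2 algorithm on the data `x 1, …, x T`: the sorted solution path, with the number of
steps. -/
def wbs2 (x : ℕ → ℝ) (T M : ℕ) (draw : ℕ → ℕ → ℕ → ℕ × ℕ) (tie : Entry → Entry → Bool) :
    Timed (List Entry) := do
  let l ← solPath x M draw tie 1 T
  sortPath tie l

/-- The intervals drawn on the sub-domains of `[1, T]` are sub-intervals with at least two points. -/
def ValidDraws (T M : ℕ) (draw : ℕ → ℕ → ℕ → ℕ × ℕ) : Prop :=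
  ∀ s e m, 1 ≤ s → s < e → e ≤ T → m < M →
    s ≤ (draw s e m).1 ∧ (draw s e m).1 < (draw s e m).2 ∧ (draw s e m).2 ≤ e

/-! ## Scales -/

/-- The sub-domains into which a sub-domain is split (none if it has length 1). -/
def children (x : ℕ → ℝ) (M : ℕ) (draw : ℕ → ℕ → ℕ → ℕ × ℕ) (tie : Entry → Entry → Bool)
    (d : ℕ × ℕ) : List (ℕ × ℕ) :=
  if d.1 < d.2 then
    match (search x M draw tie d.1 d.2).val with
    | none => []
    | some p => [(d.1, p.b), (p.b + 1, d.2)]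
  else []

/-- The sub-domains `(s, e)` on which the algorithm operates at scale `i + 1`; scale 1 is `[1, T]`. -/
def domainsAt (x : ℕ → ℝ) (T M : ℕ) (draw : ℕ → ℕ → ℕ → ℕ × ℕ) (tie : Entry → Entry → Bool) :
    (i : ℕ) → List (ℕ × ℕ)
  | 0 => [(1, T)]
  | i + 1 => (domainsAt x T M draw tie i).flatMap (children x M draw tie)

/-- The length of the longest sub-domain at scale `j = 1, 2, …` (0 if there is none). -/
def Gam (x : ℕ → ℝ) (T M : ℕ) (draw : ℕ → ℕ → ℕ → ℕ × ℕ) (tie : Entry → Entry → Bool) (j : ℕ) : ℕ :=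
  ((domainsAt x T M draw tie (j - 1)).map (fun d => d.2 - d.1 + 1)).foldr max 0

/-- The number of scales, `min {j : Γ_j = 1} - 1`. -/
def numScales (x : ℕ → ℝ) (T M : ℕ) (draw : ℕ → ℕ → ℕ → ℕ × ℕ) (tie : Entry → Entry → Bool) : ℕ :=
  sInf {j : ℕ | 1 ≤ j ∧ Gam x T M draw tie j = 1} - 1

/-! ## The change-point model -/

/-- `η 1 < … < η N` are exactly the change-points of `f 1, …, f T`, the times `2 ≤ t ≤ T` with
`f t ≠ f (t - 1)`; moreover `η 0 = 1` and `η (N + 1) = T + 1`. -/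
structure IsChangePoints (f : ℕ → ℝ) (T N : ℕ) (η : ℕ → ℕ) : Prop where
  zero : η 0 = 1
  last : η (N + 1) = T + 1
  lt_succ : ∀ i ≤ N, η i < η (i + 1)
  jump_iff : ∀ t, 2 ≤ t → t ≤ T → (f t ≠ f (t - 1) ↔ ∃ i, 1 ≤ i ∧ i ≤ N ∧ η i = t)

/-- The assumptions on the signal: spacing at least `δ T`, bound `fbar`, and jump sizes at least
`fT ≥ C T ^ κ`. -/
structure SignalAssumptions (f : ℕ → ℝ) (T N : ℕ) (η : ℕ → ℕ) (δ fbar C κ fT : ℝ) : Prop where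
  changePoints : IsChangePoints f T N η
  spacing : ∀ i, 1 ≤ i → i ≤ N + 1 → δ * T ≤ (η i : ℝ) - η (i - 1)
  bounded : ∀ t, 1 ≤ t → t ≤ T → |f t| ≤ fbar
  jumps : ∀ i, 1 ≤ i → i ≤ N → fT ≤ |f (η i) - f (η i - 1)|
  rate : C * (T : ℝ) ^ κ ≤ fT

/-- `ε 1, …, ε T` are independent `N(0, σ²)`. -/
structure IsGaussianNoise {Ω : Type*} [MeasurableSpace Ω] (μ : Measure Ω) (T : ℕ) (σ : ℝ)
    (ε : ℕ → Ω → ℝ) : Prop where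
  law : ∀ t, 1 ≤ t → t ≤ T → HasLaw (ε t) (gaussianReal 0 (σ ^ 2).toNNReal) μ
  indep : iIndepFun (fun t : Set.Icc 1 T => ε t) μ

/-- The draws: `(s, e, m)` stands for the `m`-th draw on the sub-domain `[s, e]` of `[1, T]`. -/
abbrev Slot (T M : ℕ) : Type :=
  {q : ℕ × ℕ × ℕ // 1 ≤ q.1 ∧ q.1 < q.2.1 ∧ q.2.1 ≤ T ∧ q.2.2 < M}

/-- On each sub-domain `[s, e]`, the start- and end-points are drawn uniformly subject to
`s ≤ s' < e' ≤ e`; all draws are independent of each other and of the noise. -/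
structure IsUniformDraws {Ω : Type*} [MeasurableSpace Ω] (μ : Measure Ω) (T M : ℕ)
    (ε : ℕ → Ω → ℝ) (D : ℕ → ℕ → ℕ → Ω → ℕ × ℕ) : Prop where
  law : ∀ s e m, 1 ≤ s → s < e → e ≤ T → m < M →
    HasLaw (D s e m) (uniformOn {p : ℕ × ℕ | s ≤ p.1 ∧ p.1 < p.2 ∧ p.2 ≤ e}) μ
  indep : iIndepFun (fun q : Slot T M => D q.1.1 q.1.2.1 q.1.2.2) μ
  indep_noise : IndepFun (fun ω (t : Set.Icc 1 T) => ε t ω)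
    (fun ω (q : Slot T M) => D q.1.1 q.1.2.1 q.1.2.2 ω) μ

/-- The event that all standardised partial sums of the noise are at most
`σ (2 (1 + Δ) log T)^{1/2}`. -/
def noiseEvent {Ω : Type*} (T : ℕ) (σ Δ : ℝ) (ε : ℕ → Ω → ℝ) : Set Ω :=
  {ω | ∀ l m : ℕ, 1 ≤ l → l ≤ m → m ≤ T →
    (√((m : ℝ) - l + 1))⁻¹ * |∑ i ∈ Finset.Icc l m, ε i ω| ≤ σ * √(2 * (1 + Δ) * Real.log T)}

/-- The first `N` candidates of a sorted solution path, in increasing order. -/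
def firstCandidates (N : ℕ) (P : List Entry) : List ℕ :=
  ((P.take N).map Entry.b).insertionSort (· ≤ ·)

/-- What is claimed about a sorted solution path `P` of the data `x`: the `N` first candidates are
`C₁ fT⁻² log T`-close to the change-points, their absolute CUSUMs are at least `c₀ fT T^{1/2}`, and
the later ones are at most `C₂ log^{1/2} T`. -/
def GoodPath (x : ℕ → ℝ) (T N : ℕ) (η : ℕ → ℕ) (fT C₁ C₂ c₀ : ℝ) (P : List Entry) : Prop :=
  (∀ i, 1 ≤ i → i ≤ N →
    |(η i : ℝ) - ((firstCandidates N P).getD (i - 1) 0 : ℕ)| ≤ C₁ * (fT ^ 2)⁻¹ * Real.log T) ∧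
  (∀ k (hk : k < P.length), k < N →
    c₀ * fT * √(T : ℝ) ≤ |cusum x P[k].s P[k].e P[k].b|) ∧
  (∀ k (hk : k < P.length), N ≤ k →
    |cusum x P[k].s P[k].e P[k].b| ≤ C₂ * √(Real.log T))

/-- The event that the WBS2 solution path of the data `f t + ε t` is good, however ties are broken. -/
def goodEvent {Ω : Type*} (f : ℕ → ℝ) (T M N : ℕ) (η : ℕ → ℕ) (fT C₁ C₂ c₀ : ℝ)
    (ε : ℕ → Ω → ℝ) (D : ℕ → ℕ → ℕ → Ω → ℕ × ℕ) : Set Ω :=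
  {ω | ∀ tie : Entry → Entry → Bool,
    GoodPath (fun t => f t + ε t ω) T N η fT C₁ C₂ c₀
      (wbs2 (fun t => f t + ε t ω) T M (fun s e m => D s e m ω) tie).val}

end

end WBS2

open WBS2

/-! Parts (i) and (ii) only use that every search on a sub-domain of length at least 2 returns an
admissible split. Each split records one entry and leaves two non-empty pieces, hence `T - 1`
entries. The sub-domains of one scale are disjoint and a search on length `n` costs `O(M n)`, so a
scale costs `O(M T)`. Splitting is binary, hence `T ≤ 2 ^ J`, and the `O(T log T)` steps of the
merge sort are absorbed into `M J T`.

Part (iii) is deterministic on the intersection of two events: all partial sums of the noise have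
standardised size `O(√(log T))` (`noiseEvent`), and on every sub-domain whose ends are accurate
estimates some draw surrounds the largest remaining jump (`DrawsSucceed`). The possible sub-domains
form a list fixed in advance, so a union bound over it deals with the adaptivity of the recursion
(`measure_not_drawsSucceed_le`).

The analytic core is `localization`. Between two jumps of a piecewise constant signal, the CUSUM is
a function `v / z + u * z` of the ratio `z` of weights. From a noisy maximiser, move towards the
side with the larger of `u`, `v`: the curve rises at a rate proportional to the maximum `V`, so the
next jump must be near. Comparing this rise with the change of the noise, which is of order `r √(z²
- 1)`, gives a distance of order `r² T / V²`.

The errors must not accumulate along the recursion. A sub-domain between estimates of `η i` and `η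
j` may contain remnants of the neighbouring segments. The signal is replaced by `clamped`, which has
no such remnants, and the difference is counted as noise. This raises the global noise level to `lam
+ 2 √A`, but the difference vanishes near the inner jumps, and only the local level `lam` enters the
rate. Hence the same bound `A` for error times squared jump holds at every depth
(`Regime.best_spec`, `Regime.solPath_spec`). Once no change-point is left, all CUSUMs are of noise
size, so a threshold separates the `N` detections from the rest and sorting puts them first
(`Regime.goodPath`). -/

namespace WBS2


/-! ## Values and step counts of timed computations -/

@[simp] lemma pure_val {α : Type} (a : α) : (pure a : Timed α).val = a := rfl
@[simp] lemma pure_steps {α : Type} (a : α) : (pure a : Timed α).steps = 0 := rfl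
@[simp] lemma bind_val {α β : Type} (x : Timed α) (g : α → Timed β) :
    (x >>= g).val = (g x.val).val := rfl
@[simp] lemma bind_steps {α β : Type} (x : Timed α) (g : α → Timed β) :
    (x >>= g).steps = x.steps + (g x.val).steps := rfl
@[simp] lemma ops_val {α : Type} (k : ℕ) (a : α) : (ops k a).val = a := rfl
@[simp] lemma ops_steps {α : Type} (k : ℕ) (a : α) : (ops k a).steps = k := rfl
@[simp] lemma op_val {α : Type} (a : α) : (op a).val = a := rfl
@[simp] lemma op_steps {α : Type} (a : α) : (op a).steps = 1 := rfl

/-! ## The search for the largest absolute CUSUM -/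

/-- The entry of a solution path for the interval `[s, e]` and the candidate `b`. -/
noncomputable def cusumEntry (x : ℕ → ℝ) (s e b : ℕ) : Entry := ⟨s, e, b, |cusum x s e b|⟩

/-- `o` is an element of `S` with the largest absolute CUSUM, and `none` if `S` is empty. -/
def IsBest (S : Set Entry) : Option Entry → Prop
  | none => S = ∅
  | some p => p ∈ S ∧ ∀ q ∈ S, q.v ≤ p.v

lemma le_of_precedes {tie : Entry → Entry → Bool} {p q : Entry} (h : precedes tie p q = true) :
    q.v ≤ p.v := by
  simp only [precedes, Bool.or_eq_true, decide_eq_true_eq, Bool.and_eq_true] at h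
  rcases h with h | h
  · exact h.le
  · exact h.1.le

lemma le_of_not_precedes {tie : Entry → Entry → Bool} {p q : Entry}
    (h : ¬ precedes tie p q = true) : p.v ≤ q.v := by
  simp only [precedes, Bool.or_eq_true, decide_eq_true_eq, Bool.and_eq_true, not_or] at h
  exact not_lt.mp h.1

/-- `IsBest` asks for some maximiser and not for a particular one, so it survives every decision of
`tie`. No later argument has to look at ties. -/
lemma IsBest.keepBest {S : Set Entry} {o : Option Entry} (h : IsBest S o)
    (tie : Entry → Entry → Bool) (new : Entry) :
    IsBest (insert new S) (keepBest tie new o).val := by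
  cases o with
  | none =>
    simp only [IsBest] at h
    simp [WBS2.keepBest, IsBest, h]
  | some p =>
    simp only [WBS2.keepBest, ops_val]
    obtain ⟨hp, hq⟩ := h
    split_ifs with hc
    · refine ⟨Set.mem_insert _ _, fun q hqS => ?_⟩
      rcases hqS with rfl | hqS
      · exact le_rfl
      · exact (hq q hqS).trans (le_of_precedes hc)
    · refine ⟨Set.mem_insert_of_mem _ hp, fun q hqS => ?_⟩
      rcases hqS with rfl | hqS
      · exact le_of_not_precedes hc
      · exact hq q hqS

lemma keepBest_steps_le (tie : Entry → Entry → Bool) (new : Entry) (o : Option Entry) :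
    (keepBest tie new o).steps ≤ 3 := by
  cases o <;> simp [keepBest]

lemma addUp_val (x : ℕ → ℝ) (k t : ℕ) (acc : ℝ) :
    (addUp x k t acc).val = acc + ∑ i ∈ Finset.Ico t (t + k), x i := by
  induction k generalizing t acc with
  | zero => simp [addUp]
  | succ k ih =>
    simp only [addUp, bind_val, op_val, ih]
    rw [Finset.sum_eq_sum_Ico_succ_bot (by omega : t < t + (k + 1))]
    rw [show t + 1 + k = t + (k + 1) by ring]
    ring

lemma addUp_steps (x : ℕ → ℝ) (k t : ℕ) (acc : ℝ) : (addUp x k t acc).steps = 3 * k + 1 := by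
  induction k generalizing t acc with
  | zero => simp [addUp]
  | succ k ih =>
    simp only [addUp, bind_steps, op_steps, ih]
    ring

/-- Loop invariant: `left` is the sum over `[s, b - 1]`, so `tot - left'` is the right sum and the
computed `v` is the absolute CUSUM at `b`. -/
lemma scan_isBest (x : ℕ → ℝ) (tie : Entry → Entry → Bool) (s e : ℕ) (k b : ℕ) (hsb : s ≤ b)
    (hbe : b + k = e) (S : Set Entry) (o : Option Entry) (h : IsBest S o) :
    IsBest (S ∪ {p | ∃ c, b ≤ c ∧ c < e ∧ p = cusumEntry x s e c})
      (scan x tie s e (∑ i ∈ Finset.Icc s e, x i) k b (∑ i ∈ Finset.Ico s b, x i) o).val := by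
  induction k generalizing b S o with
  | zero =>
    have : {p | ∃ c, b ≤ c ∧ c < e ∧ p = cusumEntry x s e c} = ∅ := by
      ext p
      simp only [Set.mem_ofPred_eq, Set.mem_empty_iff_false, iff_false]
      rintro ⟨c, h1, h2, -⟩
      omega
    simpa [scan, this] using h
  | succ k ih =>
    simp only [scan, bind_val, op_val, ops_val]
    rw [← Finset.sum_Ico_succ_top hsb]
    have hr : (∑ i ∈ Finset.Icc s e, x i) - ∑ i ∈ Finset.Ico s (b + 1), x i
        = ∑ i ∈ Finset.Icc (b + 1) e, x i := by
      rw [← Finset.Ico_add_one_right_eq_Icc, ← Finset.Ico_add_one_right_eq_Icc,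
        ← Finset.sum_Ico_consecutive x (by omega : s ≤ b + 1) (by omega : b + 1 ≤ e + 1)]
      ring
    have hent : (⟨s, e, b, |√(((e : ℝ) - b) / (((e : ℝ) - s + 1) * ((b : ℝ) - s + 1)))
          * ∑ i ∈ Finset.Ico s (b + 1), x i
        - √(((b : ℝ) - s + 1) / (((e : ℝ) - s + 1) * ((e : ℝ) - b)))
          * ((∑ i ∈ Finset.Icc s e, x i) - ∑ i ∈ Finset.Ico s (b + 1), x i)|⟩ : Entry)
        = cusumEntry x s e b := by
      rw [hr, Finset.Ico_add_one_right_eq_Icc]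
      rfl
    rw [hent]
    have := ih (b + 1) (by omega) (by omega) _ _ (h.keepBest tie (cusumEntry x s e b))
    convert this using 1
    ext p
    simp only [Set.mem_union, Set.mem_ofPred_eq, Set.mem_insert_iff]
    constructor
    · rintro (hp | ⟨c, h1, h2, rfl⟩)
      · exact Or.inl (Or.inr hp)
      · rcases h1.eq_or_lt with rfl | h1
        · exact Or.inl (Or.inl rfl)
        · exact Or.inr ⟨c, h1, h2, rfl⟩
    · rintro ((rfl | hp) | ⟨c, h1, h2, rfl⟩)
      · exact Or.inr ⟨b, le_rfl, by omega, rfl⟩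
      · exact Or.inl hp
      · exact Or.inr ⟨c, by omega, h2, rfl⟩

lemma scan_steps_le (x : ℕ → ℝ) (tie : Entry → Entry → Bool) (s e : ℕ) (tot : ℝ) (k b : ℕ)
    (left : ℝ) (o : Option Entry) : (scan x tie s e tot k b left o).steps ≤ 22 * k + 1 := by
  induction k generalizing b left o with
  | zero => simp [scan]
  | succ k ih =>
    simp only [scan, bind_steps, op_steps, ops_steps, op_val, ops_val]
    refine le_trans (Nat.add_le_add_left (Nat.add_le_add_left (Nat.add_le_add_left
      (Nat.add_le_add_left (Nat.add_le_add_left (Nat.add_le_add_left (Nat.add_le_add_left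
      (Nat.add_le_add (keepBest_steps_le _ _ _) (Nat.add_le_add_left (ih _ _ _) _))
      _) _) _) _) _) _) _) ?_
    omega

lemma scanList_isBest (x : ℕ → ℝ) (tie : Entry → Entry → Bool) (l : List (ℕ × ℕ)) (S : Set Entry)
    (o : Option Entry) (h : IsBest S o) :
    IsBest (S ∪ {p | ∃ i ∈ l, ∃ c, i.1 ≤ c ∧ c < i.2 ∧ p = cusumEntry x i.1 i.2 c})
      (scanList x tie l o).val := by
  induction l generalizing S o with
  | nil => simpa [scanList] using h
  | cons i l ih =>
    obtain ⟨s, e⟩ := i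
    simp only [scanList, bind_val, op_val]
    have key : IsBest (S ∪ {p | ∃ c, s ≤ c ∧ c < e ∧ p = cusumEntry x s e c})
        (scan x tie s e (addUp x (e - s + 1) s 0).val (e - s) s 0 o).val := by
      rcases le_or_gt s e with hse | hse
      · have := scan_isBest x tie s e (e - s) s le_rfl (by omega) S o h
        rw [addUp_val, zero_add, show s + (e - s + 1) = e + 1 by omega,
          Finset.Ico_add_one_right_eq_Icc]
        simpa using this
      · have : {p | ∃ c, s ≤ c ∧ c < e ∧ p = cusumEntry x s e c} = ∅ := by
          ext p
          simp only [Set.mem_ofPred_eq, Set.mem_empty_iff_false, iff_false]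
          rintro ⟨c, h1, h2, -⟩
          omega
        rw [this, show e - s = 0 by omega]
        simpa [scan] using h
    convert ih _ _ key using 1
    ext p
    simp only [Set.mem_union, Set.mem_ofPred_eq, List.mem_cons, exists_eq_or_imp, or_assoc]

lemma scanList_steps_le (x : ℕ → ℝ) (tie : Entry → Entry → Bool) (l : List (ℕ × ℕ)) (n : ℕ)
    (hn : ∀ i ∈ l, i.2 - i.1 + 1 ≤ n) (o : Option Entry) :
    (scanList x tie l o).steps ≤ 31 * n * l.length + 1 := by
  induction l generalizing o with
  | nil => simp [scanList]
  | cons i l ih =>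
    obtain ⟨s, e⟩ := i
    simp only [scanList, bind_steps, op_steps, op_val, List.length_cons, addUp_steps]
    have h1 := hn (s, e) (by simp)
    have h2 := ih (fun i hi => hn i (by simp [hi]))
      (scan x tie s e (addUp x (e - s + 1) s 0).val (e - s) s 0 o).val
    have h3 := scan_steps_le x tie s e (addUp x (e - s + 1) s 0).val (e - s) s 0 o
    have h4 : 31 * n * (l.length + 1) = 31 * n * l.length + 31 * n := by ring
    simp only at h1
    omega

/-! ## The intervals examined on a sub-domain -/

lemma mem_rowIntervals (i k : ℕ) (acc : List (ℕ × ℕ)) (p : ℕ × ℕ) :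
    p ∈ (rowIntervals i k acc).val ↔ p ∈ acc ∨ (p.1 = i ∧ i < p.2 ∧ p.2 ≤ i + k) := by
  induction k generalizing acc with
  | zero =>
    simp only [rowIntervals, op_val]
    constructor
    · exact Or.inl
    · rintro (h | h)
      · exact h
      · omega
  | succ k ih =>
    simp only [rowIntervals, bind_val, ops_val, op_val, ih, List.mem_cons, Prod.ext_iff]
    constructor
    · rintro ((h | h) | h)
      · right; omega
      · exact Or.inl h
      · right; omega
    · rintro (h | h)
      · exact Or.inl (Or.inr h)
      · by_cases h' : p.2 = i + k + 1
        · exact Or.inl (Or.inl ⟨h.1, h'⟩)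
        · right; omega

lemma rowIntervals_steps (i k : ℕ) (acc : List (ℕ × ℕ)) :
    (rowIntervals i k acc).steps = 3 * k + 1 := by
  induction k generalizing acc with
  | zero => simp [rowIntervals]
  | succ k ih =>
    simp only [rowIntervals, bind_steps, ops_steps, op_steps, ih]
    ring

lemma rowIntervals_length (i k : ℕ) (acc : List (ℕ × ℕ)) :
    (rowIntervals i k acc).val.length = acc.length + k := by
  induction k generalizing acc with
  | zero => simp [rowIntervals]
  | succ k ih =>
    simp only [rowIntervals, bind_val, ops_val, op_val, ih, List.length_cons]
    ring

lemma mem_allIntervals (e k : ℕ) (hk : k ≤ e) (acc : List (ℕ × ℕ)) (p : ℕ × ℕ) :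
    p ∈ (allIntervals e k acc).val ↔ p ∈ acc ∨ (e - k ≤ p.1 ∧ p.1 < p.2 ∧ p.2 ≤ e) := by
  induction k generalizing acc with
  | zero =>
    simp only [allIntervals, op_val]
    constructor
    · exact Or.inl
    · rintro (h | h)
      · exact h
      · omega
  | succ k ih =>
    simp only [allIntervals, bind_val, ops_val, ih (by omega), mem_rowIntervals]
    constructor
    · rintro ((h | h) | h)
      · exact Or.inl h
      · right; omega
      · right; omega
    · rintro (h | h)
      · exact Or.inl (Or.inl h)
      · by_cases h' : p.1 = e - (k + 1)
        · left; right; omega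
        · right; omega

lemma allIntervals_steps_le (e k : ℕ) (acc : List (ℕ × ℕ)) :
    (allIntervals e k acc).steps ≤ 3 * (k * (k + 1)) + 1 := by
  induction k generalizing acc with
  | zero => simp [allIntervals]
  | succ k ih =>
    simp only [allIntervals, bind_steps, ops_steps, ops_val, rowIntervals_steps]
    have := ih (rowIntervals (e - (k + 1)) (k + 1) acc).val
    nlinarith

lemma allIntervals_length (e k : ℕ) (acc : List (ℕ × ℕ)) :
    2 * (allIntervals e k acc).val.length = 2 * acc.length + k * (k + 1) := by
  induction k generalizing acc with
  | zero => simp [allIntervals]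
  | succ k ih =>
    simp only [allIntervals, bind_val, ops_val, ih, rowIntervals_length]
    ring

lemma mem_drawIntervals (draw : ℕ → ℕ → ℕ → ℕ × ℕ) (s e m : ℕ) (acc : List (ℕ × ℕ))
    (p : ℕ × ℕ) :
    p ∈ (drawIntervals draw s e m acc).val ↔ p ∈ acc ∨ ∃ m' < m, p = draw s e m' := by
  induction m generalizing acc with
  | zero => simp [drawIntervals]
  | succ m ih =>
    simp only [drawIntervals, bind_val, ops_val, op_val, ih, List.mem_cons]
    constructor
    · rintro ((h | h) | ⟨m', h1, h2⟩)
      · exact Or.inr ⟨m, by omega, h⟩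
      · exact Or.inl h
      · exact Or.inr ⟨m', by omega, h2⟩
    · rintro (h | ⟨m', h1, h2⟩)
      · exact Or.inl (Or.inr h)
      · rcases (Nat.lt_succ_iff.mp h1).eq_or_lt with rfl | h1
        · exact Or.inl (Or.inl h2)
        · exact Or.inr ⟨m', h1, h2⟩

lemma drawIntervals_steps (draw : ℕ → ℕ → ℕ → ℕ × ℕ) (s e m : ℕ) (acc : List (ℕ × ℕ)) :
    (drawIntervals draw s e m acc).steps = 3 * m + 1 := by
  induction m generalizing acc with
  | zero => simp [drawIntervals]
  | succ m ih =>
    simp only [drawIntervals, bind_steps, ops_steps, op_steps, ih]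
    ring

lemma drawIntervals_length (draw : ℕ → ℕ → ℕ → ℕ × ℕ) (s e m : ℕ) (acc : List (ℕ × ℕ)) :
    (drawIntervals draw s e m acc).val.length = acc.length + m := by
  induction m generalizing acc with
  | zero => simp [drawIntervals]
  | succ m ih =>
    simp only [drawIntervals, bind_val, ops_val, op_val, ih, List.length_cons]
    ring

/-- The intervals examined on the sub-domain `[s, e]`. -/
noncomputable def intervals (M : ℕ) (draw : ℕ → ℕ → ℕ → ℕ × ℕ) (s e : ℕ) : List (ℕ × ℕ) :=
  if (e - s + 1) * (e - s + 1 - 1) / 2 ≤ M then (allIntervals e (e - s) []).val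
  else (drawIntervals draw s e M []).val

/-- The entries met in the search on the sub-domain `[s, e]`. -/
def searched (x : ℕ → ℝ) (M : ℕ) (draw : ℕ → ℕ → ℕ → ℕ × ℕ) (s e : ℕ) : Set Entry :=
  {p | ∃ i ∈ intervals M draw s e, ∃ c, i.1 ≤ c ∧ c < i.2 ∧ p = cusumEntry x i.1 i.2 c}

lemma search_isBest (x : ℕ → ℝ) (M : ℕ) (draw : ℕ → ℕ → ℕ → ℕ × ℕ) (tie : Entry → Entry → Bool)
    (s e : ℕ) : IsBest (searched x M draw s e) (search x M draw tie s e).val := by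
  have h := scanList_isBest x tie (intervals M draw s e) ∅ none (by simp [IsBest])
  rw [Set.empty_union] at h
  have hs : (search x M draw tie s e).val = (scanList x tie (intervals M draw s e) none).val := by
    by_cases hc : (e - s + 1) * (e - s + 1 - 1) / 2 ≤ M
    · simp only [search, intervals, hc, bind_val, ops_val, decide_true, if_true]
    · simp only [search, intervals, hc, bind_val, ops_val, decide_false, if_false,
        Bool.false_eq_true]
  rw [hs]
  exact h

/-- The condition of `ValidDraws` on the single sub-domain `[s, e]`. -/
def ValidOn (M : ℕ) (draw : ℕ → ℕ → ℕ → ℕ × ℕ) (s e : ℕ) : Prop :=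
  ∀ m < M, s ≤ (draw s e m).1 ∧ (draw s e m).1 < (draw s e m).2 ∧ (draw s e m).2 ≤ e

lemma ValidDraws.validOn {T M : ℕ} {draw : ℕ → ℕ → ℕ → ℕ × ℕ} (h : ValidDraws T M draw) {s e : ℕ}
    (hs : 1 ≤ s) (hse : s < e) (he : e ≤ T) : ValidOn M draw s e :=
  fun m hm => h s e m hs hse he hm

lemma ValidOn.mem_intervals {M : ℕ} {draw : ℕ → ℕ → ℕ → ℕ × ℕ} {s e : ℕ}
    (h : ValidOn M draw s e) (hse : s < e) {i : ℕ × ℕ} (hi : i ∈ intervals M draw s e) :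
    s ≤ i.1 ∧ i.1 < i.2 ∧ i.2 ≤ e := by
  unfold intervals at hi
  split_ifs at hi
  · rw [mem_allIntervals _ _ (by omega)] at hi
    simp only [List.not_mem_nil, false_or] at hi
    omega
  · rw [mem_drawIntervals] at hi
    simp only [List.not_mem_nil, false_or] at hi
    obtain ⟨m, hm, rfl⟩ := hi
    exact h m hm

/-- At least one interval with two points is examined, so the search cannot fail, and its split is
proper. Both `none` and the failing branch of `_hb` in `solPath` are thereby excluded. -/
lemma search_spec {x : ℕ → ℝ} {M : ℕ} {draw : ℕ → ℕ → ℕ → ℕ × ℕ} (tie : Entry → Entry → Bool)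
    {s e : ℕ} (hM : 1 ≤ M) (h : ValidOn M draw s e) (hse : s < e) :
    ∃ p, (search x M draw tie s e).val = some p ∧ p ∈ searched x M draw s e ∧
      (∀ q ∈ searched x M draw s e, q.v ≤ p.v) ∧ s ≤ p.b ∧ p.b < e := by
  have hb := search_isBest x M draw tie s e
  have hne : ∃ i, i ∈ intervals M draw s e := by
    unfold intervals
    split_ifs
    · exact ⟨(s, e), by rw [mem_allIntervals _ _ (by omega)]; simp only; right; omega⟩
    · exact ⟨draw s e 0, by rw [mem_drawIntervals]; exact Or.inr ⟨0, by omega, rfl⟩⟩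
  obtain ⟨i, hi⟩ := hne
  have hi' := h.mem_intervals hse hi
  cases ho : (search x M draw tie s e).val with
  | none =>
    rw [ho] at hb
    have : cusumEntry x i.1 i.2 i.1 ∈ searched x M draw s e := ⟨i, hi, i.1, le_rfl, hi'.2.1, rfl⟩
    rw [hb] at this
    exact this.elim
  | some p =>
    rw [ho] at hb
    refine ⟨p, rfl, hb.1, hb.2, ?_⟩
    obtain ⟨j, hj, c, h1, h2, rfl⟩ := hb.1
    have hj' := h.mem_intervals hse hj
    simp only [cusumEntry]
    omega

lemma search_steps_le (x : ℕ → ℝ) {M : ℕ} {draw : ℕ → ℕ → ℕ → ℕ × ℕ} (tie : Entry → Entry → Bool)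
    {s e : ℕ} (hM : 1 ≤ M) (h : ValidOn M draw s e) (hse : s < e) :
    (search x M draw tie s e).steps ≤ 45 * (M * (e - s + 1)) := by
  have h1 := scanList_steps_le x tie (intervals M draw s e) (e - s + 1)
    (fun i hi => by have := h.mem_intervals hse hi; omega) none
  have hMn : M * 2 ≤ M * (e - s + 1) := Nat.mul_le_mul_left _ (by omega)
  have hlen : (intervals M draw s e).length ≤ M ∧ (search x M draw tie s e).steps
      ≤ 6 + (6 * M + 1 + (scanList x tie (intervals M draw s e) none).steps) := by
    by_cases hc : (e - s + 1) * (e - s + 1 - 1) / 2 ≤ M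
    · simp only [search, intervals, hc, bind_steps, ops_steps, ops_val, decide_true, if_true]
      have h2 := allIntervals_length e (e - s) []
      have h3 := allIntervals_steps_le e (e - s) []
      have h4 : (e - s + 1) * (e - s + 1 - 1) = (e - s) * (e - s + 1) := by
        rw [Nat.add_sub_cancel, mul_comm]
      -- Parity makes the truncated division by 2 exact, so that the exhaustive list has at most `M`
      -- elements and costs at most `6 * M + 1` steps to build.
      have h5 : 2 ∣ (e - s) * (e - s + 1) := (Nat.even_mul_succ_self (e - s)).two_dvd
      rw [h4] at hc
      simp only [List.length_nil] at h2
      constructor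
      · omega
      · generalize (scanList _ _ _ _).steps = z
        generalize (e - s) * (e - s + 1) = y at *
        omega
    · simp only [search, intervals, hc, bind_steps, ops_steps, ops_val, decide_false, if_false,
        Bool.false_eq_true]
      have h2 := drawIntervals_length draw s e M []
      have h3 := drawIntervals_steps draw s e M []
      simp only [List.length_nil] at h2
      constructor
      · omega
      · omega
  have h6 : 31 * (e - s + 1) * (intervals M draw s e).length ≤ 31 * (M * (e - s + 1)) := by
    have := Nat.mul_le_mul_left (31 * (e - s + 1)) hlen.1
    nlinarith
  omega

/-! ## The recursive routine -/

lemma solPath_of_le (x : ℕ → ℝ) (M : ℕ) (draw : ℕ → ℕ → ℕ → ℕ × ℕ) (tie : Entry → Entry → Bool)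
    {s e : ℕ} (h : e ≤ s) :
    (solPath x M draw tie s e).val = [] ∧ (solPath x M draw tie s e).steps = 3 := by
  rw [solPath]
  simp [Nat.not_lt.mpr h]

lemma solPath_of_lt {x : ℕ → ℝ} {M : ℕ} {draw : ℕ → ℕ → ℕ → ℕ × ℕ} {tie : Entry → Entry → Bool}
    {s e : ℕ} (h : s < e) {p : Entry} (hp : (search x M draw tie s e).val = some p)
    (hb : s ≤ p.b ∧ p.b < e) :
    (solPath x M draw tie s e).val
        = p :: ((solPath x M draw tie s p.b).val ++ (solPath x M draw tie (p.b + 1) e).val) ∧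
    (solPath x M draw tie s e).steps = 2 + ((search x M draw tie s e).steps
      + ((solPath x M draw tie s p.b).steps + ((solPath x M draw tie (p.b + 1) e).steps
        + ((solPath x M draw tie s p.b).val.length + 4)))) := by
  rw [solPath]
  simp [h, hp, hb]

/-- A split at `b` contributes one entry, and `1 + (b - s) + (e - (b + 1)) = e - s`. -/
lemma solPath_length {x : ℕ → ℝ} {T M : ℕ} {draw : ℕ → ℕ → ℕ → ℕ × ℕ}
    {tie : Entry → Entry → Bool} (hM : 1 ≤ M) (hv : ValidDraws T M draw) {s e : ℕ} (hs : 1 ≤ s)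
    (he : e ≤ T) : (solPath x M draw tie s e).val.length = e - s := by
  induction hn : e - s using Nat.strong_induction_on generalizing s e with
  | _ n ih =>
    rcases le_or_gt e s with h | h
    · rw [(solPath_of_le x M draw tie h).1, List.length_nil]
      omega
    · obtain ⟨p, hp, -, -, hb1, hb2⟩ := search_spec (x := x) tie hM (hv.validOn hs h he) h
      rw [(solPath_of_lt h hp ⟨hb1, hb2⟩).1, List.length_cons, List.length_append,
        ih _ (by omega) hs (by omega) rfl, ih _ (by omega) (by omega) he rfl]
      omega

/-! ## Sorting -/

lemma merge_cons_of_precedes {tie : Entry → Entry → Bool} {p q : Entry}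
    (h : precedes tie p q = true) (l₁ l₂ : List Entry) :
    (merge tie (p :: l₁) (q :: l₂)).val = p :: (merge tie l₁ (q :: l₂)).val ∧
    (merge tie (p :: l₁) (q :: l₂)).steps = (merge tie l₁ (q :: l₂)).steps + 4 := by
  rw [merge]
  simp [h]
  omega

lemma merge_cons_of_not_precedes {tie : Entry → Entry → Bool} {p q : Entry}
    (h : ¬ precedes tie p q = true) (l₁ l₂ : List Entry) :
    (merge tie (p :: l₁) (q :: l₂)).val = q :: (merge tie (p :: l₁) l₂).val ∧
    (merge tie (p :: l₁) (q :: l₂)).steps = (merge tie (p :: l₁) l₂).steps + 4 := by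
  rw [merge]
  simp [h]
  omega

lemma merge_perm (tie : Entry → Entry → Bool) (l₁ l₂ : List Entry) :
    (merge tie l₁ l₂).val.Perm (l₁ ++ l₂) := by
  induction l₁ generalizing l₂ with
  | nil => simp [merge]
  | cons p l₁ ih₁ =>
    induction l₂ with
    | nil => simp [merge]
    | cons q l₂ ih₂ =>
      by_cases hc : precedes tie p q = true
      · rw [(merge_cons_of_precedes hc _ _).1]
        exact (ih₁ _).cons p
      · rw [(merge_cons_of_not_precedes hc _ _).1]
        exact (ih₂.cons q).trans List.perm_middle.symm

lemma merge_pairwise (tie : Entry → Entry → Bool) (l₁ l₂ : List Entry)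
    (h₁ : l₁.Pairwise (fun p q => q.v ≤ p.v)) (h₂ : l₂.Pairwise (fun p q => q.v ≤ p.v)) :
    (merge tie l₁ l₂).val.Pairwise (fun p q => q.v ≤ p.v) := by
  induction l₁ generalizing l₂ with
  | nil => simpa [merge] using h₂
  | cons p l₁ ih₁ =>
    induction l₂ with
    | nil => simpa [merge] using h₁
    | cons q l₂ ih₂ =>
      have h₁' := List.pairwise_cons.mp h₁
      have h₂' := List.pairwise_cons.mp h₂
      by_cases hc : precedes tie p q = true
      · rw [(merge_cons_of_precedes hc _ _).1, List.pairwise_cons]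
        refine ⟨fun a ha => ?_, ih₁ _ h₁'.2 h₂⟩
        rcases List.mem_append.mp ((merge_perm _ _ _).mem_iff.mp ha) with h | h
        · exact h₁'.1 a h
        · rcases List.mem_cons.mp h with rfl | h
          · exact le_of_precedes hc
          · exact (h₂'.1 a h).trans (le_of_precedes hc)
      · rw [(merge_cons_of_not_precedes hc _ _).1, List.pairwise_cons]
        refine ⟨fun a ha => ?_, ih₂ h₂'.2⟩
        rcases List.mem_append.mp ((merge_perm _ _ _).mem_iff.mp ha) with h | h
        · rcases List.mem_cons.mp h with rfl | h
          · exact le_of_not_precedes hc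
          · exact (h₁'.1 a h).trans (le_of_not_precedes hc)
        · exact h₂'.1 a h

lemma merge_steps_le (tie : Entry → Entry → Bool) (l₁ l₂ : List Entry) :
    (merge tie l₁ l₂).steps ≤ 4 * (l₁.length + l₂.length) + 1 := by
  induction l₁ generalizing l₂ with
  | nil => simp [merge]
  | cons p l₁ ih₁ =>
    induction l₂ with
    | nil => simp [merge]
    | cons q l₂ ih₂ =>
      by_cases hc : precedes tie p q = true
      · have := ih₁ (q :: l₂)
        rw [(merge_cons_of_precedes hc _ _).2]
        simp only [List.length_cons] at *
        omega
      · rw [(merge_cons_of_not_precedes hc _ _).2]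
        simp only [List.length_cons] at *
        omega

lemma sortPath_perm (tie : Entry → Entry → Bool) (l : List Entry) :
    (sortPath tie l).val.Perm l := by
  fun_induction sortPath tie l with
  | case1 => simp
  | case2 l h ih1 ih2 =>
    simp only [bind_val]
    refine (merge_perm _ _ _).trans ((ih1.append ih2).trans ?_)
    rw [List.take_append_drop]

lemma sortPath_pairwise (tie : Entry → Entry → Bool) (l : List Entry) :
    (sortPath tie l).val.Pairwise (fun p q => q.v ≤ p.v) := by
  fun_induction sortPath tie l with
  | case1 l h =>
    simp only [op_val]
    match l, h with
    | [], _ => simp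
    | [a], _ => simp
  | case2 l h ih1 ih2 =>
    simp only [bind_val]
    exact merge_pairwise _ _ _ ih1 ih2

/-- The depth bound `k` is a parameter instead of a logarithm, because the number of scales will be
inserted for it. -/
lemma sortPath_steps_le (tie : Entry → Entry → Bool) (l : List Entry) (k : ℕ)
    (hk : l.length ≤ 2 ^ k) : (sortPath tie l).steps ≤ 8 * (l.length * k) + 1 := by
  induction k generalizing l with
  | zero =>
    rw [sortPath]
    simp only [pow_zero] at hk
    simp [hk]
  | succ k ih =>
    rw [sortPath]
    split_ifs with h
    · simp
    · rw [pow_succ] at hk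
      have h1 := ih (l.take (l.length / 2)) (by simp only [List.length_take]; omega)
      have h2 := ih (l.drop (l.length / 2)) (by simp only [List.length_drop]; omega)
      have h3 := merge_steps_le tie (sortPath tie (l.take (l.length / 2))).val
        (sortPath tie (l.drop (l.length / 2))).val
      rw [(sortPath_perm _ _).length_eq, (sortPath_perm _ _).length_eq] at h3
      simp only [bind_steps, ops_steps]
      rw [List.length_take, List.length_drop] at *
      have h4 : min (l.length / 2) l.length * k + (l.length - l.length / 2) * k
          = l.length * k := by
        rw [← add_mul]
        congr 1
        omega
      have h5 : l.length * (k + 1) = l.length * k + l.length := by ring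
      have h6 : min (l.length / 2) l.length + (l.length - l.length / 2) = l.length := by omega
      rw [h6] at h3
      omega

theorem wbs2_length {x : ℕ → ℝ} {T M : ℕ} {draw : ℕ → ℕ → ℕ → ℕ × ℕ}
    {tie : Entry → Entry → Bool} (hM : 1 ≤ M) (hv : ValidDraws T M draw) :
    (wbs2 x T M draw tie).val.length = T - 1 := by
  simp only [wbs2, bind_val]
  rw [(sortPath_perm _ _).length_eq, solPath_length hM hv le_rfl le_rfl]


/-! ## Scales and the number of steps -/

lemma le_foldr_max {l : List ℕ} {a : ℕ} (h : a ∈ l) : a ≤ l.foldr max 0 := by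
  induction l with
  | nil => simp at h
  | cons b l ih =>
    rcases List.mem_cons.mp h with rfl | h
    · exact le_max_left _ _
    · exact (ih h).trans (le_max_right _ _)

lemma foldr_max_le {l : List ℕ} {c : ℕ} (h : ∀ a ∈ l, a ≤ c) : l.foldr max 0 ≤ c := by
  induction l with
  | nil => simp
  | cons b l ih =>
    exact max_le (h b (by simp)) (ih fun a ha => h a (by simp [ha]))

lemma foldr_max_mem {l : List ℕ} (h : l.foldr max 0 ≠ 0) : l.foldr max 0 ∈ l := by
  induction l with
  | nil => simp at h
  | cons b l ih =>
    simp only [List.foldr_cons, List.mem_cons] at h ⊢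
    rcases le_total b (l.foldr max 0) with hb | hb
    · rw [max_eq_right hb] at h ⊢
      exact Or.inr (ih h)
    · exact Or.inl (max_eq_left hb)

/-- The passage from the sub-domains of one scale to those of the next. -/
noncomputable def splitAll (x : ℕ → ℝ) (M : ℕ) (draw : ℕ → ℕ → ℕ → ℕ × ℕ)
    (tie : Entry → Entry → Bool) (l : List (ℕ × ℕ)) : List (ℕ × ℕ) :=
  l.flatMap (children x M draw tie)

lemma domainsAt_eq_iterate (x : ℕ → ℝ) (T M : ℕ) (draw : ℕ → ℕ → ℕ → ℕ × ℕ)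
    (tie : Entry → Entry → Bool) (i : ℕ) :
    domainsAt x T M draw tie i = (splitAll x M draw tie)^[i] [(1, T)] := by
  induction i with
  | zero => rfl
  | succ i ih => rw [Function.iterate_succ_apply', ← ih]; rfl

/-- The two halves of a sub-domain evolve independently. This turns the description by scales into
the recursion of `solPath`. -/
lemma iterate_splitAll_append (x : ℕ → ℝ) (M : ℕ) (draw : ℕ → ℕ → ℕ → ℕ × ℕ)
    (tie : Entry → Entry → Bool) (i : ℕ) (l₁ l₂ : List (ℕ × ℕ)) :
    (splitAll x M draw tie)^[i] (l₁ ++ l₂)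
      = (splitAll x M draw tie)^[i] l₁ ++ (splitAll x M draw tie)^[i] l₂ := by
  induction i generalizing l₁ l₂ with
  | zero => rfl
  | succ i ih =>
    rw [Function.iterate_succ_apply, Function.iterate_succ_apply, Function.iterate_succ_apply,
      ← ih, splitAll, splitAll, splitAll, List.flatMap_append]

lemma children_of_lt {x : ℕ → ℝ} {M : ℕ} {draw : ℕ → ℕ → ℕ → ℕ × ℕ} {tie : Entry → Entry → Bool}
    {s e : ℕ} (h : s < e) {p : Entry} (hp : (search x M draw tie s e).val = some p) :
    children x M draw tie (s, e) = [(s, p.b), (p.b + 1, e)] := by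
  simp [children, h, hp]

/-- Induction on the number `j` of scales below `[s, e]`. Both bounds come from the binary
splitting: lengths add up over the two children, and each child has one scale less. Sub-domains of
length 1 have no children, so `hj` only speaks of those that survive. -/
lemma solPath_steps_le {x : ℕ → ℝ} {T M : ℕ} {draw : ℕ → ℕ → ℕ → ℕ × ℕ}
    {tie : Entry → Entry → Bool} (hM : 1 ≤ M) (hv : ValidDraws T M draw) (j : ℕ) {s e : ℕ}
    (hs : 1 ≤ s) (hse : s ≤ e) (he : e ≤ T)
    (hj : ∀ d ∈ (splitAll x M draw tie)^[j] [(s, e)], d.2 ≤ d.1) :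
    e - s + 1 ≤ 2 ^ j ∧
      (solPath x M draw tie s e).steps ≤ (52 * j + 3) * (M * (e - s + 1)) := by
  induction j generalizing s e with
  | zero =>
    have h : e ≤ s := hj (s, e) (by simp)
    rw [(solPath_of_le x M draw tie h).2, show e - s = 0 by omega]
    constructor
    · simp
    · omega
  | succ j ih =>
    rcases le_or_gt e s with h | h
    · rw [(solPath_of_le x M draw tie h).2, show e - s = 0 by omega]
      constructor
      · simpa using Nat.one_le_two_pow
      · nlinarith
    · obtain ⟨p, hp, -, -, hb1, hb2⟩ := search_spec (x := x) tie hM (hv.validOn hs h he) h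
      have hst := search_steps_le x tie hM (hv.validOn hs h he) h
      have hc : splitAll x M draw tie [(s, e)] = [(s, p.b)] ++ [(p.b + 1, e)] := by
        simp [splitAll, children_of_lt h hp]
      rw [Function.iterate_succ_apply, hc, iterate_splitAll_append] at hj
      obtain ⟨h1, h1'⟩ := ih hs hb1 (by omega)
        (fun d hd => hj d (List.mem_append_left _ hd))
      obtain ⟨h2, h2'⟩ := ih (by omega) (by omega) he
        (fun d hd => hj d (List.mem_append_right _ hd))
      rw [(solPath_of_lt h hp ⟨hb1, hb2⟩).2, solPath_length hM hv hs (by omega)]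
      obtain ⟨a, ha⟩ : ∃ a, p.b - s + 1 = a := ⟨_, rfl⟩
      obtain ⟨c, hc'⟩ : ∃ c, e - (p.b + 1) + 1 = c := ⟨_, rfl⟩
      have hn : e - s + 1 = a + c := by omega
      rw [hn] at hst ⊢
      rw [ha] at h1 h1'
      rw [hc'] at h2 h2'
      constructor
      · rw [pow_succ]; omega
      -- Per unit of `M * (a + c)`, the search costs 45 and the bookkeeping `(p.b - s) + 6` at most
      -- 4, which leaves room below 52.
      · have hMn : a + c ≤ M * (a + c) := Nat.le_mul_of_pos_left _ hM
        have h2M : 2 ≤ a + c := by omega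
        have hl : p.b - s ≤ a + c := by omega
        have e1 : (52 * (j + 1) + 3) * (M * (a + c)) = (52 * j + 3) * (M * a)
          + (52 * j + 3) * (M * c) + 52 * (M * (a + c)) := by ring
        rw [e1]
        omega

lemma domainsAt_valid {x : ℕ → ℝ} {T M : ℕ} {draw : ℕ → ℕ → ℕ → ℕ × ℕ}
    {tie : Entry → Entry → Bool} (hT : 1 ≤ T) (hM : 1 ≤ M) (hv : ValidDraws T M draw) (i : ℕ) :
    ∀ d ∈ domainsAt x T M draw tie i, 1 ≤ d.1 ∧ d.1 ≤ d.2 ∧ d.2 ≤ T := by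
  induction i with
  | zero => simpa [domainsAt] using hT
  | succ i ih =>
    intro d hd
    simp only [domainsAt, List.mem_flatMap] at hd
    obtain ⟨⟨s, e⟩, hse, hd⟩ := hd
    have h := ih _ hse
    rcases le_or_gt e s with hlt | hlt
    · simp [children, Nat.not_lt.mpr hlt] at hd
    · obtain ⟨p, hp, -, -, hb1, hb2⟩ := search_spec (x := x) tie hM (hv.validOn h.1 hlt h.2.2) hlt
      rw [children_of_lt hlt hp] at hd
      simp only [List.mem_cons, List.not_mem_nil, or_false] at hd
      simp only at h
      rcases hd with rfl | rfl <;> simp only <;> omega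

/-- Splits are proper, so the longest length drops strictly while it is at least 2, and it cannot
jump to the default 0. It therefore hits 1, and the infimum in `numScales` is attained. -/
lemma Gam_succ_lt {x : ℕ → ℝ} {T M : ℕ} {draw : ℕ → ℕ → ℕ → ℕ × ℕ}
    {tie : Entry → Entry → Bool} (hT : 1 ≤ T) (hM : 1 ≤ M) (hv : ValidDraws T M draw) (i : ℕ)
    (h : 2 ≤ Gam x T M draw tie (i + 1)) :
    1 ≤ Gam x T M draw tie (i + 2) ∧ Gam x T M draw tie (i + 2) < Gam x T M draw tie (i + 1) := by
  have hch : ∀ d ∈ domainsAt x T M draw tie i, d.1 < d.2 →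
      ∃ b, d.1 ≤ b ∧ b < d.2 ∧ children x M draw tie d = [(d.1, b), (b + 1, d.2)] := by
    intro d hd hlt
    have hd' := domainsAt_valid hT hM hv i d hd
    obtain ⟨p, hp, -, -, hb1, hb2⟩ :=
      search_spec (x := x) tie hM (hv.validOn hd'.1 hlt hd'.2.2) hlt
    exact ⟨p.b, hb1, hb2, children_of_lt hlt hp⟩
  have hmem : Gam x T M draw tie (i + 1)
      ∈ (domainsAt x T M draw tie i).map (fun d => d.2 - d.1 + 1) :=
    foldr_max_mem (show Gam x T M draw tie (i + 1) ≠ 0 by omega)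
  constructor
  · obtain ⟨d, hd, hde⟩ := List.mem_map.mp hmem
    obtain ⟨b, h1, h2, h3⟩ := hch d hd (by omega)
    refine le_trans (by omega : 1 ≤ b - d.1 + 1) (le_foldr_max (List.mem_map.mpr ⟨(d.1, b), ?_, rfl⟩))
    exact List.mem_flatMap.mpr ⟨d, hd, by simp [h3]⟩
  · refine Nat.lt_of_le_pred (by omega) (foldr_max_le fun a ha => ?_)
    obtain ⟨d', hd', rfl⟩ := List.mem_map.mp ha
    obtain ⟨d, hd, hdd⟩ := List.mem_flatMap.mp hd'
    have hle : d.2 - d.1 + 1 ≤ Gam x T M draw tie (i + 1) :=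
      le_foldr_max (List.mem_map.mpr ⟨d, hd, rfl⟩)
    by_cases hlt : d.1 < d.2
    · obtain ⟨b, h1, h2, h3⟩ := hch d hd hlt
      rw [h3] at hdd
      simp only [List.mem_cons, List.not_mem_nil, or_false] at hdd
      rcases hdd with rfl | rfl <;> simp only [Nat.pred_eq_sub_one] <;> omega
    · simp [children, hlt] at hdd

lemma exists_Gam_eq_one {x : ℕ → ℝ} {T M : ℕ} {draw : ℕ → ℕ → ℕ → ℕ × ℕ}
    {tie : Entry → Entry → Bool} (hT : 1 ≤ T) (hM : 1 ≤ M) (hv : ValidDraws T M draw) :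
    ∃ j, 1 ≤ j ∧ Gam x T M draw tie j = 1 := by
  have key : ∀ g i, 1 ≤ Gam x T M draw tie (i + 1) → Gam x T M draw tie (i + 1) ≤ g →
      ∃ j, 1 ≤ j ∧ Gam x T M draw tie j = 1 := by
    intro g
    induction g with
    | zero => intro i h1 h2; omega
    | succ g ih =>
      intro i h1 h2
      by_cases h : Gam x T M draw tie (i + 1) = 1
      · exact ⟨i + 1, by omega, h⟩
      · have := Gam_succ_lt (x := x) (tie := tie) hT hM hv i (by omega)
        exact ih (i + 1) this.1 (Nat.le_of_lt_succ (this.2.trans_le h2))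
  refine key _ 0 ?_ le_rfl
  simp [Gam, domainsAt]

theorem wbs2_steps_le {x : ℕ → ℝ} {T M : ℕ} {draw : ℕ → ℕ → ℕ → ℕ × ℕ}
    {tie : Entry → Entry → Bool} (hT : 2 ≤ T) (hM : 1 ≤ M) (hv : ValidDraws T M draw) :
    (wbs2 x T M draw tie).steps ≤ 64 * (M * numScales x T M draw tie * T) := by
  have hne : {j : ℕ | 1 ≤ j ∧ Gam x T M draw tie j = 1}.Nonempty :=
    exists_Gam_eq_one (by omega) hM hv
  obtain ⟨-, h2⟩ := Nat.sInf_mem hne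
  have hJ : numScales x T M draw tie = sInf {j : ℕ | 1 ≤ j ∧ Gam x T M draw tie j = 1} - 1 := rfl
  obtain ⟨J, hJJ⟩ : ∃ J, numScales x T M draw tie = J := ⟨_, rfl⟩
  -- Scale `J + 1` is `domainsAt` at index `J`, and all its sub-domains have length 1.
  rw [Gam, ← hJ, hJJ] at h2
  have hall : ∀ d ∈ (splitAll x M draw tie)^[J] [(1, T)], d.2 ≤ d.1 := by
    intro d hd
    rw [← domainsAt_eq_iterate] at hd
    have := le_foldr_max (List.mem_map_of_mem (f := fun d : ℕ × ℕ => d.2 - d.1 + 1) hd)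
    rw [h2] at this
    omega
  obtain ⟨h3, h4⟩ := solPath_steps_le hM hv J le_rfl (by omega) le_rfl hall
  rw [show T - 1 + 1 = T by omega] at h3 h4
  have hJ1 : 1 ≤ J := by
    rcases J with _ | J
    · simp only [pow_zero] at h3
      omega
    · omega
  have h5 := sortPath_steps_le tie (solPath x M draw tie 1 T).val J
    (by rw [solPath_length hM hv le_rfl le_rfl]; omega)
  rw [solPath_length hM hv le_rfl le_rfl] at h5
  simp only [wbs2, bind_steps, hJJ]
  have h6 : (T - 1) * J ≤ M * J * T := by
    calc (T - 1) * J ≤ T * J := Nat.mul_le_mul_right _ (by omega)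
      _ ≤ M * (T * J) := Nat.le_mul_of_pos_left _ hM
      _ = M * J * T := by ring
  have h7 : M * T ≤ M * J * T := by
    calc M * T ≤ J * (M * T) := Nat.le_mul_of_pos_left _ hJ1
      _ = M * J * T := by ring
  -- The constant is `64 = 52 + 3 + 8 + 1`: the scales, the leaves, and the two terms of the sorting
  -- bound.
  have h8 : (52 * J + 3) * (M * T) = 52 * (M * J * T) + 3 * (M * T) := by ring
  have h9 : 1 ≤ M * J * T := Nat.mul_pos (Nat.mul_pos hM hJ1) (by omega)
  omega


/-! ## CUSUM statistics as functions of the candidate -/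

/-- The quotient of the values of `√((b - s + 1) / (e - b))` at `c` and at `b`. -/
noncomputable def cusumRatio (s e b c : ℕ) : ℝ :=
  √((((c : ℝ) - s + 1) * ((e : ℝ) - b)) / (((e : ℝ) - c) * ((b : ℝ) - s + 1)))

/-- The weight of the left sum in a CUSUM statistic. -/
noncomputable def leftWeight (s e b : ℕ) : ℝ :=
  √(((e : ℝ) - b) / (((e : ℝ) - s + 1) * ((b : ℝ) - s + 1)))

/-- The weight of the right sum in a CUSUM statistic. -/
noncomputable def rightWeight (s e b : ℕ) : ℝ :=
  √(((b : ℝ) - s + 1) / (((e : ℝ) - s + 1) * ((e : ℝ) - b)))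

lemma cusum_eq (x : ℕ → ℝ) (s e b : ℕ) :
    cusum x s e b = leftWeight s e b * ∑ t ∈ Finset.Icc s b, x t
      - rightWeight s e b * ∑ t ∈ Finset.Icc (b + 1) e, x t := rfl

lemma leftWeight_nonneg (s e b : ℕ) : 0 ≤ leftWeight s e b := Real.sqrt_nonneg _

lemma rightWeight_nonneg (s e b : ℕ) : 0 ≤ rightWeight s e b := Real.sqrt_nonneg _

lemma cusum_neg (x : ℕ → ℝ) (s e b : ℕ) : cusum (fun t => -x t) s e b = -cusum x s e b := by
  simp only [cusum_eq, Finset.sum_neg_distrib]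
  ring

lemma cusum_add (x y : ℕ → ℝ) (s e b : ℕ) :
    cusum (fun t => x t + y t) s e b = cusum x s e b + cusum y s e b := by
  simp only [cusum_eq, Finset.sum_add_distrib]
  ring

section
variable {s e b c : ℕ}

lemma left_length_pos (hsb : s ≤ b) : 0 < (b : ℝ) - s + 1 := by
  have : (s : ℝ) ≤ b := by exact_mod_cast hsb
  linarith

lemma right_length_pos (hbe : b < e) : 0 < (e : ℝ) - b := by
  have : (b : ℝ) < e := by exact_mod_cast hbe
  linarith

/-- The total weights of the two sides agree. This is why CUSUMs ignore additive constants. -/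
lemma leftWeight_mul_left_length (hsb : s ≤ b) (hbe : b < e) :
    leftWeight s e b * ((b : ℝ) - s + 1) = rightWeight s e b * ((e : ℝ) - b) := by
  have hq := left_length_pos hsb
  have hp := right_length_pos hbe
  have hn : 0 < (e : ℝ) - s + 1 := by linarith
  unfold leftWeight rightWeight
  rw [← Real.sqrt_sq hq.le, ← Real.sqrt_sq hp.le, ← Real.sqrt_mul (by positivity),
    ← Real.sqrt_mul (by positivity)]
  congr 1
  rw [Real.sqrt_sq hq.le, Real.sqrt_sq hp.le]
  field_simp

lemma cusum_sub_const (x : ℕ → ℝ) (v : ℝ) (hsb : s ≤ b) (hbe : b < e) :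
    cusum (fun t => x t - v) s e b = cusum x s e b := by
  simp only [cusum_eq, Finset.sum_sub_distrib, Finset.sum_const, Nat.card_Icc, nsmul_eq_mul]
  rw [Nat.cast_sub (by omega), Nat.cast_sub (by omega)]
  push_cast
  linear_combination (-v) * leftWeight_mul_left_length hsb hbe

lemma cusum_eq_zero_of_const {x : ℕ → ℝ} (hsb : s ≤ b) (hbe : b < e)
    (h : ∀ t, s ≤ t → t ≤ e → x t = x s) : cusum x s e b = 0 := by
  rw [← cusum_sub_const x (x s) hsb hbe, cusum_eq, Finset.sum_eq_zero, Finset.sum_eq_zero]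
  · simp
  · intro t ht
    rw [Finset.mem_Icc] at ht
    rw [h t (by omega) (by omega), sub_self]
  · intro t ht
    rw [Finset.mem_Icc] at ht
    rw [h t (by omega) (by omega), sub_self]

lemma leftWeight_mul_sqrt_le (hsb : s ≤ b) (hbe : b < e) :
    leftWeight s e b * √((b : ℝ) - s + 1) ≤ 1 := by
  have hq := left_length_pos hsb
  have hp := right_length_pos hbe
  have hn : 0 < (e : ℝ) - s + 1 := by linarith
  rw [leftWeight, ← Real.sqrt_mul (by positivity), Real.sqrt_le_one]
  rw [div_mul_eq_mul_div, mul_div_mul_right _ _ hq.ne', div_le_one hn]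
  linarith

lemma rightWeight_mul_sqrt_le (hsb : s ≤ b) (hbe : b < e) :
    rightWeight s e b * √((e : ℝ) - b) ≤ 1 := by
  have hq := left_length_pos hsb
  have hp := right_length_pos hbe
  have hn : 0 < (e : ℝ) - s + 1 := by linarith
  rw [rightWeight, ← Real.sqrt_mul (by positivity), Real.sqrt_le_one]
  rw [div_mul_eq_mul_div, mul_div_mul_right _ _ hp.ne', div_le_one hn]
  linarith

/-- This is the weight with which a block enters a change of the CUSUM when it passes from the right
sum to the left one. -/
lemma weight_add (hsb : s ≤ b) (hbe : b < e) :
    leftWeight s e b + rightWeight s e b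
      = √(((e : ℝ) - s + 1) / (((b : ℝ) - s + 1) * ((e : ℝ) - b))) := by
  have hq := left_length_pos hsb
  have hp := right_length_pos hbe
  have hn : 0 < (e : ℝ) - s + 1 := by linarith
  have h1 : leftWeight s e b * rightWeight s e b = 1 / ((e : ℝ) - s + 1) := by
    rw [leftWeight, rightWeight, ← Real.sqrt_mul (by positivity)]
    rw [Real.sqrt_eq_iff_mul_self_eq (by positivity) (by positivity)]
    field_simp
  symm
  rw [Real.sqrt_eq_iff_mul_self_eq (by positivity)
    (add_nonneg (leftWeight_nonneg _ _ _) (rightWeight_nonneg _ _ _))]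
  have h2 : leftWeight s e b * leftWeight s e b
      = ((e : ℝ) - b) / (((e : ℝ) - s + 1) * ((b : ℝ) - s + 1)) :=
    Real.mul_self_sqrt (by positivity)
  have h3 : rightWeight s e b * rightWeight s e b
      = ((b : ℝ) - s + 1) / (((e : ℝ) - s + 1) * ((e : ℝ) - b)) :=
    Real.mul_self_sqrt (by positivity)
  symm
  calc (leftWeight s e b + rightWeight s e b) * (leftWeight s e b + rightWeight s e b)
      = leftWeight s e b * leftWeight s e b + 2 * (leftWeight s e b * rightWeight s e b)
        + rightWeight s e b * rightWeight s e b := by ring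
    _ = ((e : ℝ) - s + 1) / (((b : ℝ) - s + 1) * ((e : ℝ) - b)) := by
      rw [h1, h2, h3]
      field_simp
      ring

lemma cusumRatio_pos (hsb : s ≤ b) (hbe : b < e) (hsc : s ≤ c) (hce : c < e) :
    0 < cusumRatio s e b c := by
  have := left_length_pos hsb
  have := right_length_pos hbe
  have := left_length_pos hsc
  have := right_length_pos hce
  unfold cusumRatio
  positivity

/-- A square-root-free relation by which bounds on the ratio become bounds on the distance `c - b`,
and conversely. -/
lemma cusumRatio_sq (hsb : s ≤ b) (hbe : b < e) (hsc : s ≤ c) (hce : c < e) :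
    (cusumRatio s e b c ^ 2 - 1) * (((e : ℝ) - c) * ((b : ℝ) - s + 1))
      = ((c : ℝ) - b) * ((e : ℝ) - s + 1) := by
  have h1 := left_length_pos hsb
  have h2 := right_length_pos hbe
  have h3 := left_length_pos hsc
  have h4 := right_length_pos hce
  unfold cusumRatio
  rw [Real.sq_sqrt (by positivity)]
  field_simp
  ring

lemma one_le_cusumRatio (hsb : s ≤ b) (hbc : b ≤ c) (hce : c < e) :
    1 ≤ cusumRatio s e b c := by
  have h1 := cusumRatio_sq hsb (by omega : b < e) (by omega : s ≤ c) hce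
  have h2 := left_length_pos hsb
  have h4 := right_length_pos hce
  have h5 : (b : ℝ) ≤ c := by exact_mod_cast hbc
  have h6 := cusumRatio_pos hsb (by omega : b < e) (by omega : s ≤ c) hce
  have h7 : 0 ≤ cusumRatio s e b c ^ 2 - 1 := by
    by_contra hneg
    push Not at hneg
    have := mul_neg_of_neg_of_pos hneg (mul_pos h4 h2)
    have := mul_nonneg (sub_nonneg.mpr h5) (by linarith : 0 ≤ (e : ℝ) - s + 1)
    linarith
  nlinarith

lemma rightWeight_eq_ratio_mul (hsb : s ≤ b) (hbe : b < e) (hsc : s ≤ c) (hce : c < e) :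
    rightWeight s e c = cusumRatio s e b c * rightWeight s e b := by
  have h1 := left_length_pos hsb
  have h2 := right_length_pos hbe
  have h3 := left_length_pos hsc
  have h4 := right_length_pos hce
  have hn : 0 < (e : ℝ) - s + 1 := by linarith
  unfold cusumRatio rightWeight
  rw [← Real.sqrt_mul (by positivity)]
  congr 1
  field_simp

lemma leftWeight_eq_div_ratio (hsb : s ≤ b) (hbe : b < e) (hsc : s ≤ c) (hce : c < e) :
    leftWeight s e c = leftWeight s e b / cusumRatio s e b c := by
  have h1 := left_length_pos hsb
  have h2 := right_length_pos hbe
  have h3 := left_length_pos hsc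
  have h4 := right_length_pos hce
  have hn : 0 < (e : ℝ) - s + 1 := by linarith
  unfold cusumRatio leftWeight
  rw [← Real.sqrt_div (by positivity)]
  congr 1
  field_simp

lemma sum_Icc_add_sum_Icc (x : ℕ → ℝ) {l m k : ℕ} (h1 : l ≤ m + 1) (h2 : m ≤ k) :
    ∑ t ∈ Finset.Icc l m, x t + ∑ t ∈ Finset.Icc (m + 1) k, x t = ∑ t ∈ Finset.Icc l k, x t := by
  rw [← Finset.Ico_add_one_right_eq_Icc, ← Finset.Ico_add_one_right_eq_Icc,
    ← Finset.Ico_add_one_right_eq_Icc]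
  exact Finset.sum_Ico_consecutive x h1 (by omega)

/-- The CUSUM at `c ≥ b` in terms of the weights and the sums at `b`. -/
lemma cusum_right (x : ℕ → ℝ) (hsb : s ≤ b) (hbc : b ≤ c) (hce : c < e) :
    cusum x s e c = leftWeight s e b / cusumRatio s e b c
        * (∑ t ∈ Finset.Icc s b, x t + ∑ t ∈ Finset.Icc (b + 1) c, x t)
      - cusumRatio s e b c * rightWeight s e b
        * (∑ t ∈ Finset.Icc (b + 1) e, x t - ∑ t ∈ Finset.Icc (b + 1) c, x t) := by
  rw [cusum_eq, leftWeight_eq_div_ratio hsb (by omega) (by omega : s ≤ c) hce,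
    rightWeight_eq_ratio_mul hsb (by omega) (by omega : s ≤ c) hce,
    sum_Icc_add_sum_Icc x (by omega) hbc,
    ← sum_Icc_add_sum_Icc x (by omega : b + 1 ≤ c + 1) (by omega : c ≤ e)]
  ring

/-- The CUSUM at `c ≤ b` in terms of the weights and the sums at `b`. -/
lemma cusum_left (x : ℕ → ℝ) (hsc : s ≤ c) (hcb : c ≤ b) (hbe : b < e) :
    cusum x s e c = leftWeight s e b * cusumRatio s e c b
        * (∑ t ∈ Finset.Icc s b, x t - ∑ t ∈ Finset.Icc (c + 1) b, x t)
      - rightWeight s e b / cusumRatio s e c b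
        * (∑ t ∈ Finset.Icc (b + 1) e, x t + ∑ t ∈ Finset.Icc (c + 1) b, x t) := by
  have hr := cusumRatio_pos hsc (by omega : c < e) (by omega : s ≤ b) hbe
  rw [cusum_eq, leftWeight_eq_div_ratio hsc (by omega) (by omega : s ≤ b) hbe,
    rightWeight_eq_ratio_mul hsc (by omega) (by omega : s ≤ b) hbe,
    ← sum_Icc_add_sum_Icc x (by omega : s ≤ c + 1) hcb,
    ← sum_Icc_add_sum_Icc x (by omega : c + 1 ≤ b + 1) (by omega : b ≤ e)]
  field_simp
  ring

lemma leftWeight_mul_sum_le {x : ℕ → ℝ} {r : ℝ} (hr : 0 ≤ r) (hsb : s ≤ b) (hbe : b < e)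
    (hx : |∑ t ∈ Finset.Icc s b, x t| ≤ r * √((b : ℝ) - s + 1)) :
    |leftWeight s e b * ∑ t ∈ Finset.Icc s b, x t| ≤ r := by
  rw [abs_mul, abs_of_nonneg (leftWeight_nonneg _ _ _)]
  calc _ ≤ leftWeight s e b * (r * √((b : ℝ) - s + 1)) :=
        mul_le_mul_of_nonneg_left hx (leftWeight_nonneg _ _ _)
    _ = r * (leftWeight s e b * √((b : ℝ) - s + 1)) := by ring
    _ ≤ r * 1 := mul_le_mul_of_nonneg_left (leftWeight_mul_sqrt_le hsb hbe) hr
    _ = r := mul_one r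

lemma rightWeight_mul_sum_le {x : ℕ → ℝ} {r : ℝ} (hr : 0 ≤ r) (hsb : s ≤ b) (hbe : b < e)
    (hx : |∑ t ∈ Finset.Icc (b + 1) e, x t| ≤ r * √((e : ℝ) - b)) :
    |rightWeight s e b * ∑ t ∈ Finset.Icc (b + 1) e, x t| ≤ r := by
  rw [abs_mul, abs_of_nonneg (rightWeight_nonneg _ _ _)]
  calc _ ≤ rightWeight s e b * (r * √((e : ℝ) - b)) :=
        mul_le_mul_of_nonneg_left hx (rightWeight_nonneg _ _ _)
    _ = r * (rightWeight s e b * √((e : ℝ) - b)) := by ring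
    _ ≤ r * 1 := mul_le_mul_of_nonneg_left (rightWeight_mul_sqrt_le hsb hbe) hr
    _ = r := mul_one r

/-- All standardised partial sums of `x` over `[s, e]` are at most `r`. -/
def SumsBounded (x : ℕ → ℝ) (s e : ℕ) (r : ℝ) : Prop :=
  ∀ l m : ℕ, s ≤ l → l ≤ m → m ≤ e → |∑ t ∈ Finset.Icc l m, x t| ≤ r * √((m : ℝ) - l + 1)

lemma SumsBounded.mono {x : ℕ → ℝ} {s' e' : ℕ} {r : ℝ} (h : SumsBounded x s e r) (hs : s ≤ s')
    (he : e' ≤ e) : SumsBounded x s' e' r :=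
  fun l m h1 h2 h3 => h l m (hs.trans h1) h2 (h3.trans he)

lemma SumsBounded.left {x : ℕ → ℝ} {r : ℝ} (h : SumsBounded x s e r) (hr : 0 ≤ r) (hsb : s ≤ b)
    (hbe : b < e) : |leftWeight s e b * ∑ t ∈ Finset.Icc s b, x t| ≤ r :=
  leftWeight_mul_sum_le hr hsb hbe (h s b le_rfl hsb hbe.le)

lemma SumsBounded.right {x : ℕ → ℝ} {r : ℝ} (h : SumsBounded x s e r) (hr : 0 ≤ r) (hsb : s ≤ b)
    (hbe : b < e) : |rightWeight s e b * ∑ t ∈ Finset.Icc (b + 1) e, x t| ≤ r := by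
  refine rightWeight_mul_sum_le hr hsb hbe ?_
  have := h (b + 1) e (by omega) hbe le_rfl
  rwa [show (e : ℝ) - ((b + 1 : ℕ) : ℝ) + 1 = e - b by push_cast; ring] at this

lemma SumsBounded.abs_cusum_le {x : ℕ → ℝ} {r : ℝ} (h : SumsBounded x s e r) (hr : 0 ≤ r)
    (hsb : s ≤ b) (hbe : b < e) : |cusum x s e b| ≤ 2 * r := by
  rw [cusum_eq]
  have h1 := h.left hr hsb hbe
  have h2 := h.right hr hsb hbe
  refine (abs_sub _ _).trans ?_
  linarith

/-- The variation of a CUSUM statistic between two candidates. -/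
lemma SumsBounded.abs_cusum_sub_le {x : ℕ → ℝ} {r r' : ℝ} (h : SumsBounded x s e r') (hr' : 0 ≤ r')
    (hr : 0 ≤ r) (hsb : s ≤ b) (hbc : b ≤ c) (hce : c < e)
    (hx : |∑ t ∈ Finset.Icc (b + 1) c, x t| ≤ r * √((c : ℝ) - b)) :
    |cusum x s e c - cusum x s e b|
      ≤ 2 * r' * (cusumRatio s e b c - 1) + r * √(cusumRatio s e b c ^ 2 - 1) := by
  have hz := one_le_cusumRatio hsb hbc hce
  have hzs := cusumRatio_sq hsb (by omega : b < e) (by omega : s ≤ c) hce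
  have h1 := left_length_pos hsb
  have h2 := right_length_pos (by omega : b < e)
  have h3 := left_length_pos (by omega : s ≤ c)
  have h4 := right_length_pos hce
  have hn : 0 < (e : ℝ) - s + 1 := by linarith
  have hbc' : (b : ℝ) ≤ c := by exact_mod_cast hbc
  have hA := h.left hr' hsb (by omega : b < e)
  have hB := h.right hr' hsb (by omega : b < e)
  have hw := weight_add (by omega : s ≤ c) hce
  rw [leftWeight_eq_div_ratio hsb (by omega) (by omega : s ≤ c) hce,
    rightWeight_eq_ratio_mul hsb (by omega) (by omega : s ≤ c) hce] at hw
  rw [cusum_right x hsb hbc hce, cusum_eq]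
  set z := cusumRatio s e b c
  set D := ∑ t ∈ Finset.Icc (b + 1) c, x t
  set A := ∑ t ∈ Finset.Icc s b, x t
  set B := ∑ t ∈ Finset.Icc (b + 1) e, x t
  set P := leftWeight s e b
  set Q := rightWeight s e b
  -- Two effects are separated: the reweighting of the old sums, by factors within `z - 1` of 1, and
  -- the transfer of the block sum `D`.
  have e1 : P / z * (A + D) - z * Q * (B - D) - (P * A - Q * B)
      = (P * A) * (1 / z - 1) - (Q * B) * (z - 1) + D * (P / z + z * Q) := by
    have : z ≠ 0 := by positivity
    field_simp
    ring
  rw [e1, hw]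
  have e2 : |1 / z - 1| ≤ z - 1 := by
    have h0 : 0 < z := by linarith
    have h5 : 1 / z ≤ 1 := by rw [div_le_one h0]; exact hz
    rw [abs_of_nonpos (by linarith)]
    have : 1 / z * z = 1 := by field_simp
    nlinarith [sq_nonneg (z - 1)]
  have e3 : |D * √(((e : ℝ) - s + 1) / (((c : ℝ) - s + 1) * ((e : ℝ) - c)))|
      ≤ r * √(z ^ 2 - 1) := by
    rw [abs_mul, abs_of_nonneg (Real.sqrt_nonneg _)]
    refine (mul_le_mul_of_nonneg_right hx (Real.sqrt_nonneg _)).trans ?_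
    rw [mul_assoc, ← Real.sqrt_mul (by linarith)]
    refine mul_le_mul_of_nonneg_left (Real.sqrt_le_sqrt ?_) hr
    rw [← mul_div_assoc, ← hzs, div_le_iff₀ (by positivity)]
    have hz2 : 0 ≤ z ^ 2 - 1 := by nlinarith
    refine mul_le_mul_of_nonneg_left ?_ hz2
    nlinarith
  have e4 : |P * A * (1 / z - 1)| ≤ r' * (z - 1) := by
    rw [abs_mul]
    exact mul_le_mul hA e2 (abs_nonneg _) hr'
  have e5 : |Q * B * (z - 1)| ≤ r' * (z - 1) := by
    rw [abs_mul, abs_of_nonneg (by linarith : 0 ≤ z - 1)]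
    exact mul_le_mul_of_nonneg_right hB (by linarith)
  refine (abs_add_le _ _).trans ?_
  have := abs_sub (P * A * (1 / z - 1)) (Q * B * (z - 1))
  linarith

end

/-! ## Localisation of the maximum -/

lemma dist_le_of_ratio {n d z Y : ℝ} (hn : 0 < n) (hz : 1 ≤ z) (hzd : (z ^ 2 - 1) * Y = d * n)
    (hYn : Y ≤ n ^ 2) : d ≤ (z ^ 2 - 1) * n := by
  have hz2 : 0 ≤ z ^ 2 - 1 := by nlinarith
  have h1 := mul_le_mul_of_nonneg_left hYn hz2
  rw [hzd] at h1
  refine le_of_mul_le_mul_right (h1.trans (le_of_eq ?_)) hn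
  ring

/-- `Γ` is the value at `z = 1`, that is, at the maximiser; the factor `u - v / z` plays the role of
a slope. -/
lemma curve_sub {Γ u v z : ℝ} (hΓ : u + v = Γ) (hz : 0 < z) :
    v / z + u * z - Γ = (z - 1) * (u - v / z) := by
  rw [← hΓ]; field_simp; ring

/-- For `z > 1 + δ / 8` the slope is at least `δ Γ / 18`, because `(1 - δ / 9) (1 + δ / 8) ≥ 1` for
`δ ≤ 1`. The gain `δ² Γ / 144` then exceeds what the noise allows. -/
lemma ratio_le_of_curve_le {δ Γ u v z r : ℝ} (hδ : 0 < δ) (hδ1 : δ ≤ 1) (hΓ0 : 0 < Γ)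
    (hΓ : u + v = Γ) (huv : v ≤ u) (hK : 1152 * r ≤ δ ^ 2 * Γ)
    (h : (z - 1) * (u - v / z) ≤ 4 * r) : z ≤ 1 + δ / 8 := by
  by_contra hcon
  push Not at hcon
  have hz0 : 0 < z := by linarith
  have h1 : Γ / 2 * (δ / 9) ≤ u - v / z := by
    rcases le_or_gt v 0 with hv | hv
    · have h2 : v / z ≤ 0 := div_nonpos_of_nonpos_of_nonneg hv hz0.le
      have h3 : Γ / 2 * (δ / 9) ≤ Γ / 2 * 1 := mul_le_mul_of_nonneg_left (by linarith) (by linarith)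
      linarith
    · have h2 : v / z ≤ u * (1 - δ / 9) := by
        rw [div_le_iff₀ hz0]
        have h3 : (1 - δ / 9) * (1 + δ / 8) ≤ (1 - δ / 9) * z :=
          mul_le_mul_of_nonneg_left hcon.le (by linarith)
        have h4 : 1 ≤ (1 - δ / 9) * z := by nlinarith
        have h5 : u * 1 ≤ u * ((1 - δ / 9) * z) := mul_le_mul_of_nonneg_left h4 (by linarith)
        linarith
      have h6 : Γ / 2 * (δ / 9) ≤ u * (δ / 9) := mul_le_mul_of_nonneg_right (by linarith) (by linarith)
      linarith
  have h3 : δ / 8 * (Γ / 2 * (δ / 9)) ≤ (z - 1) * (u - v / z) :=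
    mul_le_mul (by linarith) h1 (by positivity) (by linarith)
  have h4 : δ / 8 * (Γ / 2 * (δ / 9)) = δ ^ 2 * Γ / 144 := by ring
  have h5 : 0 < δ ^ 2 * Γ := by positivity
  linarith

/-- For `u` close to `v` the slope at `z = 1` could vanish. This is ruled out by the jump on the
other side, which is far away (`w ≥ 1 + δ / 8`): since moving there gains little as well, `v` is
smaller than `u` by a definite fraction of `u`, up to noise. -/
lemma slope_lower_bound {δ Γ u v z w r : ℝ} (hδ : 0 < δ) (hδ1 : δ ≤ 1)
    (hΓ : u + v = Γ) (huv : v ≤ u) (hv : 0 < v) (hK : 1152 * r ≤ δ ^ 2 * Γ) (hz : 1 ≤ z)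
    (hr : 0 < r) (hw : 1 + δ / 8 ≤ w) (hw4 : (w - 1) * (v - u / w) ≤ 4 * r) :
    δ * Γ / 36 ≤ u - v / z := by
  have hz0 : 0 < z := by linarith
  have hw0 : 0 < w := by linarith
  have hvz : v / z ≤ v := div_le_self hv.le hz
  have h2 : v - u / w ≤ 32 * r / δ := by
    rw [le_div_iff₀ hδ]
    rcases le_or_gt (v - u / w) 0 with h | h
    · have := mul_nonpos_of_nonpos_of_nonneg h hδ.le
      linarith
    · have := mul_le_mul_of_nonneg_right (by linarith : δ / 8 ≤ w - 1) h.le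
      linarith
  have h3 : u / w ≤ u * (1 - δ / 9) := by
    rw [div_le_iff₀ hw0]
    have h3 : (1 - δ / 9) * (1 + δ / 8) ≤ (1 - δ / 9) * w :=
      mul_le_mul_of_nonneg_left hw (by linarith)
    have h4 : 1 ≤ (1 - δ / 9) * w := by nlinarith
    have h5 : u * 1 ≤ u * ((1 - δ / 9) * w) := mul_le_mul_of_nonneg_left h4 (by linarith)
    linarith
  have h4 : 32 * r / δ ≤ δ * Γ / 36 := by
    rw [div_le_iff₀ hδ]
    have : δ * Γ / 36 * δ = δ ^ 2 * Γ / 36 := by ring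
    linarith
  have h6 : Γ / 2 * (δ / 9) ≤ u * (δ / 9) := mul_le_mul_of_nonneg_right (by linarith) (by linarith)
  linarith

/-- The global noise `r'` only enters with the factor `z - 1` and is absorbed by half of the slope.
What remains compares `z² - 1` with `√(z² - 1)`, so only the local level `r` survives; `46656 =
216²`. -/
lemma sq_ratio_le {δ Γ z r r' a : ℝ} (hδ : 0 < δ) (hΓ0 : 0 < Γ)
    (hK : 144 * r' ≤ δ * Γ) (hz : 1 ≤ z) (hz2 : z ≤ 2) (ha : δ * Γ / 36 ≤ a)
    (h : (z - 1) * a ≤ 2 * r' * (z - 1) + r * √(z ^ 2 - 1)) :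
    (z ^ 2 - 1) * (δ * Γ) ^ 2 ≤ 46656 * r ^ 2 := by
  have hy : 0 ≤ z ^ 2 - 1 := by nlinarith
  have h1 : (z - 1) * (δ * Γ / 72) ≤ r * √(z ^ 2 - 1) := by
    have h2 : (z - 1) * (δ * Γ / 36) ≤ (z - 1) * a :=
      mul_le_mul_of_nonneg_left ha (by linarith)
    have h3 : (z - 1) * (2 * r') ≤ (z - 1) * (δ * Γ / 72) :=
      mul_le_mul_of_nonneg_left (by linarith) (by linarith)
    linarith
  have h2 : z ^ 2 - 1 ≤ 3 * (z - 1) := by nlinarith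
  have h3 : (z ^ 2 - 1) * (δ * Γ) ≤ 216 * r * √(z ^ 2 - 1) := by
    have := mul_le_mul_of_nonneg_right h2 (mul_pos hδ hΓ0).le
    linarith
  set y := z ^ 2 - 1
  have hs : √y * √y = y := Real.mul_self_sqrt hy
  rcases (Real.sqrt_nonneg y).eq_or_lt with h0 | h0
  · rw [← hs, ← h0]
    have : 0 ≤ r ^ 2 := sq_nonneg r
    linarith
  · have h5 : √y * (δ * Γ) ≤ 216 * r := by
      have : √y * (√y * (δ * Γ)) ≤ √y * (216 * r) := by
        rw [← mul_assoc, hs]; linarith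
      exact le_of_mul_le_mul_left this h0
    have h6 : 0 ≤ √y * (δ * Γ) := by positivity
    calc y * (δ * Γ) ^ 2 = (√y * (δ * Γ)) ^ 2 := by rw [mul_pow (√y), sq (√y), hs]
      _ ≤ (216 * r) ^ 2 := pow_le_pow_left₀ h6 h5 2
      _ = 46656 * r ^ 2 := by ring

/-- The distance `d` between a maximiser and the next kink of a curve `z ↦ v / z + u * z` perturbed
by noise, in a parametrisation by the ratio `z` of weights. -/
lemma localization_core {δ L n r r' Γ u v z d Y : ℝ} (hδ : 0 < δ) (hδ1 : δ ≤ 1) (hn : 0 < n)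
    (hL : n ≤ L) (hΓ : u + v = Γ) (huv : v ≤ u) (hr' : 0 < r')
    (hK : 1152 * r' ≤ δ ^ 2 * Γ) (hz : 1 ≤ z) (hzd : (z ^ 2 - 1) * Y = d * n)
    (hYn : Y ≤ n ^ 2) (hcoarse : v / z + u * z - Γ ≤ 4 * r')
    (hsharp : d ≤ δ * L / 2 → v / z + u * z - Γ ≤ 2 * r' * (z - 1) + r * √(z ^ 2 - 1))
    (hother : v = 0 ∨ ∃ w d' Y', 1 ≤ w ∧ (w ^ 2 - 1) * Y' = d' * n ∧ Y' ≤ n ^ 2 ∧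
      δ * L ≤ d + d' ∧ v * w + u / w - Γ ≤ 4 * r') :
    d * Γ ^ 2 * δ ^ 2 ≤ 46656 * r ^ 2 * L := by
  have hδ2 : 0 < δ ^ 2 := by positivity
  have hΓ0 : 0 < Γ := pos_of_mul_pos_right (lt_of_lt_of_le (by linarith) hK) hδ2.le
  have hδΓ : δ ^ 2 * Γ ≤ δ * Γ := by
    refine mul_le_mul_of_nonneg_right ?_ hΓ0.le
    nlinarith
  have hLpos : 0 < L := hn.trans_le hL
  have hz0 : 0 < z := by linarith
  rw [curve_sub hΓ hz0] at hcoarse hsharp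
  have hzle := ratio_le_of_curve_le hδ hδ1 hΓ0 hΓ huv hK hcoarse
  have hzsq : z ^ 2 - 1 ≤ δ / 2 := by nlinarith
  have hzsq0 : 0 ≤ z ^ 2 - 1 := by nlinarith
  have hdn := dist_le_of_ratio hn hz hzd hYn
  have hdle : d ≤ (z ^ 2 - 1) * L := hdn.trans (mul_le_mul_of_nonneg_left hL hzsq0)
  have hdhalf : d ≤ δ * L / 2 := by
    have := mul_le_mul_of_nonneg_right hzsq hLpos.le
    linarith
  have hκ : δ * Γ / 36 ≤ u - v / z := by
    have hsmall : δ * Γ / 36 ≤ Γ / 2 := by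
      have := mul_le_mul_of_nonneg_right hδ1 hΓ0.le
      linarith
    rcases le_or_gt v 0 with hv | hv
    · have : v / z ≤ 0 := div_nonpos_of_nonpos_of_nonneg hv hz0.le
      linarith
    · rcases hother with h | ⟨w, d', Y', hw, hwd, hYn', hdd, hw4⟩
      · linarith
      · have hw0 : 0 < w := by linarith
        have h1 := dist_le_of_ratio hn hw hwd hYn'
        have h2 : δ * n / 2 ≤ δ * L / 2 := by
          have := mul_le_mul_of_nonneg_left hL hδ.le
          linarith
        have h3 : δ / 2 ≤ w ^ 2 - 1 := le_of_mul_le_mul_right (by linarith) hn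
        -- The maximiser is within `δ L / 2` of the near jump, so by separation the other one is at
        -- least `δ L / 2` away, which forces `w² - 1 ≥ δ / 2`.
        have hwge : 1 + δ / 8 ≤ w := by
          by_contra hcon
          push Not at hcon
          nlinarith
        rw [show v * w + u / w - Γ = u / w + v * w - Γ by ring,
          curve_sub (by rw [add_comm]; exact hΓ) hw0] at hw4
        exact slope_lower_bound hδ hδ1 hΓ huv hv hK hz hr' hwge hw4
  have h4 := sq_ratio_le hδ hΓ0 (by linarith) hz (by linarith) hκ (hsharp hdhalf)
  calc d * Γ ^ 2 * δ ^ 2 = d * (δ * Γ) ^ 2 := by ring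
    _ ≤ ((z ^ 2 - 1) * L) * (δ * Γ) ^ 2 := mul_le_mul_of_nonneg_right hdle (by positivity)
    _ = ((z ^ 2 - 1) * (δ * Γ) ^ 2) * L := by ring
    _ ≤ 46656 * r ^ 2 * L := mul_le_mul_of_nonneg_right h4 hLpos.le


/-- The jumps of `g` inside `[s, e]` are at least `D` apart. -/
def JumpsSeparated (g : ℕ → ℝ) (s e : ℕ) (D : ℝ) : Prop :=
  ∀ c c', s ≤ c → c < c' → c' < e → g c ≠ g (c + 1) → g c' ≠ g (c' + 1) → D ≤ (c' : ℝ) - c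

/-- The standardised partial sums of `ζ` over the parts of `[s, e]` that are within distance `D` of
a jump of `g` are at most `r`. -/
def SumsBoundedNearJumps (g ζ : ℕ → ℝ) (s e : ℕ) (D r : ℝ) : Prop :=
  ∀ c l m : ℕ, s ≤ c → c < e → g c ≠ g (c + 1) → s ≤ l → l ≤ m → m ≤ e →
    (c : ℝ) - D ≤ l → (m : ℝ) ≤ c + D → |∑ t ∈ Finset.Icc l m, ζ t| ≤ r * √((m : ℝ) - l + 1)

lemma eq_of_no_jump {g : ℕ → ℝ} {l m : ℕ} (h : ∀ t, l ≤ t → t < m → g t = g (t + 1)) :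
    ∀ t, l ≤ t → t ≤ m → g t = g l := by
  intro t hlt
  induction t, hlt using Nat.le_induction with
  | base => intro; rfl
  | succ t hlt ih =>
    intro hm
    rw [← h t hlt (by omega), ih (by omega)]

lemma exists_next_jump (g : ℕ → ℝ) (b e : ℕ) :
    (∀ t, b ≤ t → t < e → g t = g (t + 1)) ∨
    ∃ c, b ≤ c ∧ c < e ∧ g c ≠ g (c + 1) ∧ ∀ t, b ≤ t → t < c → g t = g (t + 1) := by
  classical
  by_cases h : ∃ c, b ≤ c ∧ c < e ∧ g c ≠ g (c + 1)
  · right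
    obtain ⟨h1, h2, h3⟩ := Nat.find_spec h
    refine ⟨Nat.find h, h1, h2, h3, fun t ht htc => ?_⟩
    by_contra hne
    exact Nat.find_min h htc ⟨ht, htc.trans h2, hne⟩
  · left
    push Not at h
    exact h

lemma exists_previous_jump (g : ℕ → ℝ) (s b : ℕ) :
    (∀ t, s ≤ t → t < b → g t = g (t + 1)) ∨
    ∃ c, s ≤ c ∧ c < b ∧ g c ≠ g (c + 1) ∧ ∀ t, c < t → t < b → g t = g (t + 1) := by
  classical
  by_cases h : ∃ c, s ≤ c ∧ c < b ∧ g c ≠ g (c + 1)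
  · right
    obtain ⟨c₀, h0⟩ := h
    have hspec := Nat.findGreatest_spec (P := fun c => s ≤ c ∧ c < b ∧ g c ≠ g (c + 1))
      (n := b) h0.2.1.le h0
    refine ⟨_, hspec.1, hspec.2.1, hspec.2.2, fun t ht htb => ?_⟩
    by_contra hne
    exact Nat.findGreatest_is_greatest ht htb.le ⟨hspec.1.trans ht.le, htb, hne⟩
  · left
    push Not at h
    exact h

lemma mul_length_le_sq {s e b c : ℕ} (hsb : s ≤ b) (hbe : b < e) (hsc : s ≤ c) (hce : c < e) :
    ((e : ℝ) - c) * ((b : ℝ) - s + 1) ≤ ((e : ℝ) - s + 1) ^ 2 := by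
  have h1 := left_length_pos hsb
  have h2 := right_length_pos hbe
  have h3 := left_length_pos hsc
  have h4 := right_length_pos hce
  rw [sq]
  exact mul_le_mul (by linarith) (by linarith) h1.le (by linarith)

lemma sum_sub_eq_zero {g : ℕ → ℝ} {v : ℝ} {l m : ℕ} (h : ∀ t, l ≤ t → t ≤ m → g t = v) :
    ∑ t ∈ Finset.Icc l m, (g t - v) = 0 :=
  Finset.sum_eq_zero fun t ht => by
    rw [Finset.mem_Icc] at ht
    rw [h t ht.1 ht.2, sub_self]

/-- The adjacent jumps on both sides of `b` are put into the form of `localization_core`. A side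
without a jump contributes nothing to the sums of `g - g b`, so its coefficient `u` or `v` is zero.
-/
lemma localization_of_pos {g ζ : ℕ → ℝ} {s e b : ℕ} {δ L r r' : ℝ} (hδ : 0 < δ) (hδ1 : δ ≤ 1)
    (hsb : s ≤ b) (hbe : b < e) (hL : (e : ℝ) - s + 1 ≤ L) (hr' : 0 < r') (hr : 0 ≤ r)
    (hgap : JumpsSeparated g s e (δ * L)) (hζ : SumsBounded ζ s e r')
    (hζ' : SumsBoundedNearJumps g ζ s e (δ * L / 2) r)
    (hmax : ∀ c, s ≤ c → c < e →
      cusum g s e c + cusum ζ s e c ≤ cusum g s e b + cusum ζ s e b)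
    (hbig : 1152 * r' ≤ δ ^ 2 * cusum g s e b) :
    ∃ c, s ≤ c ∧ c < e ∧ g c ≠ g (c + 1) ∧
      |(b : ℝ) - c| * cusum g s e b ^ 2 * δ ^ 2 ≤ 46656 * r ^ 2 * L := by
  have hn : 0 < (e : ℝ) - s + 1 := by
    have := left_length_pos hsb
    have := right_length_pos hbe
    linarith
  have hLpos : 0 < L := hn.trans_le hL
  have hδL : 0 < δ * L := mul_pos hδ hLpos
  by_cases hjb : g b ≠ g (b + 1)
  · refine ⟨b, hsb, hbe, hjb, ?_⟩
    rw [sub_self, abs_zero]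
    have : 0 ≤ r ^ 2 := sq_nonneg r
    simp only [zero_mul]
    positivity
  push Not at hjb
  have hcoarse : ∀ c, s ≤ c → c < e → cusum g s e c - cusum g s e b ≤ 4 * r' := by
    intro c h1 h2
    have := hmax c h1 h2
    have h3 := hζ.abs_cusum_le hr'.le h1 h2
    have h4 := hζ.abs_cusum_le hr'.le hsb hbe
    rw [abs_le] at h3 h4
    linarith [h3.1, h4.2]
  have hsharp : ∀ c, s ≤ c → c < e → cusum g s e c - cusum g s e b
      ≤ |cusum ζ s e c - cusum ζ s e b| := by
    intro c h1 h2
    have := hmax c h1 h2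
    have := neg_abs_le (cusum ζ s e c - cusum ζ s e b)
    linarith
  set v₀ := g b with hv₀
  -- After subtraction of the local value `g b`, the block between `b` and the next jump has sum
  -- zero. Moving the candidate across it only rescales `v` and `u`.
  obtain ⟨v, hv⟩ : ∃ v, leftWeight s e b * ∑ t ∈ Finset.Icc s b, (g t - v₀) = v := ⟨_, rfl⟩
  obtain ⟨u, hu⟩ : ∃ u, -(rightWeight s e b * ∑ t ∈ Finset.Icc (b + 1) e, (g t - v₀)) = u :=
    ⟨_, rfl⟩
  have hΓ : u + v = cusum g s e b := by
    rw [← cusum_sub_const g v₀ hsb hbe, cusum_eq, hv, ← hu]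
    ring
  have hΓ0 : 0 < cusum g s e b := by
    refine pos_of_mul_pos_right (lt_of_lt_of_le (by linarith) hbig) (sq_nonneg δ)
  have hright : u = 0 ∨ ∃ c, b < c ∧ c < e ∧ g c ≠ g (c + 1) ∧
      cusum g s e c = v / cusumRatio s e b c + u * cusumRatio s e b c := by
    rcases exists_next_jump g b e with h | ⟨c, h1, h2, h3, h4⟩
    · left
      rw [← hu, sum_sub_eq_zero fun t ht hte => eq_of_no_jump h t (by omega) hte]
      simp
    · right
      have hbc : b < c := h1.lt_of_ne (by rintro rfl; exact h3 hjb)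
      refine ⟨c, hbc, h2, h3, ?_⟩
      rw [← cusum_sub_const g v₀ (by omega) h2, cusum_right _ hsb hbc.le h2,
        sum_sub_eq_zero fun t ht hte => eq_of_no_jump h4 t (by omega) hte, ← hu, ← hv]
      ring
  have hleft : v = 0 ∨ ∃ c, s ≤ c ∧ c < b ∧ g c ≠ g (c + 1) ∧
      cusum g s e c = v * cusumRatio s e c b + u / cusumRatio s e c b := by
    rcases exists_previous_jump g s b with h | ⟨c, h1, h2, h3, h4⟩
    · left
      rw [← hv, sum_sub_eq_zero fun t ht hte => by
        rw [eq_of_no_jump h t ht hte, hv₀, eq_of_no_jump h b hsb le_rfl]]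
      simp
    · right
      refine ⟨c, h1, h2, h3, ?_⟩
      rw [← cusum_sub_const g v₀ (by omega) (by omega), cusum_left _ h1 h2.le hbe,
        sum_sub_eq_zero (l := c + 1) (m := b) fun t ht hte => by
          rw [eq_of_no_jump h4 t ht hte, hv₀, eq_of_no_jump h4 b h2 le_rfl], ← hu, ← hv]
      ring
  rcases le_total v u with huv | huv
  · rcases hright with h0 | ⟨c, hbc, hce, hjc, hc⟩
    · linarith
    have hsc : s ≤ c := by omega
    have hbc' : (b : ℝ) < c := by exact_mod_cast hbc
    refine ⟨c, hsc, hce, hjc, ?_⟩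
    rw [abs_sub_comm, abs_of_pos (by linarith)]
    have hco := hcoarse c hsc hce
    have hsh := hsharp c hsc hce
    rw [hc] at hco hsh
    refine localization_core hδ hδ1 hn hL hΓ huv hr' hbig
      (one_le_cusumRatio hsb hbc.le hce) (cusumRatio_sq hsb hbe hsc hce)
      (mul_length_le_sq hsb hbe hsc hce) hco (fun hd => hsh.trans ?_) ?_
    · refine hζ.abs_cusum_sub_le hr'.le hr hsb hbc.le hce ?_
      have := hζ' c (b + 1) c hsc hce hjc (by omega) hbc hce.le
        (by push_cast; linarith) (by linarith)
      rwa [show (c : ℝ) - ((b + 1 : ℕ) : ℝ) + 1 = c - b by push_cast; ring] at this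
    · rcases hleft with h0 | ⟨c₁, hsc₁, hcb₁, hjc₁, hc₁⟩
      · exact Or.inl h0
      · right
        refine ⟨_, _, _, one_le_cusumRatio hsc₁ hcb₁.le hbe,
          cusumRatio_sq hsc₁ (by omega) hsb hbe, mul_length_le_sq hsc₁ (by omega) hsb hbe, ?_, ?_⟩
        · have := hgap c₁ c hsc₁ (by omega) hce hjc₁ hjc
          linarith
        · rw [← hc₁]
          exact hcoarse c₁ hsc₁ (by omega)
  -- The mirror image: the curve rises to the left and `u`, `v` exchange roles.
  · rcases hleft with h0 | ⟨c, hsc, hcb, hjc, hc⟩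
    · linarith
    have hce : c < e := by omega
    have hcb' : (c : ℝ) < b := by exact_mod_cast hcb
    refine ⟨c, hsc, hce, hjc, ?_⟩
    rw [abs_of_pos (by linarith)]
    have hco := hcoarse c hsc hce
    have hsh := hsharp c hsc hce
    rw [hc, add_comm (v * _)] at hco hsh
    refine localization_core hδ hδ1 hn hL ((add_comm v u).trans hΓ) huv hr' hbig
      (one_le_cusumRatio hsc hcb.le hbe) (cusumRatio_sq hsc hce hsb hbe)
      (mul_length_le_sq hsc hce hsb hbe) hco (fun hd => hsh.trans ?_) ?_
    · rw [abs_sub_comm]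
      refine hζ.abs_cusum_sub_le hr'.le hr hsc hcb.le hbe ?_
      have := hζ' c (c + 1) b hsc hce hjc (by omega) hcb hbe.le
        (by push_cast; linarith) (by linarith)
      rwa [show (b : ℝ) - ((c + 1 : ℕ) : ℝ) + 1 = b - c by push_cast; ring] at this
    · rcases hright with h0 | ⟨c₂, hbc₂, hce₂, hjc₂, hc₂⟩
      · exact Or.inl h0
      · right
        refine ⟨_, _, _, one_le_cusumRatio hsb hbc₂.le hce₂,
          cusumRatio_sq hsb hbe (by omega) hce₂, mul_length_le_sq hsb hbe (by omega) hce₂, ?_, ?_⟩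
        · have := hgap c c₂ hsc (by omega) hce₂ hjc hjc₂
          linarith
        · rw [add_comm, ← hc₂]
          exact hcoarse c₂ (by omega) hce₂

/-- The maximiser of the absolute CUSUM of a piecewise constant signal `g` with noise `ζ` is close to
a jump of `g`. The noise level `r` near the jumps determines the rate; the possibly larger level `r'`
elsewhere only has to be small against the maximum. -/
theorem localization {g ζ : ℕ → ℝ} {s e b : ℕ} {δ L r r' : ℝ} (hδ : 0 < δ) (hδ1 : δ ≤ 1)
    (hsb : s ≤ b) (hbe : b < e) (hL : (e : ℝ) - s + 1 ≤ L) (hr' : 0 < r') (hr : 0 ≤ r)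
    (hgap : JumpsSeparated g s e (δ * L)) (hζ : SumsBounded ζ s e r')
    (hζ' : SumsBoundedNearJumps g ζ s e (δ * L / 2) r)
    (hmax : ∀ c, s ≤ c → c < e →
      |cusum (fun t => g t + ζ t) s e c| ≤ |cusum (fun t => g t + ζ t) s e b|)
    (hbig : 2304 * r' ≤ δ ^ 2 * |cusum (fun t => g t + ζ t) s e b|) :
    ∃ c, s ≤ c ∧ c < e ∧ g c ≠ g (c + 1) ∧
      |(b : ℝ) - c| * |cusum (fun t => g t + ζ t) s e b| ^ 2 * δ ^ 2 ≤ 186624 * r ^ 2 * L := by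
  have key : ∀ g ζ : ℕ → ℝ, JumpsSeparated g s e (δ * L) → SumsBounded ζ s e r' →
      SumsBoundedNearJumps g ζ s e (δ * L / 2) r →
      (∀ c, s ≤ c → c < e →
        cusum g s e c + cusum ζ s e c ≤ cusum g s e b + cusum ζ s e b) →
      2304 * r' ≤ δ ^ 2 * (cusum g s e b + cusum ζ s e b) →
      ∃ c, s ≤ c ∧ c < e ∧ g c ≠ g (c + 1) ∧
        |(b : ℝ) - c| * (cusum g s e b + cusum ζ s e b) ^ 2 * δ ^ 2 ≤ 186624 * r ^ 2 * L := by
    intro g ζ hgap hζ hζ' hmax hbig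
    have h1 := (abs_le.mp (hζ.abs_cusum_le hr'.le hsb hbe)).2
    set V := cusum g s e b + cusum ζ s e b
    have hδ2 : δ ^ 2 ≤ 1 := by nlinarith
    have hV0 : 0 < V := pos_of_mul_pos_right (lt_of_lt_of_le (by linarith) hbig) (sq_nonneg δ)
    have hV : 2304 * r' ≤ V := hbig.trans (by nlinarith)
    -- The noise takes at most half of the observed maximum. Hence `2304 = 2 * 1152`, and the rate
    -- constant becomes `4 * 46656 = 186624`.
    have h2 : V / 2 ≤ cusum g s e b := by
      have : V = cusum g s e b + cusum ζ s e b := rfl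
      linarith
    have h3 : δ ^ 2 * (V / 2) ≤ δ ^ 2 * cusum g s e b :=
      mul_le_mul_of_nonneg_left h2 (sq_nonneg δ)
    obtain ⟨c, hc1, hc2, hc3, hc4⟩ := localization_of_pos hδ hδ1 hsb hbe hL hr' hr hgap hζ hζ' hmax
      (by linarith)
    refine ⟨c, hc1, hc2, hc3, ?_⟩
    have h4 : (V / 2) ^ 2 ≤ cusum g s e b ^ 2 := pow_le_pow_left₀ (by linarith) h2 2
    have h5 : |(b : ℝ) - c| * (V / 2) ^ 2 * δ ^ 2 ≤ |(b : ℝ) - c| * cusum g s e b ^ 2 * δ ^ 2 :=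
      mul_le_mul_of_nonneg_right (mul_le_mul_of_nonneg_left h4 (abs_nonneg _)) (sq_nonneg δ)
    have h6 : |(b : ℝ) - c| * (V / 2) ^ 2 * δ ^ 2 = |(b : ℝ) - c| * V ^ 2 * δ ^ 2 / 4 := by ring
    linarith
  rw [cusum_add] at hbig ⊢
  rcases le_total 0 (cusum g s e b + cusum ζ s e b) with hsign | hsign
  · rw [abs_of_nonneg hsign] at hbig ⊢
    refine key g ζ hgap hζ hζ' (fun c h1 h2 => ?_) hbig
    have := hmax c h1 h2
    rw [cusum_add, cusum_add, abs_of_nonneg hsign] at this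
    exact (le_abs_self _).trans this
  · rw [abs_of_nonpos hsign] at hbig ⊢
    -- A negative CUSUM is handled by changing the sign of the data.
    have := key (fun t => -g t) (fun t => -ζ t)
      (fun c c' h1 h2 h3 h4 h5 => hgap c c' h1 h2 h3 (fun h => h4 (congrArg Neg.neg h))
        (fun h => h5 (congrArg Neg.neg h)))
      (fun l m h1 h2 h3 => by
        rw [Finset.sum_neg_distrib, abs_neg]
        exact hζ l m h1 h2 h3)
      (fun c l m h1 h2 h3 h4 h5 h6 h7 h8 => by
        rw [Finset.sum_neg_distrib, abs_neg]
        exact hζ' c l m h1 h2 (fun h => h3 (congrArg Neg.neg h)) h4 h5 h6 h7 h8)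
      (fun c h1 h2 => by
        have := hmax c h1 h2
        rw [cusum_add, cusum_add, abs_of_nonpos hsign] at this
        simp only [cusum_neg]
        have := (neg_le_abs _).trans this
        linarith)
      (by simp only [cusum_neg]; linarith)
    obtain ⟨c, h1, h2, h3, h4⟩ := this
    refine ⟨c, h1, h2, fun h => h3 (by rw [h]), ?_⟩
    simp only [cusum_neg] at h4
    convert h4 using 3
    ring

/-- The size of the CUSUM at the only jump of a signal. -/
lemma abs_cusum_single_jump {g : ℕ → ℝ} {s e c : ℕ} (hsc : s ≤ c) (hce : c < e)
    (hl : ∀ t, s ≤ t → t ≤ c → g t = g c) (hr : ∀ t, c + 1 ≤ t → t ≤ e → g t = g (c + 1)) {a : ℝ}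
    (ha : 0 ≤ a) (h1 : a ≤ (c : ℝ) - s + 1) (h2 : a ≤ (e : ℝ) - c) :
    |g (c + 1) - g c| * √(a / 2) ≤ |cusum g s e c| := by
  have hq := left_length_pos hsc
  have hp := right_length_pos hce
  have hn : 0 < (e : ℝ) - s + 1 := by linarith
  rw [← cusum_sub_const g (g c) hsc hce, cusum_eq, sum_sub_eq_zero hl, mul_zero, zero_sub, abs_neg,
    abs_mul, abs_of_nonneg (rightWeight_nonneg _ _ _),
    Finset.sum_congr rfl (fun t ht => by
      rw [Finset.mem_Icc] at ht; rw [hr t ht.1 ht.2] : ∀ t ∈ Finset.Icc (c + 1) e,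
        g t - g c = g (c + 1) - g c),
    Finset.sum_const, Nat.card_Icc, nsmul_eq_mul, abs_mul, Nat.abs_cast,
    show e + 1 - (c + 1) = e - c by omega, Nat.cast_sub hce.le]
  have h3 : √(a / 2) ≤ rightWeight s e c * ((e : ℝ) - c) := by
    rw [rightWeight, ← Real.sqrt_sq hp.le, ← Real.sqrt_mul (by rw [Real.sqrt_sq hp.le]; positivity),
      Real.sqrt_sq hp.le]
    refine Real.sqrt_le_sqrt ?_
    rw [div_mul_eq_mul_div, div_le_div_iff₀ (by norm_num) (by positivity)]
    have h4 : a * ((e : ℝ) - s + 1) ≤ 2 * (((c : ℝ) - s + 1) * ((e : ℝ) - c)) := by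
      nlinarith
    nlinarith [mul_le_mul_of_nonneg_right h4 hp.le]
  calc |g (c + 1) - g c| * √(a / 2)
      ≤ |g (c + 1) - g c| * (rightWeight s e c * ((e : ℝ) - c)) :=
        mul_le_mul_of_nonneg_left h3 (abs_nonneg _)
    _ = _ := by ring


/-! ## Signals with separated change-points -/

/-- The size of the jump at the `i`-th change-point. -/
noncomputable def jumpSize (f : ℕ → ℝ) (η : ℕ → ℕ) (i : ℕ) : ℝ := |f (η i) - f (η i - 1)|

/-- The quantitative assumptions under which the solution path is analysed: `lam` is the noise
level, `A` the bound for the products of the squared jump sizes with the estimation errors. -/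
structure Regime (f : ℕ → ℝ) (T N : ℕ) (η : ℕ → ℕ) (δ fT A lam : ℝ) : Prop where
  cp : IsChangePoints f T N η
  spacing : ∀ i, 1 ≤ i → i ≤ N + 1 → δ * T ≤ (η i : ℝ) - η (i - 1)
  jumps : ∀ i, 1 ≤ i → i ≤ N → fT ≤ jumpSize f η i
  delta_pos : 0 < δ
  delta_le_one : δ ≤ 1
  fT_pos : 0 < fT
  lam_pos : 0 < lam
  A_nonneg : 0 ≤ A
  rate : ∀ i, 1 ≤ i → i ≤ N → jumpSize f η i ^ 2 + 4665600 * lam ^ 2 / δ ^ 3 ≤ A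
  radius : 12 * A ≤ δ * T * fT ^ 2
  length : 12 ≤ δ * T
  signal : 2304 * (lam + 2 * √A) ≤ δ ^ 2 * (√δ / 5 * fT * √T)

/-- `s` is the start of `[1, T]` or follows an accurate estimate of `η i`. -/
def LeftEnd (f : ℕ → ℝ) (N : ℕ) (η : ℕ → ℕ) (A : ℝ) (i s : ℕ) : Prop :=
  (i = 0 ∧ s = 1) ∨ (1 ≤ i ∧ i ≤ N ∧ |(s : ℝ) - 1 - η i| * jumpSize f η i ^ 2 ≤ A)

/-- `e` is the end of `[1, T]` or an accurate estimate of `η j`. -/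
def RightEnd (f : ℕ → ℝ) (T N : ℕ) (η : ℕ → ℕ) (A : ℝ) (j e : ℕ) : Prop :=
  (j = N + 1 ∧ e = T) ∨ (1 ≤ j ∧ j ≤ N ∧ |(e : ℝ) - η j| * jumpSize f η j ^ 2 ≤ A)

/-- The signal `f` with its values outside `[η i, η j - 1]` replaced by the nearest inner value. -/
def clamped (f : ℕ → ℝ) (η : ℕ → ℕ) (i j t : ℕ) : ℝ := f (max (η i) (min t (η j - 1)))

/-- The intervals around `η r` that allow its detection. -/
def goodIntervals (η : ℕ → ℕ) (δ : ℝ) (T r : ℕ) : Set (ℕ × ℕ) :=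
  {p | (η r : ℝ) - 2 * (δ * T) / 3 ≤ p.1 ∧ (p.1 : ℝ) ≤ η r - δ * T / 3 ∧
    (η r : ℝ) + δ * T / 3 ≤ p.2 ∧ (p.2 : ℝ) ≤ η r + 2 * (δ * T) / 3}

/-- A change-point with the largest jump among those strictly between `η i` and `η j`. -/
noncomputable def largestJump (f : ℕ → ℝ) (η : ℕ → ℕ) (i j : ℕ) : ℕ :=
  Classical.epsilon fun r => i < r ∧ r < j ∧ ∀ k, i < k → k < j → jumpSize f η k ≤ jumpSize f η r

lemma largestJump_spec (f : ℕ → ℝ) (η : ℕ → ℕ) {i j : ℕ} (hij : i + 2 ≤ j) :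
    i < largestJump f η i j ∧ largestJump f η i j < j ∧
      ∀ k, i < k → k < j → jumpSize f η k ≤ jumpSize f η (largestJump f η i j) := by
  refine Classical.epsilon_spec
    (p := fun r => i < r ∧ r < j ∧ ∀ k, i < k → k < j → jumpSize f η k ≤ jumpSize f η r) ?_
  obtain ⟨r, hr, hmax⟩ := Finset.exists_max_image (Finset.Ioo i j) (jumpSize f η)
    ⟨i + 1, Finset.mem_Ioo.mpr ⟨by omega, by omega⟩⟩
  rw [Finset.mem_Ioo] at hr
  exact ⟨r, hr.1, hr.2, fun k h1 h2 => hmax k (Finset.mem_Ioo.mpr ⟨h1, h2⟩)⟩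

namespace Regime

variable {f : ℕ → ℝ} {T N : ℕ} {η : ℕ → ℕ} {δ fT A lam : ℝ}

lemma strictMono (h : Regime f T N η δ fT A lam) {i j : ℕ} (hij : i < j) (hj : j ≤ N + 1) :
    η i < η j := by
  induction j, hij using Nat.le_induction with
  | base => exact h.cp.lt_succ i (by omega)
  | succ j hij ih => exact (ih (by omega)).trans (h.cp.lt_succ j (by omega))

lemma mono (h : Regime f T N η δ fT A lam) {i j : ℕ} (hij : i ≤ j) (hj : j ≤ N + 1) :
    η i ≤ η j := by
  rcases hij.eq_or_lt with rfl | hij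
  · exact le_rfl
  · exact (h.strictMono hij hj).le

lemma lt_of_eta_lt (h : Regime f T N η δ fT A lam) {i j : ℕ} (hi : i ≤ N + 1)
    (hij : η i < η j) : i < j := by
  by_contra hcon
  exact absurd (h.mono (not_lt.mp hcon) hi) (by omega)

lemma one_le_eta (h : Regime f T N η δ fT A lam) {i : ℕ} (hi : i ≤ N + 1) : 1 ≤ η i := by
  rw [← h.cp.zero]
  exact h.mono (Nat.zero_le i) hi

lemma eta_le (h : Regime f T N η δ fT A lam) {i : ℕ} (hi : i ≤ N + 1) : η i ≤ T + 1 := by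
  rw [← h.cp.last]
  exact h.mono hi le_rfl

lemma gap (h : Regime f T N η δ fT A lam) {i j : ℕ} (hij : i < j) (hj : j ≤ N + 1) :
    δ * T ≤ (η j : ℝ) - η i := by
  have h1 := h.spacing j (by omega) hj
  have h2 : (η i : ℝ) ≤ η (j - 1) := by
    exact_mod_cast h.mono (by omega : i ≤ j - 1) (by omega)
  linarith

lemma signal_const (h : Regime f T N η δ fT A lam) {i t : ℕ} (hi : i ≤ N) (h1 : η i ≤ t)
    (h2 : t < η (i + 1)) : f t = f (η i) := by
  induction t, h1 using Nat.le_induction with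
  | base => rfl
  | succ t ht ih =>
    rw [← ih (by omega)]
    by_contra hne
    have h3 := h.one_le_eta (by omega : i ≤ N + 1)
    have h4 := h.eta_le (by omega : i + 1 ≤ N + 1)
    obtain ⟨k, hk1, hk2, hk⟩ := (h.cp.jump_iff (t + 1) (by omega) (by omega)).mp hne
    have h5 := h.lt_of_eta_lt (by omega : i ≤ N + 1) (by omega : η i < η k)
    have h6 := h.lt_of_eta_lt (by omega : k ≤ N + 1) (by omega : η k < η (i + 1))
    omega

/-- Accurate estimates are off by at most a twelfth of the minimal spacing. This leaves room for
whole detecting intervals and keeps the estimates in order. -/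
lemma dist_le (h : Regime f T N η δ fT A lam) {i : ℕ} (h1 : 1 ≤ i) (hi : i ≤ N) {a : ℝ}
    (ha : a * jumpSize f η i ^ 2 ≤ A) : a ≤ δ * T / 12 := by
  have h2 := h.jumps i h1 hi
  have h3 := h.fT_pos
  have h4 : 0 < jumpSize f η i ^ 2 := by
    have : 0 < jumpSize f η i := h3.trans_le h2
    positivity
  have h5 : fT ^ 2 ≤ jumpSize f η i ^ 2 := pow_le_pow_left₀ h3.le h2 2
  have h6 := h.radius
  have h7 : δ * T * fT ^ 2 ≤ δ * T * jumpSize f η i ^ 2 :=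
    mul_le_mul_of_nonneg_left h5 (by linarith [h.length])
  refine le_of_mul_le_mul_right ?_ h4
  linarith

lemma leftEnd_bounds (h : Regime f T N η δ fT A lam) {i s : ℕ} (hs : LeftEnd f N η A i s) :
    (η i : ℝ) - δ * T / 12 ≤ s ∧ (s : ℝ) ≤ η i + δ * T / 6 := by
  have hl := h.length
  rcases hs with ⟨rfl, rfl⟩ | ⟨h1, h2, h3⟩
  · rw [h.cp.zero]
    push_cast
    constructor <;> linarith
  · have := abs_le.mp (h.dist_le h1 h2 h3)
    constructor <;> linarith

lemma rightEnd_bounds (h : Regime f T N η δ fT A lam) {j e : ℕ} (he : RightEnd f T N η A j e) :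
    (η j : ℝ) - δ * T / 12 ≤ e ∧ (e : ℝ) ≤ η j + δ * T / 12 := by
  have hl := h.length
  rcases he with ⟨rfl, rfl⟩ | ⟨h1, h2, h3⟩
  · rw [h.cp.last]
    push_cast
    constructor <;> linarith
  · have := abs_le.mp (h.dist_le h1 h2 h3)
    constructor <;> linarith

lemma clamped_eq {i j t : ℕ} (h1 : η i ≤ t) (h2 : t < η j) :
    clamped f η i j t = f t := by
  unfold clamped
  congr 1
  omega

lemma clamped_left (h : Regime f T N η δ fT A lam) {i j t : ℕ} (hij : i < j) (hj : j ≤ N + 1)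
    (h1 : t ≤ η i) : clamped f η i j t = f (η i) := by
  have := h.strictMono hij hj
  unfold clamped
  congr 1
  omega

lemma clamped_right (h : Regime f T N η δ fT A lam) {i j t : ℕ} (hij : i < j) (hj : j ≤ N + 1)
    (h1 : η j - 1 ≤ t) : clamped f η i j t = f (η j - 1) := by
  have := h.strictMono hij hj
  unfold clamped
  congr 1
  omega

lemma clamped_jump (h : Regime f T N η δ fT A lam) {i j t : ℕ} (hij : i < j) (hj : j ≤ N + 1)
    (hne : clamped f η i j t ≠ clamped f η i j (t + 1)) : ∃ r, i < r ∧ r < j ∧ η r = t + 1 := by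
  rcases le_or_gt (t + 1) (η i) with h1 | h1
  · exact absurd (by rw [h.clamped_left hij hj (by omega), h.clamped_left hij hj h1]) hne
  rcases le_or_gt (η j - 1) t with h2 | h2
  · exact absurd (by rw [h.clamped_right hij hj h2, h.clamped_right hij hj (by omega)]) hne
  have h3 := h.one_le_eta (by omega : i ≤ N + 1)
  have h4 := h.eta_le hj
  rw [clamped_eq (by omega) (by omega), clamped_eq (by omega) (by omega)] at hne
  obtain ⟨k, hk1, hk2, hk⟩ :=
    (h.cp.jump_iff (t + 1) (by omega) (by omega)).mp (fun h' => hne h'.symm)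
  refine ⟨k, h.lt_of_eta_lt (by omega) (by omega), h.lt_of_eta_lt (by omega) (by omega), hk⟩

/-- This fails for `f` on `[s, e]` itself, which may also jump at `η i` or `η j`, next to an
end-point; clamping removes those jumps. -/
lemma jumpsSeparated_clamped (h : Regime f T N η δ fT A lam) {i j : ℕ} (hij : i < j)
    (hj : j ≤ N + 1) (s e : ℕ) : JumpsSeparated (clamped f η i j) s e (δ * T) := by
  intro c c' _ hcc' _ hc hc'
  obtain ⟨r, hr1, hr2, hr⟩ := h.clamped_jump hij hj hc
  obtain ⟨r', hr1', hr2', hr'⟩ := h.clamped_jump hij hj hc'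
  have := h.gap (h.lt_of_eta_lt (i := r) (j := r') (by omega) (by omega)) (by omega)
  rw [hr, hr'] at this
  push_cast at this
  linarith

/-- Within `δ T / 2` of an inner jump the clamped signal equals `f`, so earlier estimation errors do
not affect the local noise level. -/
lemma sumsBoundedNearJumps (h : Regime f T N η δ fT A lam) {i j s e : ℕ} (hij : i < j)
    (hj : j ≤ N + 1) {ε : ℕ → ℝ} (hε : SumsBounded ε s e lam) :
    SumsBoundedNearJumps (clamped f η i j) (fun t => f t - clamped f η i j t + ε t) s e
      (δ * T / 2) lam := by
  intro c l m _ _ hc hl hlm hm h1 h2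
  obtain ⟨r, hr1, hr2, hr⟩ := h.clamped_jump hij hj hc
  have h3 := h.gap hr1 (by omega)
  have h4 := h.gap hr2 hj
  have hlen := h.length
  rw [hr] at h3 h4
  push_cast at h3 h4
  have h5 : η i ≤ l := by
    have : (η i : ℝ) ≤ l := by linarith
    exact_mod_cast this
  have h6 : m < η j := by
    have : (m : ℝ) < η j := by linarith
    exact_mod_cast this
  rw [Finset.sum_congr rfl (fun t ht => by
    rw [Finset.mem_Icc] at ht
    rw [clamped_eq (by omega) (by omega), sub_self, zero_add] :
      ∀ t ∈ Finset.Icc l m, f t - clamped f η i j t + ε t = ε t)]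
  exact hε l m hl hlm hm

/-- At each end the mismatch equals one jump size, on as many points as the estimation error allows.
This is why accuracy is measured by error times squared jump. -/
lemma sum_sq_clamped_le (h : Regime f T N η δ fT A lam) {i j s e : ℕ} (hij : i < j)
    (hj : j ≤ N + 1) (hs : LeftEnd f N η A i s) (he : RightEnd f T N η A j e) :
    ∑ t ∈ Finset.Icc s e, (f t - clamped f η i j t) ^ 2 ≤ 4 * A := by
  have hA := h.A_nonneg
  have hlen := h.length
  have hsb := h.leftEnd_bounds hs
  have heb := h.rightEnd_bounds he
  have hpt : ∀ t ∈ Finset.Icc s e, (f t - clamped f η i j t) ^ 2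
      ≤ (if t < η i then jumpSize f η i ^ 2 else 0)
        + (if η j ≤ t then jumpSize f η j ^ 2 else 0) := by
    intro t ht
    rw [Finset.mem_Icc] at ht
    have hlt := h.strictMono hij hj
    rcases lt_or_ge t (η i) with h1 | h1
    · rw [if_pos h1, if_neg (by omega), add_zero, h.clamped_left hij hj h1.le]
      have hi1 : 1 ≤ i := by
        rcases hs with ⟨rfl, rfl⟩ | ⟨h2, -, -⟩
        · rw [h.cp.zero] at h1
          omega
        · exact h2
      have hst : (s : ℝ) ≤ t := by exact_mod_cast ht.1
      have hgap := h.spacing i hi1 (by omega)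
      have h3 : η (i - 1) ≤ t := by
        have : (η (i - 1) : ℝ) ≤ t := by linarith
        exact_mod_cast this
      have h4 := h.signal_const (i := i - 1) (t := t) (by omega) h3
        (by rw [Nat.sub_add_cancel hi1]; exact h1)
      have h5 := h.signal_const (i := i - 1) (t := η i - 1) (by omega) (by omega)
        (by rw [Nat.sub_add_cancel hi1]; omega)
      rw [h4, ← h5, jumpSize, sq_abs]
      exact le_of_eq (by ring)
    · rw [if_neg (by omega), zero_add]
      rcases lt_or_ge t (η j) with h2 | h2
      · rw [if_neg (by omega), clamped_eq h1 h2, sub_self]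
        simp
      · rw [if_pos h2, h.clamped_right hij hj (by omega)]
        have hjN : j ≤ N := by
          rcases he with ⟨rfl, rfl⟩ | ⟨-, h3, -⟩
          · rw [h.cp.last] at h2
            omega
          · exact h3
        have hte : (t : ℝ) ≤ e := by exact_mod_cast ht.2
        have hgap := h.gap (Nat.lt_succ_self j) (by omega : j + 1 ≤ N + 1)
        have h3 : t < η (j + 1) := by
          have : (t : ℝ) < η (j + 1) := by linarith
          exact_mod_cast this
        rw [h.signal_const hjN h2 h3, jumpSize, sq_abs]
  refine (Finset.sum_le_sum hpt).trans ?_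
  rw [Finset.sum_add_distrib, ← Finset.sum_filter, ← Finset.sum_filter, Finset.sum_const,
    Finset.sum_const, nsmul_eq_mul, nsmul_eq_mul]
  have hleft : (((Finset.Icc s e).filter (fun t => t < η i)).card : ℝ) * jumpSize f η i ^ 2
      ≤ A := by
    have hcard : ((Finset.Icc s e).filter (fun t => t < η i)).card ≤ η i - s := by
      rw [← Nat.card_Ico]
      refine Finset.card_le_card fun t ht => ?_
      simp only [Finset.mem_filter, Finset.mem_Icc, Finset.mem_Ico] at ht ⊢
      omega
    rcases hs with ⟨rfl, rfl⟩ | ⟨h1, h2, h3⟩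
    · have h0 := h.cp.zero
      rw [Nat.le_zero.mp (hcard.trans (by omega))]
      simpa using hA
    · rcases le_or_gt (η i) s with h4 | h4
      · rw [Nat.sub_eq_zero_of_le h4] at hcard
        rw [Nat.le_zero.mp hcard]
        simpa using hA
      · refine le_trans (mul_le_mul_of_nonneg_right ?_ (sq_nonneg _)) h3
        have h5 : (((Finset.Icc s e).filter (fun t => t < η i)).card : ℝ) ≤ (η i : ℝ) - s := by
          rw [← Nat.cast_sub h4.le]
          exact_mod_cast hcard
        have h6 := neg_abs_le ((s : ℝ) - 1 - η i)
        linarith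
  have hright : (((Finset.Icc s e).filter (fun t => η j ≤ t)).card : ℝ) * jumpSize f η j ^ 2
      ≤ 2 * A := by
    have hcard : ((Finset.Icc s e).filter (fun t => η j ≤ t)).card ≤ e + 1 - η j := by
      rw [← Nat.card_Icc]
      refine Finset.card_le_card fun t ht => ?_
      simp only [Finset.mem_filter, Finset.mem_Icc] at ht ⊢
      omega
    rcases he with ⟨rfl, rfl⟩ | ⟨h1, h2, h3⟩
    · have h0 := h.cp.last
      rw [Nat.le_zero.mp (hcard.trans (by omega))]
      simpa using hA
    -- The point `η j` itself already belongs to the next segment. This extra point costs one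
    -- squared jump, which `rate` bounds by `A`.
    · have h4 : (((Finset.Icc s e).filter (fun t => η j ≤ t)).card : ℝ) ≤ |(e : ℝ) - η j| + 1 := by
        rcases le_or_gt (η j) (e + 1) with h5 | h5
        · have h6 : (((Finset.Icc s e).filter (fun t => η j ≤ t)).card : ℝ)
              ≤ ((e + 1 : ℕ) : ℝ) - η j := by
            rw [← Nat.cast_sub h5]
            exact_mod_cast hcard
          push_cast at h6
          linarith [le_abs_self ((e : ℝ) - η j)]
        · rw [Nat.le_zero.mp (hcard.trans (by omega))]
          have := abs_nonneg ((e : ℝ) - η j)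
          push_cast
          linarith
      have h5 := h.rate j h1 h2
      have h6 : 0 ≤ 4665600 * lam ^ 2 / δ ^ 3 := by
        have := h.delta_pos
        positivity
      have h7 := mul_le_mul_of_nonneg_right h4 (sq_nonneg (jumpSize f η j))
      linarith
  linarith

/-- By the Cauchy–Schwarz inequality, a mismatch of energy `4 * A` behaves like noise of
standardised level `2 * √A`. -/
lemma sumsBounded (h : Regime f T N η δ fT A lam) {i j s e : ℕ} (hij : i < j)
    (hj : j ≤ N + 1) (hs : LeftEnd f N η A i s) (he : RightEnd f T N η A j e) {ε : ℕ → ℝ}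
    (hε : SumsBounded ε s e lam) :
    SumsBounded (fun t => f t - clamped f η i j t + ε t) s e (lam + 2 * √A) := by
  intro l m hl hlm hm
  have h1 := hε l m hl hlm hm
  have h2 : |∑ t ∈ Finset.Icc l m, (f t - clamped f η i j t)| ≤ 2 * √A * √((m : ℝ) - l + 1) := by
    have h3 := sq_sum_le_card_mul_sum_sq (s := Finset.Icc l m)
      (f := fun t => f t - clamped f η i j t)
    have h4 : ∑ t ∈ Finset.Icc l m, (f t - clamped f η i j t) ^ 2 ≤ 4 * A :=
      (Finset.sum_le_sum_of_subset_of_nonneg (Finset.Icc_subset_Icc hl hm)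
        (fun _ _ _ => sq_nonneg _)).trans (h.sum_sq_clamped_le hij hj hs he)
    have h5 : ((Finset.Icc l m).card : ℝ) = (m : ℝ) - l + 1 := by
      rw [Nat.card_Icc, Nat.cast_sub (by omega)]
      push_cast
      ring
    rw [h5] at h3
    have h6 := left_length_pos hlm
    rw [show 2 * √A = √(4 * A) by
      rw [Real.sqrt_mul (by norm_num), show (4 : ℝ) = 2 ^ 2 by norm_num,
        Real.sqrt_sq (by norm_num)], ← Real.sqrt_mul (by linarith [h.A_nonneg])]
    refine Real.abs_le_sqrt (h3.trans ?_)
    rw [mul_comm]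
    exact mul_le_mul_of_nonneg_right h4 h6.le
  rw [Finset.sum_add_distrib, add_mul]
  exact (abs_add_le _ _).trans (by linarith)

lemma signal_eq_clamped_add (f ε : ℕ → ℝ) (η : ℕ → ℕ) (i j : ℕ) :
    (fun t => f t + ε t)
      = fun t => clamped f η i j t + (fun t => f t - clamped f η i j t + ε t) t := by
  funext t
  ring

lemma level_pos (h : Regime f T N η δ fT A lam) : 0 < lam + 2 * √A := by
  have := h.lam_pos
  positivity

/-- CUSUM statistics are small on the sub-domains without change-points left to be estimated. -/
lemma abs_cusum_le_of_adjacent (h : Regime f T N η δ fT A lam) {i s e s' e' b : ℕ}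
    (hi : i ≤ N) (hs : LeftEnd f N η A i s) (he : RightEnd f T N η A (i + 1) e) {ε : ℕ → ℝ}
    (hε : SumsBounded ε s e lam) (h1 : s ≤ s') (h2 : s' ≤ b) (h3 : b < e') (h4 : e' ≤ e) :
    |cusum (fun t => f t + ε t) s' e' b| ≤ 2 * (lam + 2 * √A) := by
  rw [signal_eq_clamped_add f ε η i (i + 1), cusum_add]
  rw [cusum_eq_zero_of_const h2 h3, zero_add]
  · exact ((h.sumsBounded (by omega) (by omega) hs he hε).mono h1 h4).abs_cusum_le
      h.level_pos.le h2 h3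
  · intro t ht hte
    refine eq_of_no_jump (m := e') (fun t _ _ => ?_) t ht hte
    by_contra hne
    obtain ⟨r, hr1, hr2, -⟩ := h.clamped_jump (by omega) (by omega) hne
    omega

/-- CUSUM statistics are large at the change-points, on intervals that are suitably located. -/
lemma le_abs_cusum_of_goodInterval (h : Regime f T N η δ fT A lam) {r s' e' : ℕ}
    (hr1 : 1 ≤ r) (hr : r ≤ N) (hp : (s', e') ∈ goodIntervals η δ T r) {ε : ℕ → ℝ}
    (hε : SumsBounded ε s' e' lam) :
    s' ≤ η r - 1 ∧ η r - 1 < e' ∧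
      √δ / 5 * jumpSize f η r * √T ≤ |cusum (fun t => f t + ε t) s' e' (η r - 1)| := by
  obtain ⟨h1, h2, h3, h4⟩ := hp
  simp only at h1 h2 h3 h4
  have hlen := h.length
  have hη := h.one_le_eta (by omega : r ≤ N + 1)
  have hg1 := h.spacing r hr1 (by omega)
  have hg2 := h.gap (Nat.lt_succ_self r) (by omega : r + 1 ≤ N + 1)
  have a1 : s' < η r := by
    have : (s' : ℝ) < η r := by linarith
    exact_mod_cast this
  have a2 : η r < e' := by
    have : (η r : ℝ) < e' := by linarith
    exact_mod_cast this
  have a3 : η (r - 1) ≤ s' := by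
    have : (η (r - 1) : ℝ) ≤ s' := by linarith
    exact_mod_cast this
  have a4 : e' < η (r + 1) := by
    have : (e' : ℝ) < η (r + 1) := by linarith
    exact_mod_cast this
  have hcast : ((η r - 1 : ℕ) : ℝ) = η r - 1 := by
    rw [Nat.cast_sub hη, Nat.cast_one]
  refine ⟨by omega, by omega, ?_⟩
  have hpre : ∀ t, s' ≤ t → t ≤ η r - 1 → f t = f (η (r - 1)) := fun t ht ht' =>
    h.signal_const (i := r - 1) (by omega) (by omega) (by rw [Nat.sub_add_cancel hr1]; omega)
  have hjump := abs_cusum_single_jump (g := f) (s := s') (e := e') (c := η r - 1)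
    (a := δ * T / 3) (by omega) (by omega)
    (fun t ht ht' => by rw [hpre t ht ht', hpre _ (by omega) le_rfl])
    (fun t ht ht' => by
      rw [Nat.sub_add_cancel hη] at ht ⊢
      exact h.signal_const hr ht (by omega))
    (by linarith) (by rw [hcast]; linarith) (by rw [hcast]; linarith)
  rw [Nat.sub_add_cancel hη] at hjump
  change jumpSize f η r * _ ≤ _ at hjump
  have hnoise := hε.abs_cusum_le h.lam_pos.le (by omega : s' ≤ η r - 1) (by omega : η r - 1 < e')
  rw [cusum_add]
  have hfJ := h.jumps r hr1 hr
  have hJ : 0 < jumpSize f η r := h.fT_pos.trans_le hfJ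
  -- Both sides of the jump have at least `δ T / 3` points, and `4 / 25 ≤ 1 / 6`. The factor 2
  -- leaves half of the CUSUM to the noise.
  have hroot : 2 * (√δ / 5 * √T) ≤ √(δ * T / 3 / 2) := by
    have hδ := h.delta_pos.le
    refine Real.le_sqrt_of_sq_le ?_
    rw [mul_pow, mul_pow, div_pow, Real.sq_sqrt hδ, Real.sq_sqrt (Nat.cast_nonneg T)]
    linarith
  have hlarge := mul_le_mul_of_nonneg_left hroot hJ.le
  have hsig := h.signal
  have hδ2 : δ ^ 2 * (√δ / 5 * fT * √T) ≤ 1 * (√δ / 5 * jumpSize f η r * √T) := by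
    have h5 : δ ^ 2 ≤ 1 := by nlinarith [h.delta_pos, h.delta_le_one]
    refine mul_le_mul h5 ?_ ?_ zero_le_one
    · refine mul_le_mul_of_nonneg_right ?_ (Real.sqrt_nonneg _)
      exact mul_le_mul_of_nonneg_left hfJ (by positivity)
    · have := h.fT_pos
      positivity
  have hA : 0 ≤ √A := Real.sqrt_nonneg A
  have hlam := h.lam_pos
  have htri : |cusum f s' e' (η r - 1)| - |cusum ε s' e' (η r - 1)|
      ≤ |cusum f s' e' (η r - 1) + cusum ε s' e' (η r - 1)| := by
    have := abs_sub_abs_le_abs_sub (cusum f s' e' (η r - 1)) (-cusum ε s' e' (η r - 1))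
    rwa [abs_neg, sub_neg_eq_add] at this
  linarith

/-- The best entry of a search on a sub-domain with change-points left to be estimated. -/
lemma best_spec (h : Regime f T N η δ fT A lam) {i j s e : ℕ} (hij : i + 2 ≤ j)
    (hj : j ≤ N + 1) (hs : LeftEnd f N η A i s) (he : RightEnd f T N η A j e) (hs1 : 1 ≤ s)
    (heT : e ≤ T) {ε : ℕ → ℝ} (hε : SumsBounded ε s e lam) {M : ℕ}
    {draw : ℕ → ℕ → ℕ → ℕ × ℕ} (hv : ValidOn M draw s e) (hse : s < e) {q : ℕ × ℕ}
    (hq : q ∈ intervals M draw s e) (hqg : q ∈ goodIntervals η δ T (largestJump f η i j))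
    {p : Entry} (hp : p ∈ searched (fun t => f t + ε t) M draw s e)
    (hmax : ∀ p' ∈ searched (fun t => f t + ε t) M draw s e, p'.v ≤ p.v) :
    ∃ r, i < r ∧ r < j ∧ |(p.b : ℝ) - η r| * jumpSize f η r ^ 2 ≤ A ∧
      √δ / 5 * fT * √T ≤ p.v := by
  obtain ⟨hr1, hr2, hr3⟩ := largestJump_spec f η hij
  set r₀ := largestJump f η i j
  obtain ⟨s', e'⟩ := q
  have hq' := hv.mem_intervals hse hq
  simp only at hq'
  obtain ⟨c1, c2, c3⟩ := h.le_abs_cusum_of_goodInterval (by omega) (by omega) hqg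
    (hε.mono hq'.1 hq'.2.2)
  have hbig : √δ / 5 * jumpSize f η r₀ * √T ≤ p.v :=
    c3.trans (hmax _ ⟨(s', e'), hq, η r₀ - 1, c1, c2, rfl⟩)
  have hδ := h.delta_pos
  have hmono : ∀ a, a ≤ jumpSize f η r₀ →
      √δ / 5 * a * √T ≤ √δ / 5 * jumpSize f η r₀ * √T := fun a ha =>
    mul_le_mul_of_nonneg_right (mul_le_mul_of_nonneg_left ha (by positivity))
      (Real.sqrt_nonneg _)
  have hfT := (hmono fT (h.jumps r₀ (by omega) (by omega))).trans hbig
  obtain ⟨⟨a, z⟩, hi, b, hb1, hb2, rfl⟩ := hp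
  have hi' := hv.mem_intervals hse hi
  simp only at hi' hb1 hb2 hbig hfT ⊢
  change _ ≤ |cusum (fun t => f t + ε t) a z b| at hbig hfT
  have hL : (z : ℝ) - a + 1 ≤ T := by
    have h1 : (1 : ℝ) ≤ a := by exact_mod_cast hs1.trans hi'.1
    have h2 : (z : ℝ) ≤ T := by exact_mod_cast hi'.2.2.trans heT
    linarith
  have hmax' : ∀ c, a ≤ c → c < z →
      |cusum (fun t => f t + ε t) a z c| ≤ |cusum (fun t => f t + ε t) a z b| :=
    fun c h1 h2 => hmax _ ⟨(a, z), hi, c, h1, h2, rfl⟩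
  have hsig : 2304 * (lam + 2 * √A) ≤ δ ^ 2 * |cusum (fun t => f t + ε t) a z b| :=
    h.signal.trans (mul_le_mul_of_nonneg_left hfT (sq_nonneg δ))
  have hζ' := h.sumsBoundedNearJumps (i := i) (j := j) (by omega) hj (hε.mono hi'.1 hi'.2.2)
  obtain ⟨c, hc1, hc2, hc3, hc4⟩ := localization (g := clamped f η i j)
    (ζ := fun t => f t - clamped f η i j t + ε t) hδ h.delta_le_one hb1 hb2 hL h.level_pos
    h.lam_pos.le (h.jumpsSeparated_clamped (by omega) hj a z)
    ((h.sumsBounded (by omega) hj hs he hε).mono hi'.1 hi'.2.2) hζ'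
    (by rw [← signal_eq_clamped_add]; exact hmax') (by rw [← signal_eq_clamped_add]; exact hsig)
  rw [← signal_eq_clamped_add] at hc4
  obtain ⟨r, hri, hrj, hr⟩ := h.clamped_jump (by omega) hj hc3
  refine ⟨r, hri, hrj, ?_, hfT⟩
  simp only [cusumEntry]
  set V := |cusum (fun t => f t + ε t) a z b|
  have hJr := h.jumps r (by omega) (by omega)
  have hJ : 0 < jumpSize f η r := h.fT_pos.trans_le hJr
  -- The localised jump `r` need not be the largest one, `r₀`, whose interval was drawn. Since it is
  -- not larger, the maximum is still large in terms of its own size, and the error bound scales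
  -- with `jumpSize f η r`.
  have hV := (hmono _ (hr3 r hri hrj)).trans hbig
  have hV2 : δ / 25 * jumpSize f η r ^ 2 * T ≤ V ^ 2 := by
    have := pow_le_pow_left₀ (by positivity) hV 2
    rwa [mul_pow, mul_pow, div_pow, Real.sq_sqrt hδ.le, Real.sq_sqrt (Nat.cast_nonneg T),
      show (5 : ℝ) ^ 2 = 25 by norm_num] at this
  have hTpos : (0 : ℝ) < T := by
    have : 0 < δ * (T : ℝ) := by linarith [h.length]
    exact pos_of_mul_pos_right this hδ.le
  -- `4665600 = 25 * 186624`, the 25 coming from the square of `√δ / 5`.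
  have hbc : |(b : ℝ) - c| * jumpSize f η r ^ 2 ≤ 4665600 * lam ^ 2 / δ ^ 3 := by
    rw [le_div_iff₀ (by positivity)]
    have h1 : |(b : ℝ) - c| * (δ / 25 * jumpSize f η r ^ 2 * T) * δ ^ 2
        ≤ |(b : ℝ) - c| * V ^ 2 * δ ^ 2 :=
      mul_le_mul_of_nonneg_right (mul_le_mul_of_nonneg_left hV2 (abs_nonneg _)) (sq_nonneg δ)
    refine le_of_mul_le_mul_right ?_ hTpos
    have h2 : |(b : ℝ) - c| * (δ / 25 * jumpSize f η r ^ 2 * T) * δ ^ 2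
        = |(b : ℝ) - c| * jumpSize f η r ^ 2 * δ ^ 3 * T / 25 := by ring
    linarith
  -- A candidate is the last point before a jump and a change-point the first one after it. The
  -- shift by 1 is paid for by the first term of `rate`.
  have hdist : |(b : ℝ) - η r| ≤ |(b : ℝ) - c| + 1 := by
    rw [hr]
    have := abs_sub_le (b : ℝ) c ((c + 1 : ℕ) : ℝ)
    rwa [show (c : ℝ) - ((c + 1 : ℕ) : ℝ) = -1 by push_cast; ring, abs_neg, abs_one] at this
  have hfin := mul_le_mul_of_nonneg_right hdist (sq_nonneg (jumpSize f η r))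
  have := h.rate r (by omega) (by omega)
  linarith

end Regime


/-! ## The solution path -/

lemma mem_solPath {x : ℕ → ℝ} {T M : ℕ} {draw : ℕ → ℕ → ℕ → ℕ × ℕ}
    {tie : Entry → Entry → Bool} (hM : 1 ≤ M) (hv : ValidDraws T M draw) {s e : ℕ} (hs : 1 ≤ s)
    (he : e ≤ T) {p : Entry} (hp : p ∈ (solPath x M draw tie s e).val) :
    s ≤ p.s ∧ p.s ≤ p.b ∧ p.b < p.e ∧ p.e ≤ e ∧ p.v = |cusum x p.s p.e p.b| := by
  induction hn : e - s using Nat.strong_induction_on generalizing s e with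
  | _ n ih =>
    rcases le_or_gt e s with h | h
    · rw [(solPath_of_le x M draw tie h).1] at hp
      simp at hp
    · obtain ⟨q, hq, hqs, -, hb1, hb2⟩ := search_spec (x := x) tie hM (hv.validOn hs h he) h
      rw [(solPath_of_lt h hq ⟨hb1, hb2⟩).1, List.mem_cons, List.mem_append] at hp
      rcases hp with rfl | hp | hp
      · obtain ⟨i, hi, c, h1, h2, rfl⟩ := hqs
        have hi' := (hv.validOn hs h he).mem_intervals h hi
        exact ⟨hi'.1, h1, h2, hi'.2.2, rfl⟩
      · obtain ⟨h1, h2, h3, h4, h5⟩ := ih _ (by omega) hs (by omega) hp rfl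
        exact ⟨h1, h2, h3, by omega, h5⟩
      · obtain ⟨h1, h2, h3, h4, h5⟩ := ih _ (by omega) (by omega) he hp rfl
        exact ⟨by omega, h2, h3, h4, h5⟩

/-- On each sub-domain between accurate estimates, one of the drawn intervals allows the detection of
the largest jump. -/
def DrawsSucceed (f : ℕ → ℝ) (T N : ℕ) (η : ℕ → ℕ) (δ A : ℝ) (M : ℕ)
    (draw : ℕ → ℕ → ℕ → ℕ × ℕ) : Prop :=
  ∀ i j s e, i + 2 ≤ j → j ≤ N + 1 → 1 ≤ s → e ≤ T → s < e → LeftEnd f N η A i s →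
    RightEnd f T N η A j e → ∃ m < M, draw s e m ∈ goodIntervals η δ T (largestJump f η i j)

/-- The exhaustive search contains every valid draw, so it needs no separate probabilistic
treatment. -/
lemma ValidOn.draw_mem_intervals {M : ℕ} {draw : ℕ → ℕ → ℕ → ℕ × ℕ} {s e m : ℕ}
    (h : ValidOn M draw s e) (hse : s < e) (hm : m < M) : draw s e m ∈ intervals M draw s e := by
  have := h m hm
  unfold intervals
  split_ifs
  · rw [mem_allIntervals _ _ (by omega)]
    right
    omega
  · rw [mem_drawIntervals]
    exact Or.inr ⟨m, hm, rfl⟩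

namespace Regime

variable {f : ℕ → ℝ} {T N : ℕ} {η : ℕ → ℕ} {δ fT A lam : ℝ}

/-- Induction on the length of the sub-domain. The split lands near some `η r` with `i < r < j`, and
it becomes an accurate right end of one child and an accurate left end of the other, with the same
`A`. Each inner change-point thus gets exactly one entry `β k`, and the entries in `R` come from
sub-domains without inner change-points. -/
lemma solPath_spec (h : Regime f T N η δ fT A lam) {ε : ℕ → ℝ} (hε : SumsBounded ε 1 T lam)
    {M : ℕ} (hM : 1 ≤ M) {draw : ℕ → ℕ → ℕ → ℕ × ℕ} (hv : ValidDraws T M draw)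
    (hd : DrawsSucceed f T N η δ A M draw) (tie : Entry → Entry → Bool) {i j s e : ℕ}
    (hij : i < j) (hj : j ≤ N + 1) (hs : LeftEnd f N η A i s) (he : RightEnd f T N η A j e)
    (hs1 : 1 ≤ s) (heT : e ≤ T) :
    ∃ (β : ℕ → Entry) (R : List Entry),
      (solPath (fun t => f t + ε t) M draw tie s e).val.Perm
        ((List.range' (i + 1) (j - i - 1)).map β ++ R) ∧
      (∀ k, i < k → k < j → |((β k).b : ℝ) - η k| * jumpSize f η k ^ 2 ≤ A ∧
        √δ / 5 * fT * √T ≤ (β k).v) ∧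
      ∀ p ∈ R, p.v ≤ 2 * (lam + 2 * √A) := by
  induction hn : e - s using Nat.strong_induction_on generalizing i j s e with
  | _ n ih =>
    rcases (Nat.succ_le_of_lt hij).eq_or_lt with hadj | hij2
    · subst hadj
      -- No index lies strictly between `i` and `i + 1`, so the value of `β` is irrelevant.
      refine ⟨fun _ => ⟨0, 0, 0, 0⟩, (solPath (fun t => f t + ε t) M draw tie s e).val, ?_, ?_, ?_⟩
      · simp
      · intro k h1 h2
        omega
      · intro p hp
        obtain ⟨h1, h2, h3, h4, h5⟩ := mem_solPath hM hv hs1 heT hp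
        rw [h5]
        exact h.abs_cusum_le_of_adjacent (by omega) hs he (hε.mono hs1 heT) h1 h2 h3 h4
    · have hij3 : i + 2 ≤ j := hij2
      have hse : s < e := by
        have b1 := h.leftEnd_bounds hs
        have b2 := h.rightEnd_bounds he
        have b3 := h.gap hij hj
        have b4 := h.length
        have : (s : ℝ) < e := by linarith
        exact_mod_cast this
      have hvo := hv.validOn hs1 hse heT
      obtain ⟨p, hp, hps, hpm, hb1, hb2⟩ := search_spec (x := fun t => f t + ε t) tie hM hvo hse
      obtain ⟨m, hm, hgood⟩ := hd i j s e hij3 hj hs1 heT hse hs he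
      obtain ⟨r, hir, hrj, hacc, hbig⟩ := h.best_spec hij3 hj hs he hs1 heT (hε.mono hs1 heT) hvo
        hse (hvo.draw_mem_intervals hse hm) hgood hps hpm
      have hR : RightEnd f T N η A r p.b := Or.inr ⟨by omega, by omega, hacc⟩
      have hL : LeftEnd f N η A r (p.b + 1) := Or.inr ⟨by omega, by omega, by
        push_cast
        rwa [add_sub_cancel_right]⟩
      obtain ⟨β₁, R₁, hp₁, hβ₁, hR₁⟩ :=
        ih _ (by omega) hir (by omega) hs hR hs1 (by omega) rfl
      obtain ⟨β₂, R₂, hp₂, hβ₂, hR₂⟩ :=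
        ih _ (by omega) hrj hj hL he (by omega) heT rfl
      refine ⟨fun k => if k < r then β₁ k else if k = r then p else β₂ k, R₁ ++ R₂, ?_, ?_, ?_⟩
      · rw [(solPath_of_lt hse hp ⟨hb1, hb2⟩).1]
        have hsplit : List.range' (i + 1) (j - i - 1) = List.range' (i + 1) (r - i - 1)
            ++ r :: List.range' (r + 1) (j - r - 1) := by
          have e1 : r :: List.range' (r + 1) (j - r - 1) = List.range' r (j - r) := by
            rw [show j - r = (j - r - 1) + 1 by omega, List.range'_succ]
            rfl
          rw [e1]
          have := List.range'_append_1 (s := i + 1) (m := r - i - 1) (n := j - r)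
          rw [show i + 1 + (r - i - 1) = r by omega] at this
          rw [this]
          congr 1
          omega
        rw [hsplit, List.map_append, List.map_cons]
        have m1 : (List.range' (i + 1) (r - i - 1)).map
            (fun k => if k < r then β₁ k else if k = r then p else β₂ k)
            = (List.range' (i + 1) (r - i - 1)).map β₁ := by
          refine List.map_congr_left fun k hk => ?_
          rw [List.mem_range'_1] at hk
          rw [if_pos (by omega)]
        have m2 : (List.range' (r + 1) (j - r - 1)).map
            (fun k => if k < r then β₁ k else if k = r then p else β₂ k)
            = (List.range' (r + 1) (j - r - 1)).map β₂ := by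
          refine List.map_congr_left fun k hk => ?_
          rw [List.mem_range'_1] at hk
          rw [if_neg (by omega), if_neg (by omega)]
        rw [m1, m2, if_neg (lt_irrefl r), if_pos rfl]
        refine ((hp₁.append hp₂).cons p).trans ?_
        set B₁ := (List.range' (i + 1) (r - i - 1)).map β₁
        set B₂ := (List.range' (r + 1) (j - r - 1)).map β₂
        rw [← Multiset.coe_eq_coe]
        simp only [← Multiset.coe_add, ← Multiset.cons_coe, ← Multiset.singleton_add]
        abel
      · intro k h1 h2
        rcases lt_trichotomy k r with hk | rfl | hk
        · simp only [if_pos hk]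
          exact hβ₁ k h1 hk
        · simp only [lt_irrefl, if_false, if_true]
          exact ⟨hacc, hbig⟩
        · simp only [if_neg (by omega : ¬ k < r), if_neg (by omega : ¬ k = r)]
          exact hβ₂ k hk h2
      · intro q hq
        rcases List.mem_append.mp hq with hq | hq
        · exact hR₁ q hq
        · exact hR₂ q hq

end Regime

/-! ## The sorted solution path -/

lemma eq_filter_append_filter {l : List Entry} (h : l.Pairwise (fun p q => q.v ≤ p.v)) (θ : ℝ) :
    l = l.filter (fun p => θ < p.v) ++ l.filter (fun p => ¬ θ < p.v) := by
  induction l with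
  | nil => rfl
  | cons a l ih =>
    rw [List.pairwise_cons] at h
    by_cases ha : θ < a.v
    · rw [List.filter_cons_of_pos (by simpa using ha),
        List.filter_cons_of_neg (by simpa using ha), List.cons_append, ← ih h.2]
    · have hall : ∀ p ∈ a :: l, ¬ θ < p.v := by
        intro p hp
        rcases List.mem_cons.mp hp with rfl | hp
        · exact ha
        · exact fun hlt => ha (hlt.trans_le (h.1 p hp))
      rw [List.filter_eq_nil_iff.mpr (fun p hp => by simpa using hall p hp),
        List.filter_eq_self.mpr (fun p hp => by simpa using hall p hp), List.nil_append]

/-- Splitting a sorted list at a threshold. -/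
lemma take_drop_perm_of_threshold {P B R : List Entry} {θ : ℝ}
    (hP : P.Pairwise (fun p q => q.v ≤ p.v)) (hperm : P.Perm (B ++ R))
    (hB : ∀ p ∈ B, θ < p.v) (hR : ∀ p ∈ R, p.v ≤ θ) :
    (P.take B.length).Perm B ∧ (P.drop B.length).Perm R := by
  have h1 : (P.filter (fun p => θ < p.v)).Perm B := by
    refine (hperm.filter _).trans ?_
    rw [List.filter_append, List.filter_eq_self.mpr (fun p hp => by simpa using hB p hp),
      List.filter_eq_nil_iff.mpr (fun p hp => by simpa using hR p hp), List.append_nil]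
  have h2 : (P.filter (fun p => ¬ θ < p.v)).Perm R := by
    refine (hperm.filter _).trans ?_
    rw [List.filter_append, List.filter_eq_nil_iff.mpr (fun p hp => by simpa using hB p hp),
      List.filter_eq_self.mpr (fun p hp => by simpa using hR p hp), List.nil_append]
  have h3 := eq_filter_append_filter hP θ
  rw [← h1.length_eq]
  constructor
  · rw [h3, List.take_left' (by rw [← h3])]
    exact h1
  · rw [h3, List.drop_left' (by rw [← h3])]
    exact h2

namespace Regime

variable {f : ℕ → ℝ} {T N : ℕ} {η : ℕ → ℕ} {δ fT A lam : ℝ}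

theorem goodPath (h : Regime f T N η δ fT A lam) {ε : ℕ → ℝ} (hε : SumsBounded ε 1 T lam)
    {M : ℕ} (hM : 1 ≤ M) {draw : ℕ → ℕ → ℕ → ℕ × ℕ} (hv : ValidDraws T M draw)
    (hd : DrawsSucceed f T N η δ A M draw) (tie : Entry → Entry → Bool) {C₁ C₂ : ℝ}
    (hA : A = C₁ * Real.log T) (hC₂ : 2 * (lam + 2 * √A) ≤ C₂ * √(Real.log T)) :
    GoodPath (fun t => f t + ε t) T N η fT C₁ C₂ (√δ / 5)
      (wbs2 (fun t => f t + ε t) T M draw tie).val := by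
  obtain ⟨β, R, hperm, hβ, hR⟩ := h.solPath_spec hε hM hv hd tie (i := 0) (j := N + 1) (s := 1)
    (e := T) (by omega) le_rfl (Or.inl ⟨rfl, rfl⟩) (Or.inl ⟨rfl, rfl⟩) le_rfl le_rfl
  simp only [zero_add, Nat.sub_zero, Nat.add_sub_cancel] at hperm
  set P := (wbs2 (fun t => f t + ε t) T M draw tie).val with hPdef
  have hPsol : P.Perm (solPath (fun t => f t + ε t) M draw tie 1 T).val := sortPath_perm _ _
  have hPperm := hPsol.trans hperm
  have hPs : P.Pairwise (fun p q => q.v ≤ p.v) := sortPath_pairwise _ _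
  have hval : ∀ p ∈ P, |cusum (fun t => f t + ε t) p.s p.e p.b| = p.v := fun p hp =>
    (mem_solPath hM hv le_rfl le_rfl (hPsol.mem_iff.mp hp)).2.2.2.2.symm
  have hlv := h.level_pos
  -- This strict gap makes the set of the first `N` entries independent of tie-breaking.
  have hthr : 2 * (lam + 2 * √A) < √δ / 5 * fT * √T := by
    have h1 := h.signal
    have h2 : δ ^ 2 ≤ 1 := by nlinarith [h.delta_pos, h.delta_le_one]
    have h3 : 0 ≤ √δ / 5 * fT * √T := by
      have := h.fT_pos
      positivity
    nlinarith
  have hBmem : ∀ p ∈ (List.range' 1 N).map β, √δ / 5 * fT * √T ≤ p.v := by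
    intro p hp
    obtain ⟨k, hk, rfl⟩ := List.mem_map.mp hp
    rw [List.mem_range'_1] at hk
    exact (hβ k (by omega) (by omega)).2
  obtain ⟨htake, hdrop⟩ := take_drop_perm_of_threshold hPs hPperm
    (fun p hp => hthr.trans_le (hBmem p hp)) hR
  have hlen : ((List.range' 1 N).map β).length = N := by simp
  rw [hlen] at htake hdrop
  refine ⟨fun i hi1 hiN => ?_, fun k hk hkN => ?_, fun k hk hkN => ?_⟩
  -- Errors of at most `δ T / 12` cannot reverse the order of change-points that are `δ T` apart, so
  -- sorting the candidates matches them with the `η i`.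
  · have hsorted : ((List.range' 1 N).map (fun k => (β k).b)).Pairwise (· ≤ ·) := by
      rw [List.pairwise_map]
      refine (List.pairwise_lt_range' (s := 1) (n := N)).imp_of_mem ?_
      intro a b ha hb hab
      rw [List.mem_range'_1] at ha hb
      have h1 := h.dist_le (by omega) (by omega) (hβ a (by omega) (by omega)).1
      have h2 := h.dist_le (by omega) (by omega) (hβ b (by omega) (by omega)).1
      have h3 := h.gap hab (by omega)
      have h4 := h.length
      have h5 : ((β a).b : ℝ) ≤ (β b).b := by
        have := (abs_le.mp h1).2
        have := (abs_le.mp h2).1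
        linarith
      exact_mod_cast h5
    have hfc : firstCandidates N P = (List.range' 1 N).map (fun k => (β k).b) := by
      unfold firstCandidates
      refine List.Perm.eq_of_pairwise' (List.pairwise_insertionSort _ _) hsorted ?_
      refine (List.perm_insertionSort _ _).trans ?_
      have := htake.map Entry.b
      rwa [List.map_map] at this
    have hget : (firstCandidates N P).getD (i - 1) 0 = (β i).b := by
      rw [hfc, List.getD_eq_getElem _ _ (by simp; omega)]
      simp only [List.getElem_map, List.getElem_range', one_mul]
      rw [show 1 + (i - 1) = i by omega]
    rw [hget, abs_sub_comm]
    have h1 := (hβ i (by omega) (by omega)).1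
    have h2 := h.fT_pos
    have h3 : fT ^ 2 ≤ jumpSize f η i ^ 2 := pow_le_pow_left₀ h2.le (h.jumps i hi1 hiN) 2
    have h4 := mul_le_mul_of_nonneg_left h3 (abs_nonneg (((β i).b : ℝ) - η i))
    rw [show C₁ * (fT ^ 2)⁻¹ * Real.log T = A / fT ^ 2 by rw [hA]; ring,
      le_div_iff₀ (by positivity)]
    linarith
  · rw [hval _ (List.getElem_mem hk)]
    refine hBmem _ (htake.mem_iff.mp ?_)
    rw [List.mem_take_iff_getElem]
    exact ⟨k, by omega, rfl⟩
  · rw [hval _ (List.getElem_mem hk)]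
    refine (hR _ (hdrop.mem_iff.mp ?_)).trans hC₂
    rw [List.mem_drop_iff_getElem]
    exact ⟨k - N, by omega, by congr 1; omega⟩

end Regime


/-! ## Uniformly drawn intervals -/

/-- The sub-intervals of `[s, e]` with at least two points. -/
def subIntervals (s e : ℕ) : Finset (ℕ × ℕ) :=
  (Finset.Icc s e ×ˢ Finset.Icc s e).filter fun p => p.1 < p.2

lemma coe_subIntervals (s e : ℕ) :
    (subIntervals s e : Set (ℕ × ℕ)) = {p | s ≤ p.1 ∧ p.1 < p.2 ∧ p.2 ≤ e} := by
  ext p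
  simp only [subIntervals, Finset.coe_filter, Finset.mem_product, Finset.mem_Icc,
    Set.mem_ofPred_eq]
  omega

/-- The pairs with `p.1 < p.2` and their reflections are disjoint parts of the square. -/
lemma two_mul_card_subIntervals_le (s e : ℕ) :
    2 * (subIntervals s e).card ≤ (e + 1 - s) * (e + 1 - s) := by
  have hswap : ((subIntervals s e).map (Equiv.prodComm ℕ ℕ).toEmbedding).card
      = (subIntervals s e).card := Finset.card_map _
  have hdisj : Disjoint (subIntervals s e)
      ((subIntervals s e).map (Equiv.prodComm ℕ ℕ).toEmbedding) := by
    rw [Finset.disjoint_left]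
    rintro p hp hp'
    rw [Finset.mem_map] at hp'
    obtain ⟨q, hq, rfl⟩ := hp'
    simp only [subIntervals, Finset.mem_filter] at hp hq
    have h1 := hp.2
    have h2 := hq.2
    simp only [Equiv.coe_toEmbedding, Equiv.prodComm_apply, Prod.fst_swap, Prod.snd_swap] at h1
    omega
  have hsub : (subIntervals s e) ∪ ((subIntervals s e).map (Equiv.prodComm ℕ ℕ).toEmbedding)
      ⊆ Finset.Icc s e ×ˢ Finset.Icc s e := by
    intro p hp
    rcases Finset.mem_union.mp hp with hp | hp
    · exact (Finset.mem_filter.mp hp).1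
    · obtain ⟨q, hq, rfl⟩ := Finset.mem_map.mp hp
      have := (Finset.mem_filter.mp hq).1
      rw [Finset.mem_product] at this ⊢
      exact ⟨this.2, this.1⟩
  have := Finset.card_le_card hsub
  rw [Finset.card_union_of_disjoint hdisj, hswap, Finset.card_product, Nat.card_Icc] at this
  omega

lemma sub_one_le_card_Icc_ceil_floor {a b : ℝ} (ha : 0 ≤ a) (hab : a + 1 ≤ b) :
    b - a - 1 ≤ ((Finset.Icc ⌈a⌉₊ ⌊b⌋₊).card : ℝ) := by
  have h1 : (⌈a⌉₊ : ℝ) < a + 1 := Nat.ceil_lt_add_one ha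
  have h2 : b < (⌊b⌋₊ : ℝ) + 1 := Nat.lt_floor_add_one b
  have h3 : ⌈a⌉₊ ≤ ⌊b⌋₊ + 1 := by
    have : (⌈a⌉₊ : ℝ) ≤ ⌊b⌋₊ + 1 := by linarith
    exact_mod_cast this
  rw [Nat.card_Icc, Nat.cast_sub h3]
  push_cast
  linarith

lemma uniformOn_compl_goodIntervals_le {η : ℕ → ℕ} {δ : ℝ} {T r s e : ℕ} (hδ : 0 < δ)
    (hlen : 12 ≤ δ * T) (hs1 : 1 ≤ s) (hse : s < e) (heT : e ≤ T)
    (hs : (s : ℝ) ≤ η r - 2 * (δ * T) / 3) (he : (η r : ℝ) + 2 * (δ * T) / 3 ≤ e) :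
    (uniformOn {p : ℕ × ℕ | s ≤ p.1 ∧ p.1 < p.2 ∧ p.2 ≤ e}).real (goodIntervals η δ T r)ᶜ
      ≤ 1 - δ ^ 2 / 9 := by
  classical
  rw [← coe_subIntervals]
  have hne : (subIntervals s e).Nonempty := by
    rw [← Finset.coe_nonempty, coe_subIntervals]
    exact ⟨(s, e), le_rfl, hse, le_rfl⟩
  have : IsProbabilityMeasure (uniformOn (subIntervals s e : Set (ℕ × ℕ))) :=
    isProbabilityMeasure_uniformOn (Finset.finite_toSet _) hne
  rw [probReal_compl_eq_one_sub (MeasurableSet.of_discrete)]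
  have hs0 : (0 : ℝ) ≤ s := Nat.cast_nonneg s
  obtain ⟨G, hG⟩ : ∃ G, Finset.Icc ⌈(η r : ℝ) - 2 * (δ * T) / 3⌉₊ ⌊(η r : ℝ) - δ * T / 3⌋₊ ×ˢ
    Finset.Icc ⌈(η r : ℝ) + δ * T / 3⌉₊ ⌊(η r : ℝ) + 2 * (δ * T) / 3⌋₊ = G := ⟨_, rfl⟩
  have hGmem : ∀ p ∈ G, p ∈ goodIntervals η δ T r := by
    intro p hp
    rw [← hG, Finset.mem_product, Finset.mem_Icc, Finset.mem_Icc, Nat.ceil_le, Nat.ceil_le,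
      Nat.le_floor_iff (by linarith), Nat.le_floor_iff (by linarith)] at hp
    exact ⟨hp.1.1, hp.1.2, hp.2.1, hp.2.2⟩
  have hGsub : G ⊆ subIntervals s e := by
    intro p hp
    obtain ⟨h1, h2, h3, h4⟩ := hGmem p hp
    rw [← Finset.mem_coe, coe_subIntervals]
    have a1 : (s : ℝ) ≤ p.1 := by linarith
    have a2 : (p.1 : ℝ) < p.2 := by linarith
    have a3 : (p.2 : ℝ) ≤ e := by linarith
    exact ⟨by exact_mod_cast a1, by exact_mod_cast a2, by exact_mod_cast a3⟩
  -- Rounding loses at most one point per side, and `δ T / 3 - 1 ≥ δ T / 4` because `δ T ≥ 12`.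
  have hcardG : (δ * T / 4) ^ 2 ≤ (G.card : ℝ) := by
    rw [← hG, Finset.card_product, Nat.cast_mul, sq]
    have h1 := sub_one_le_card_Icc_ceil_floor (a := (η r : ℝ) - 2 * (δ * T) / 3)
      (b := (η r : ℝ) - δ * T / 3) (by linarith) (by linarith)
    have h2 := sub_one_le_card_Icc_ceil_floor (a := (η r : ℝ) + δ * T / 3)
      (b := (η r : ℝ) + 2 * (δ * T) / 3) (by linarith) (by linarith)
    exact mul_le_mul (by linarith) (by linarith) (by linarith) (Nat.cast_nonneg _)
  have hcardS : 2 * ((subIntervals s e).card : ℝ) ≤ (T : ℝ) ^ 2 := by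
    have h1 := two_mul_card_subIntervals_le s e
    have h2 : (e + 1 - s) * (e + 1 - s) ≤ T * T := Nat.mul_le_mul (by omega) (by omega)
    have h3 : 2 * (subIntervals s e).card ≤ T * T := h1.trans h2
    rw [sq]
    exact_mod_cast h3
  have hle : (uniformOn (subIntervals s e : Set (ℕ × ℕ))).real G
      ≤ (uniformOn (subIntervals s e : Set (ℕ × ℕ))).real (goodIntervals η δ T r) :=
    measureReal_mono (fun p hp => hGmem p hp)
  have hval : (uniformOn (subIntervals s e : Set (ℕ × ℕ))).real G
      = (G.card : ℝ) / (subIntervals s e).card := by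
    rw [measureReal_def, uniformOn_apply_finset, Finset.inter_eq_right.mpr hGsub,
      ENNReal.toReal_div, ENNReal.toReal_natCast, ENNReal.toReal_natCast]
  have hpos : (0 : ℝ) < (subIntervals s e).card := by exact_mod_cast hne.card_pos
  -- At least `δ² T² / 16` good intervals among at most `T² / 2` give `δ² / 8`, which is more than
  -- needed.
  have hfrac : δ ^ 2 / 9 ≤ (G.card : ℝ) / (subIntervals s e).card := by
    rw [le_div_iff₀ hpos]
    have h1 : δ ^ 2 / 9 * (subIntervals s e).card ≤ δ ^ 2 / 9 * ((T : ℝ) ^ 2 / 2) :=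
      mul_le_mul_of_nonneg_left (by linarith) (by positivity)
    have h2 : (δ * T / 4) ^ 2 = δ ^ 2 * (T : ℝ) ^ 2 / 16 := by ring
    have h3 : 0 ≤ δ ^ 2 * (T : ℝ) ^ 2 := by positivity
    linarith
  linarith

section
variable {Ω : Type*} [MeasurableSpace Ω] {μ : Measure Ω} {T M : ℕ} {ε : ℕ → Ω → ℝ}
  {D : ℕ → ℕ → ℕ → Ω → ℕ × ℕ}

lemma IsUniformDraws.measure_preimage (hD : IsUniformDraws μ T M ε D) {s e m : ℕ} (hs : 1 ≤ s)
    (hse : s < e) (he : e ≤ T) (hm : m < M) (G : Set (ℕ × ℕ)) :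
    μ (D s e m ⁻¹' G) = uniformOn {p : ℕ × ℕ | s ≤ p.1 ∧ p.1 < p.2 ∧ p.2 ≤ e} G := by
  have h := hD.law s e m hs hse he hm
  rw [← h.map_eq, Measure.map_apply_of_aemeasurable h.aemeasurable MeasurableSet.of_discrete]

lemma IsUniformDraws.ae_validDraws (hD : IsUniformDraws μ T M ε D) :
    ∀ᵐ ω ∂μ, ValidDraws T M (fun s e m => D s e m ω) := by
  unfold ValidDraws
  simp only [ae_all_iff]
  intro s e m hs hse he hm
  have h := hD.measure_preimage hs hse he hm {p : ℕ × ℕ | s ≤ p.1 ∧ p.1 < p.2 ∧ p.2 ≤ e}ᶜ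
  have hfin : {p : ℕ × ℕ | s ≤ p.1 ∧ p.1 < p.2 ∧ p.2 ≤ e}.Finite := by
    rw [← coe_subIntervals]
    exact Finset.finite_toSet _
  rw [(uniformOn_eq_zero_iff hfin).mpr (Set.inter_compl_self _)] at h
  exact h

/-- The probability that all draws on `[s, e]` miss the intervals that allow the detection of
`η r`. -/
lemma IsUniformDraws.measure_all_miss_le [IsProbabilityMeasure μ]
    (hD : IsUniformDraws μ T M ε D) {η : ℕ → ℕ} {δ : ℝ} {r s e : ℕ} (hδ : 0 < δ)
    (hlen : 12 ≤ δ * T) (hs1 : 1 ≤ s) (hse : s < e) (heT : e ≤ T)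
    (hs : (s : ℝ) ≤ η r - 2 * (δ * T) / 3) (he : (η r : ℝ) + 2 * (δ * T) / 3 ≤ e) :
    μ.real {ω | ∀ m < M, D s e m ω ∉ goodIntervals η δ T r} ≤ (1 - δ ^ 2 / 9) ^ M := by
  let slot : Fin M → Slot T M := fun m => ⟨(s, e, m), hs1, hse, heT, m.2⟩
  have hinj : Function.Injective slot := by
    intro a b hab
    have := congrArg (fun q : Slot T M => q.1.2.2) hab
    exact Fin.ext this
  have hind := (hD.indep.precomp hinj).measure_inter_preimage_eq_mul Finset.univ
    (sets := fun _ => (goodIntervals η δ T r)ᶜ) (fun _ _ => MeasurableSet.of_discrete)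
  have hset : {ω | ∀ m < M, D s e m ω ∉ goodIntervals η δ T r}
      = ⋂ m ∈ (Finset.univ : Finset (Fin M)), D s e m ⁻¹' (goodIntervals η δ T r)ᶜ := by
    ext ω
    simp only [Set.mem_ofPred_eq, Finset.mem_univ, Set.iInter_true, Set.mem_iInter,
      Set.mem_preimage, Set.mem_compl_iff]
    exact ⟨fun h m => h m m.2, fun h m hm => h ⟨m, hm⟩⟩
  have hind' : μ (⋂ m ∈ (Finset.univ : Finset (Fin M)), D s e m ⁻¹' (goodIntervals η δ T r)ᶜ)
      = ∏ m : Fin M, μ (D s e m ⁻¹' (goodIntervals η δ T r)ᶜ) := hind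
  rw [hset, measureReal_def, hind', ENNReal.toReal_prod]
  refine (Finset.prod_le_prod (g := fun _ => 1 - δ ^ 2 / 9)
    (fun _ _ => ENNReal.toReal_nonneg) fun m _ => ?_).trans (by simp)
  rw [hD.measure_preimage hs1 hse heT m.2]
  exact uniformOn_compl_goodIntervals_le hδ hlen hs1 hse heT hs he

end

/-! ### Counting the possible sub-domains, and the union bound. -/

lemma card_le_of_dist_le {K : Finset ℕ} {a R : ℝ} (hR : 0 ≤ R)
    (h : ∀ k ∈ K, |(k : ℝ) - a| ≤ R) : (K.card : ℝ) ≤ 2 * R + 1 := by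
  rcases K.eq_empty_or_nonempty with rfl | hne
  · simp only [Finset.card_empty, Nat.cast_zero]
    linarith
  · have hsub : K ⊆ Finset.Icc (K.min' hne) (K.max' hne) := fun k hk =>
      Finset.mem_Icc.mpr ⟨K.min'_le k hk, K.le_max' k hk⟩
    have h1 := Finset.card_le_card hsub
    rw [Nat.card_Icc] at h1
    have h2 : K.min' hne ≤ K.max' hne := K.min'_le _ (K.max'_mem hne)
    have h3 : (K.card : ℝ) ≤ (K.max' hne : ℝ) + 1 - K.min' hne := by
      have := (Nat.cast_le (α := ℝ)).mpr h1
      rwa [Nat.cast_sub (by omega), Nat.cast_add, Nat.cast_one] at this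
    have h4 := abs_le.mp (h _ (K.max'_mem hne))
    have h5 := abs_le.mp (h _ (K.min'_mem hne))
    linarith [h4.2, h5.1]

/-- The pairs of change-points with another one in between. -/
def separatedPairs (N : ℕ) : Finset (ℕ × ℕ) :=
  (Finset.range N).biUnion fun i => (Finset.Icc (i + 2) (N + 1)).map ⟨fun j => (i, j),
    fun _ _ h => (Prod.ext_iff.mp h).2⟩

lemma mem_separatedPairs {N : ℕ} {p : ℕ × ℕ} :
    p ∈ separatedPairs N ↔ p.1 + 2 ≤ p.2 ∧ p.2 ≤ N + 1 := by
  simp only [separatedPairs, Finset.mem_biUnion, Finset.mem_range, Finset.mem_map,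
    Finset.mem_Icc]
  constructor
  · rintro ⟨i, -, j, ⟨h1, h2⟩, rfl⟩
    exact ⟨h1, h2⟩
  · rintro ⟨h1, h2⟩
    exact ⟨p.1, by omega, p.2, ⟨h1, h2⟩, rfl⟩

lemma card_separatedPairs_le (N : ℕ) : ((separatedPairs N).card : ℝ) ≤ 1 / 2 * N * (N + 1) := by
  have h1 : (separatedPairs N).card ≤ ∑ i ∈ Finset.range N, (N - i) := by
    refine Finset.card_biUnion_le.trans (Finset.sum_le_sum fun i _ => ?_)
    rw [Finset.card_map, Nat.card_Icc]
    omega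
  have h2 : ∀ n : ℕ, 2 * ∑ i ∈ Finset.range n, (n - i) = n * (n + 1) := by
    intro n
    induction n with
    | zero => rfl
    | succ n ih =>
      rw [Finset.sum_range_succ']
      simp only [Nat.add_sub_add_right, Nat.sub_zero]
      rw [mul_add, ih]
      ring
  have h3 : 2 * (separatedPairs N).card ≤ N * (N + 1) := by
    rw [← h2]
    omega
  have h4 : 2 * ((separatedPairs N).card : ℝ) ≤ (N : ℝ) * (N + 1) := by exact_mod_cast h3
  linarith

namespace Regime

variable {f : ℕ → ℝ} {T N : ℕ} {η : ℕ → ℕ} {δ fT A lam : ℝ}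

lemma dist_le_radius (h : Regime f T N η δ fT A lam) {i : ℕ} (h1 : 1 ≤ i) (hi : i ≤ N) {a : ℝ}
    (ha : |a| * jumpSize f η i ^ 2 ≤ A) : |a| ≤ A / fT ^ 2 := by
  have h3 := h.fT_pos
  rw [le_div_iff₀ (by positivity)]
  have h5 : fT ^ 2 ≤ jumpSize f η i ^ 2 := pow_le_pow_left₀ h3.le (h.jumps i h1 hi) 2
  exact (mul_le_mul_of_nonneg_left h5 (abs_nonneg a)).trans ha

open scoped Classical in
lemma card_leftEnd_le (h : Regime f T N η δ fT A lam) (i : ℕ) :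
    (((Finset.Icc 1 T).filter (LeftEnd f N η A i)).card : ℝ) ≤ 2 * (A / fT ^ 2) + 1 := by
  have hR : 0 ≤ A / fT ^ 2 := div_nonneg h.A_nonneg (sq_nonneg _)
  by_cases hi : i = 0
  · refine card_le_of_dist_le (a := 1) hR fun s hs => ?_
    rcases (Finset.mem_filter.mp hs).2 with ⟨-, rfl⟩ | ⟨h1, -⟩
    · simpa using hR
    · omega
  · refine card_le_of_dist_le (a := 1 + η i) hR fun s hs => ?_
    rcases (Finset.mem_filter.mp hs).2 with ⟨h0, -⟩ | ⟨h1, h2, h3⟩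
    · exact absurd h0 hi
    · rw [← sub_sub]
      exact h.dist_le_radius h1 h2 h3

open scoped Classical in
lemma card_rightEnd_le (h : Regime f T N η δ fT A lam) (j : ℕ) :
    (((Finset.Icc 1 T).filter (RightEnd f T N η A j)).card : ℝ) ≤ 2 * (A / fT ^ 2) + 1 := by
  have hR : 0 ≤ A / fT ^ 2 := div_nonneg h.A_nonneg (sq_nonneg _)
  by_cases hj : j = N + 1
  · refine card_le_of_dist_le (a := T) hR fun s hs => ?_
    rcases (Finset.mem_filter.mp hs).2 with ⟨-, rfl⟩ | ⟨-, h1, -⟩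
    · simpa using hR
    · omega
  · refine card_le_of_dist_le (a := η j) hR fun s hs => ?_
    rcases (Finset.mem_filter.mp hs).2 with ⟨h0, -⟩ | ⟨h1, h2, h3⟩
    · exact absurd h0 hj
    · exact h.dist_le_radius h1 h2 h3

open scoped Classical in
/-- The probability that the draws on some sub-domain between accurate estimates are
unsuccessful. -/
theorem measure_not_drawsSucceed_le (h : Regime f T N η δ fT A lam) {Ω : Type*}
    [MeasurableSpace Ω] {μ : Measure Ω} [IsProbabilityMeasure μ] {M : ℕ} {ε : ℕ → Ω → ℝ}
    {D : ℕ → ℕ → ℕ → Ω → ℕ × ℕ} (hD : IsUniformDraws μ T M ε D) :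
    μ.real {ω | ¬ DrawsSucceed f T N η δ A M (fun s e m => D s e m ω)}
      ≤ 1 / 2 * N * (N + 1) * (2 * (A / fT ^ 2) + 1) ^ 2 * (1 - δ ^ 2 / 9) ^ M := by
  -- The sub-domains and the target `largestJump` depend only on the signal, so each `miss q d`
  -- concerns the independent draws of one fixed sub-domain.
  set ends : ℕ × ℕ → Finset (ℕ × ℕ) := fun q =>
    ((Finset.Icc 1 T).filter (LeftEnd f N η A q.1)) ×ˢ
      ((Finset.Icc 1 T).filter (RightEnd f T N η A q.2))
  set miss : ℕ × ℕ → ℕ × ℕ → Set Ω := fun q d =>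
    {ω | ∀ m < M, D d.1 d.2 m ω ∉ goodIntervals η δ T (largestJump f η q.1 q.2)}
  have hcover : {ω | ¬ DrawsSucceed f T N η δ A M (fun s e m => D s e m ω)}
      ⊆ ⋃ q ∈ separatedPairs N, ⋃ d ∈ ends q, miss q d := by
    intro ω hω
    simp only [Set.mem_ofPred_eq, DrawsSucceed] at hω
    push Not at hω
    obtain ⟨i, j, s, e, hij, hj, hs1, heT, hse, hs, he, hmiss⟩ := hω
    simp only [Set.mem_iUnion]
    refine ⟨(i, j), mem_separatedPairs.mpr ⟨hij, hj⟩, (s, e), ?_, hmiss⟩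
    simp only [ends, Finset.mem_product, Finset.mem_filter, Finset.mem_Icc]
    exact ⟨⟨⟨hs1, by omega⟩, hs⟩, ⟨⟨by omega, heT⟩, he⟩⟩
  have hδ := h.delta_pos
  have hbase : 0 ≤ 1 - δ ^ 2 / 9 := by nlinarith [h.delta_le_one]
  have hmiss : ∀ q ∈ separatedPairs N, ∀ d ∈ ends q,
      μ.real (miss q d) ≤ (1 - δ ^ 2 / 9) ^ M := by
    rintro ⟨i, j⟩ hq ⟨s, e⟩ hd
    simp only [ends, Finset.mem_product, Finset.mem_filter, Finset.mem_Icc] at hd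
    obtain ⟨⟨⟨hs1, -⟩, hs⟩, ⟨⟨-, heT⟩, he⟩⟩ := hd
    obtain ⟨hij, hj⟩ := mem_separatedPairs.mp hq
    simp only at hij hj
    obtain ⟨hr1, hr2, -⟩ := largestJump_spec f η hij
    have b1 := h.leftEnd_bounds hs
    have b2 := h.rightEnd_bounds he
    have g1 := h.gap hr1 (by omega)
    have g2 := h.gap hr2 hj
    have hlen := h.length
    have hse : s < e := by
      have : (s : ℝ) < e := by linarith
      exact_mod_cast this
    exact hD.measure_all_miss_le hδ hlen hs1 hse heT (by linarith) (by linarith)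
  have hR : 0 ≤ A / fT ^ 2 := div_nonneg h.A_nonneg (sq_nonneg _)
  have hends : ∀ q, ((ends q).card : ℝ) ≤ (2 * (A / fT ^ 2) + 1) ^ 2 := by
    intro q
    rw [Finset.card_product, Nat.cast_mul, sq]
    exact mul_le_mul (h.card_leftEnd_le q.1) (h.card_rightEnd_le q.2) (Nat.cast_nonneg _)
      (by linarith)
  calc μ.real {ω | ¬ DrawsSucceed f T N η δ A M (fun s e m => D s e m ω)}
      ≤ μ.real (⋃ q ∈ separatedPairs N, ⋃ d ∈ ends q, miss q d) := measureReal_mono hcover (measure_ne_top _ _)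
    _ ≤ ∑ q ∈ separatedPairs N, μ.real (⋃ d ∈ ends q, miss q d) :=
        measureReal_biUnion_finset_le _ _
    _ ≤ ∑ q ∈ separatedPairs N, (2 * (A / fT ^ 2) + 1) ^ 2 * (1 - δ ^ 2 / 9) ^ M := by
        refine Finset.sum_le_sum fun q hq => ?_
        refine (measureReal_biUnion_finset_le _ _).trans
          ((Finset.sum_le_sum (hmiss q hq)).trans ?_)
        rw [Finset.sum_const, nsmul_eq_mul]
        exact mul_le_mul_of_nonneg_right (hends q) (pow_nonneg hbase M)
    _ = (separatedPairs N).card * ((2 * (A / fT ^ 2) + 1) ^ 2 * (1 - δ ^ 2 / 9) ^ M) := by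
        rw [Finset.sum_const, nsmul_eq_mul]
    _ ≤ 1 / 2 * N * (N + 1) * ((2 * (A / fT ^ 2) + 1) ^ 2 * (1 - δ ^ 2 / 9) ^ M) :=
        mul_le_mul_of_nonneg_right (card_separatedPairs_le N)
          (mul_nonneg (sq_nonneg _) (pow_nonneg hbase M))
    _ = _ := by ring

end Regime


/-! ## The asymptotic regime -/

/-- For `κ > -1/2` a power of `T` with positive exponent beats `log T`. The constants `k₁` and `k₂`
serve the conditions `radius` and `signal` of `Regime`. -/
lemma exists_large_sample {δ fbar κ k₁ k₂ : ℝ} (hδ : 0 < δ) (hκ : -(1 / 2) < κ) (hk₁ : 0 < k₁)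
    (hk₂ : 0 < k₂) : ∃ T₀ : ℕ, ∀ T : ℕ, T₀ ≤ T → 2 ≤ T ∧ 12 ≤ δ * T ∧
      (2 * fbar) ^ 2 ≤ Real.log T ∧ Real.log T ≤ k₁ * ((T : ℝ) ^ (κ + 1 / 2)) ^ 2 ∧
      Real.log T ≤ k₂ * ((T : ℝ) ^ (κ + 1 / 2)) ^ 2 := by
  have hlog : ∀ k : ℝ, 0 < k →
      ∀ᶠ T : ℕ in Filter.atTop, Real.log T ≤ k * ((T : ℝ) ^ (κ + 1 / 2)) ^ 2 := by
    intro k hk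
    have h1 := (isLittleO_log_rpow_atTop (by linarith : 0 < 2 * (κ + 1 / 2))).bound hk
    have h2 := tendsto_natCast_atTop_atTop (R := ℝ) |>.eventually h1
    filter_upwards [h2] with T hT
    refine (le_abs_self _).trans (hT.trans (le_of_eq ?_))
    have h0 : (0 : ℝ) ≤ T := Nat.cast_nonneg T
    rw [Real.norm_of_nonneg (Real.rpow_nonneg h0 _), ← Real.rpow_natCast ((T : ℝ) ^ (κ + 1 / 2)) 2,
      ← Real.rpow_mul h0]
    norm_num
    left
    ring_nf
  have h3 : ∀ᶠ T : ℕ in Filter.atTop, 12 ≤ δ * (T : ℝ) :=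
    (tendsto_natCast_atTop_atTop.const_mul_atTop hδ).eventually_ge_atTop 12
  have h4 : ∀ᶠ T : ℕ in Filter.atTop, (2 * fbar) ^ 2 ≤ Real.log T :=
    (Real.tendsto_log_atTop.comp tendsto_natCast_atTop_atTop).eventually_ge_atTop _
  obtain ⟨T₀, hT₀⟩ := Filter.eventually_atTop.mp
    ((Filter.eventually_ge_atTop 2).and (h3.and (h4.and ((hlog k₁ hk₁).and (hlog k₂ hk₂)))))
  exact ⟨T₀, hT₀⟩

/-- The constant in the noise level `√(log T)`. -/
noncomputable def noiseConst (σ Δ : ℝ) : ℝ := σ * √(2 * (1 + Δ))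

/-- The constant in the rate of the estimation errors. -/
noncomputable def rateConst (σ δ Δ : ℝ) : ℝ := 4665600 * noiseConst σ Δ ^ 2 / δ ^ 3 + 1

/-- The constant in the bound for the CUSUM statistics without change-points. -/
noncomputable def sizeConst (σ δ Δ : ℝ) : ℝ := 2 * (noiseConst σ Δ + 2 * √(rateConst σ δ Δ))

section
variable {σ δ Δ : ℝ}

lemma noiseConst_pos (hσ : 0 < σ) (hΔ : 0 < Δ) : 0 < noiseConst σ Δ := by
  unfold noiseConst
  positivity

lemma rateConst_pos (hδ : 0 < δ) : 0 < rateConst σ δ Δ := by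
  unfold rateConst
  positivity

lemma sizeConst_pos (hσ : 0 < σ) (hΔ : 0 < Δ) : 0 < sizeConst σ δ Δ := by
  have := noiseConst_pos hσ hΔ
  unfold sizeConst
  positivity

lemma regime_of_signalAssumptions (hσ : 0 < σ) (hδ : 0 < δ) (hΔ : 0 < Δ) {fbar C κ : ℝ}
    (hC : 0 < C) {T N : ℕ} {f : ℕ → ℝ} {η : ℕ → ℕ} {fT : ℝ}
    (hf : SignalAssumptions f T N η δ fbar C κ fT) (hT : 2 ≤ T) (hlen : 12 ≤ δ * T)
    (hfbar : (2 * fbar) ^ 2 ≤ Real.log T)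
    (h₁ : Real.log T ≤ δ * C ^ 2 / (12 * rateConst σ δ Δ) * ((T : ℝ) ^ (κ + 1 / 2)) ^ 2)
    (h₂ : Real.log T ≤ (δ ^ 2 * √δ * C / (5760 * sizeConst σ δ Δ)) ^ 2
      * ((T : ℝ) ^ (κ + 1 / 2)) ^ 2) :
    Regime f T N η δ fT (rateConst σ δ Δ * Real.log T) (noiseConst σ Δ * √(Real.log T)) := by
  have hT0 : (0 : ℝ) < T := by
    have : 0 < T := by omega
    exact_mod_cast this
  have hlog : 0 < Real.log T := Real.log_pos (by exact_mod_cast hT)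
  have hn := noiseConst_pos hσ hΔ
  have hr := rateConst_pos (σ := σ) (Δ := Δ) hδ
  have hz := sizeConst_pos (δ := δ) hσ hΔ
  have hpow : (0 : ℝ) < (T : ℝ) ^ κ := Real.rpow_pos_of_pos hT0 κ
  have hfT : 0 < fT := (mul_pos hC hpow).trans_le hf.rate
  have hX : (T : ℝ) ^ (κ + 1 / 2) = (T : ℝ) ^ κ * √T := by
    rw [Real.rpow_add hT0, Real.sqrt_eq_rpow]
  have hCX : C * (T : ℝ) ^ (κ + 1 / 2) ≤ fT * √T := by
    rw [hX, ← mul_assoc]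
    exact mul_le_mul_of_nonneg_right hf.rate (Real.sqrt_nonneg _)
  set X := (T : ℝ) ^ (κ + 1 / 2)
  have hX0 : 0 < X := Real.rpow_pos_of_pos hT0 _
  have hcp := hf.changePoints
  have hmono : ∀ a b, a ≤ b → b ≤ N + 1 → η a ≤ η b := by
    intro a b hab
    induction b, hab using Nat.le_induction with
    | base => intro; exact le_rfl
    | succ b hab ih => exact fun hb => (ih (by omega)).trans (hcp.lt_succ b (by omega)).le
  refine ⟨hcp, hf.spacing, hf.jumps, hδ, ?_, hfT, ?_, ?_, ?_, ?_, hlen, ?_⟩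
  · have h1 := hf.spacing 1 le_rfl (by omega)
    rw [Nat.sub_self, hcp.zero] at h1
    have h2 := hmono 1 (N + 1) (by omega) le_rfl
    rw [hcp.last] at h2
    have h3 : (η 1 : ℝ) ≤ T + 1 := by exact_mod_cast h2
    push_cast at h1
    refine le_of_mul_le_mul_right ?_ hT0
    linarith
  · exact mul_pos hn (Real.sqrt_pos.mpr hlog)
  · exact (mul_pos hr hlog).le
  · intro i hi hiN
    have e1 := hmono 1 i hi (by omega)
    have e2 := hmono (i + 1) (N + 1) (by omega) le_rfl
    have e3 := hcp.lt_succ 0 (by omega)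
    have e4 := hcp.lt_succ i hiN
    rw [hcp.zero, zero_add] at e3
    rw [hcp.last] at e2
    have h1 := abs_le.mp (hf.bounded (η i) (by omega) (by omega))
    have h2 := abs_le.mp (hf.bounded (η i - 1) (by omega) (by omega))
    -- For large `T` the squared jump is at most `log T`, which the summand 1 in `rateConst` covers.
    -- So `fbar` affects `T₀` but not the constants.
    have h3 : jumpSize f η i ≤ 2 * fbar := by
      unfold jumpSize
      rw [abs_le]
      constructor <;> linarith [h1.1, h1.2, h2.1, h2.2]
    have h4 : jumpSize f η i ^ 2 ≤ (2 * fbar) ^ 2 := pow_le_pow_left₀ (abs_nonneg _) h3 2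
    have h5 : 4665600 * (noiseConst σ Δ * √(Real.log T)) ^ 2 / δ ^ 3
        = (rateConst σ δ Δ - 1) * Real.log T := by
      rw [mul_pow, Real.sq_sqrt hlog.le, rateConst]
      ring
    rw [h5]
    linarith
  · have h3 : (C * X) ^ 2 ≤ (fT * √T) ^ 2 := pow_le_pow_left₀ (mul_pos hC hX0).le hCX 2
    rw [mul_pow fT, Real.sq_sqrt hT0.le] at h3
    rw [div_mul_eq_mul_div, le_div_iff₀ (by positivity)] at h₁
    have h4 := mul_le_mul_of_nonneg_left h3 hδ.le
    rw [mul_pow] at h4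
    linarith
  · have h3 : √(Real.log T) ≤ δ ^ 2 * √δ * C / (5760 * sizeConst σ δ Δ) * X := by
      rw [← mul_pow] at h₂
      have := Real.sqrt_le_sqrt h₂
      rwa [Real.sqrt_sq (by positivity)] at this
    rw [div_mul_eq_mul_div, le_div_iff₀ (by positivity)] at h3
    rw [Real.sqrt_mul hr.le]
    have h4 : δ ^ 2 * √δ * (C * X) ≤ δ ^ 2 * √δ * (fT * √T) :=
      mul_le_mul_of_nonneg_left hCX (by positivity)
    have h5 : 5760 * (√(Real.log T) * sizeConst σ δ Δ)
        = 5 * (2304 * (noiseConst σ Δ * √(Real.log T) + 2 * (√(rateConst σ δ Δ) * √(Real.log T))))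
        := by
      unfold sizeConst
      ring
    linarith

end

lemma sumsBounded_of_mem_noiseEvent {Ω : Type*} {T : ℕ} {σ Δ : ℝ} {ε : ℕ → Ω → ℝ} {ω : Ω}
    (hΔ : 0 < Δ) (h : ω ∈ noiseEvent T σ Δ ε) :
    SumsBounded (fun t => ε t ω) 1 T (noiseConst σ Δ * √(Real.log T)) := by
  intro l m hl hlm hm
  have h1 := h l m hl hlm hm
  have h2 := Real.sqrt_pos.mpr (left_length_pos hlm)
  rw [inv_mul_le_iff₀ h2, Real.sqrt_mul (by positivity), ← mul_assoc σ] at h1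
  rw [noiseConst]
  linarith

theorem measure_goodEvent_ge {σ δ Δ : ℝ} (hσ : 0 < σ) (hδ : 0 < δ) (hΔ : 0 < Δ) {fbar C κ : ℝ}
    (hC : 0 < C) (hκ : -(1 / 2) < κ) :
    ∃ T₀ : ℕ, ∀ (T M N : ℕ) (f : ℕ → ℝ) (η : ℕ → ℕ) (fT : ℝ),
      T₀ ≤ T → 1 ≤ M → SignalAssumptions f T N η δ fbar C κ fT →
      ∀ {Ω : Type*} [MeasurableSpace Ω] (μ : Measure Ω) [IsProbabilityMeasure μ]
        (ε : ℕ → Ω → ℝ) (D : ℕ → ℕ → ℕ → Ω → ℕ × ℕ), IsUniformDraws μ T M ε D →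
        1 - (1 - μ.real (noiseEvent T σ Δ ε))
            - (1 / 2) * N * (N + 1) * (2 * rateConst σ δ Δ * (fT ^ 2)⁻¹ * Real.log T + 1) ^ 2
              * (1 - δ ^ 2 / 9) ^ M
          ≤ μ.real (goodEvent f T M N η fT (rateConst σ δ Δ) (sizeConst σ δ Δ) (√δ / 5) ε D) := by
  have hr := rateConst_pos (σ := σ) (Δ := Δ) hδ
  have hz := sizeConst_pos (δ := δ) hσ hΔ
  obtain ⟨T₀, hT₀⟩ := exists_large_sample (fbar := fbar) hδ hκ
    (k₁ := δ * C ^ 2 / (12 * rateConst σ δ Δ))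
    (k₂ := (δ ^ 2 * √δ * C / (5760 * sizeConst σ δ Δ)) ^ 2) (by positivity) (by positivity)
  refine ⟨T₀, fun T M N f η fT hT hM hf Ω _ μ _ ε D hD => ?_⟩
  obtain ⟨t1, t2, t3, t4, t5⟩ := hT₀ T hT
  have h := regime_of_signalAssumptions hσ hδ hΔ hC hf t1 t2 t3 t4 t5
  set A := rateConst σ δ Δ * Real.log T with hA
  set bad := {ω | ¬ DrawsSucceed f T N η δ A M (fun s e m => D s e m ω)}
  set invalid := {ω | ¬ ValidDraws T M (fun s e m => D s e m ω)}
  have hinv : μ.real invalid = 0 := by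
    have : μ invalid = 0 := hD.ae_validDraws
    rw [measureReal_def, this, ENNReal.toReal_zero]
  have hbad : μ.real bad ≤ _ := h.measure_not_drawsSucceed_le hD
  set good := goodEvent f T M N η fT (rateConst σ δ Δ) (sizeConst σ δ Δ) (√δ / 5) ε D
  -- Only monotonicity and subadditivity of the measure are used, so `good` need not be measurable
  -- although it quantifies over all tie-breaking rules.
  have hcover : noiseEvent T σ Δ ε ⊆ good ∪ (bad ∪ invalid) := by
    intro ω hω
    by_cases hb : ω ∈ bad
    · exact Or.inr (Or.inl hb)
    by_cases hi : ω ∈ invalid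
    · exact Or.inr (Or.inr hi)
    refine Or.inl fun tie => ?_
    refine h.goodPath (sumsBounded_of_mem_noiseEvent hΔ hω) hM (not_not.mp hi) (not_not.mp hb) tie
      hA (le_of_eq ?_)
    rw [hA, Real.sqrt_mul hr.le, sizeConst]
    ring
  have h1 : μ.real (noiseEvent T σ Δ ε) ≤ μ.real good + (μ.real bad + μ.real invalid) :=
    (measureReal_mono hcover (measure_ne_top _ _)).trans ((measureReal_union_le _ _).trans
      (add_le_add le_rfl (measureReal_union_le _ _)))
  rw [hinv, add_zero] at h1
  have h2 : 2 * rateConst σ δ Δ * (fT ^ 2)⁻¹ * Real.log T = 2 * (A / fT ^ 2) := by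
    rw [hA]
    ring
  rw [h2]
  linarith


end WBS2


theorem theorem1 :
    -- (i) completeness of the solution path
    (∀ (x : ℕ → ℝ) (T M : ℕ) (draw : ℕ → ℕ → ℕ → ℕ × ℕ) (tie : Entry → Entry → Bool),
      1 ≤ T → 1 ≤ M → ValidDraws T M draw →
        (wbs2 x T M draw tie).val.length = T - 1) ∧
    -- (ii) computational complexity
    (∃ K : ℕ, ∀ (x : ℕ → ℝ) (T M : ℕ) (draw : ℕ → ℕ → ℕ → ℕ × ℕ) (tie : Entry → Entry → Bool),
      2 ≤ T → 1 ≤ M → ValidDraws T M draw →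
        (wbs2 x T M draw tie).steps ≤ K * (M * numScales x T M draw tie * T)) ∧
    -- (iii) the first candidates and the sizes of the CUSUMs
    (∀ σ δ Δ : ℝ, 0 < σ → 0 < δ → 0 < Δ →
      ∃ C₁ C₂ c₀ : ℝ, 0 < C₁ ∧ 0 < C₂ ∧ 0 < c₀ ∧
        ∀ fbar C κ : ℝ, 0 < C → -(1 / 2) < κ →
          ∃ T₀ : ℕ, ∀ (T M N : ℕ) (f : ℕ → ℝ) (η : ℕ → ℕ) (fT : ℝ),
            T₀ ≤ T → 1 ≤ M → SignalAssumptions f T N η δ fbar C κ fT →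
            ∀ {Ω : Type*} [MeasurableSpace Ω] (μ : Measure Ω)
              [IsProbabilityMeasure μ]
              (ε : ℕ → Ω → ℝ) (D : ℕ → ℕ → ℕ → Ω → ℕ × ℕ),
              IsGaussianNoise μ T σ ε → IsUniformDraws μ T M ε D →
              1 - (1 - μ.real (noiseEvent T σ Δ ε))
                  - (1 / 2) * N * (N + 1) * (2 * C₁ * (fT ^ 2)⁻¹ * Real.log T + 1) ^ 2
                    * (1 - δ ^ 2 / 9) ^ M
                ≤ μ.real (goodEvent f T M N η fT C₁ C₂ c₀ ε D)) := by
  refine ⟨fun x T M draw tie _ hM hv => wbs2_length hM hv,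
    ⟨64, fun x T M draw tie hT hM hv => wbs2_steps_le hT hM hv⟩, ?_⟩
  intro σ δ Δ hσ hδ hΔ
  refine ⟨rateConst σ δ Δ, sizeConst σ δ Δ, √δ / 5, rateConst_pos hδ, sizeConst_pos hσ hΔ,
    by positivity, fun fbar C κ hC hκ => ?_⟩
  obtain ⟨T₀, hT₀⟩ := measure_goodEvent_ge (fbar := fbar) hσ hδ hΔ hC hκ
  exact ⟨T₀, fun T M N f η fT hT hM hf Ω _ μ _ ε D _ hD => hT₀ T M N f η fT hT hM hf μ ε D hD⟩
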